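/- Fix an integer $d\ge 1$. For a matrix $V:\mathbb{C}^N\to\mathbb{C}^N\otimes\mathbb{C}^d$ let $$\mathcal{E}'_V(\rho):=\operatorname{Tr}_{\mathrm{anc}}[V\rho V^\dagger],\qquad H_V:=\begin{pmatrix}0&V\\V^\dagger&0\end{pmatrix},\qquad \mathcal{E}_V(\rho):=\operatorname{Tr}_{\mathrm{anc}}\big[e^{-iH_V\pi/2}\,(|d\rangle\langle d|\otimes\rho)\,e^{iH_V\pi/2}\big].$$ Here $H_V$ acts on $(\mathbb{C}^N\otimes\mathbb{C}^d)\oplus\mathbb{C}^N=\mathbb{C}^N\otimes\mathbb{C}^{d+1}$, where the last summand is $\mathbb{C}^N\otimes|d\rangle$ with $|d\rangle$ the $(d+1)$st basis state of the ancilla $\mathbb{C}^{d+1}$, and $\operatorname{Tr}_{\mathrm{anc}}$ traces out the ancilla ($\mathbb{C}^d$, resp. $\mathbb{C}^{d+1}$). There are a constant $C$ and a polynomial $p$, depending only on $d$, such that the following holds for all $N,s\ge 0$ and all $\varepsilon\ge0$. Consider the matrices $V$ that have at most $s$ nonzero entries in each row and in each column and that satisfy $\|V^\dagger V-I\|\le\varepsilon$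 in spectral norm. 1. For every such $V$, $\mathcal{E}_V$ is a quantum operation (completely positive and trace preserving), and $\|\mathcal{E}_V-\mathcal{E}'_V\|_\diamond\le C\varepsilon$. 2. $\mathcal{E}_V$ can be implemented efficiently: for every $\delta>0$ there is a single quantum circuit, which uses at most $p(s,\log N,\varepsilon,1/\delta)$ 2-qubit gates, black-box queries and ancilla qubits, such that for every such $V$, when the queries are answered by any black box for $V$, the circuit implements a quantum operation within diamond distance $\delta$ of $\mathcal{E}_V$. In 2, a black box for $V$ takes a column index or a row index as input and outputs a list, in any order, of all nonzero entries of that column or row together with their positions; the values are given in fixed-point binary with a number of digits that is chosen by the circuit and is also at most $p(s,\log N,\varepsilon,1/\delta)$. States on $\mathbb{C}^N$ are encoded in binary on $\lceil\log_2N\rceil$ qubits; the circuit starts with the encoded input and ancilla qubits in state $|0\rangle$, applies its gates and queries, and discards the ancilla qubits. In particular, taking $\delta=\varepsilon$ for $0<\varepsilon\le1$, the map $\mathcal{E}'_V$ is approximated within diamond distance $O(\varepsilon)$ by a quantum operation that uses $\mathrm{poly}(s,\log N,1/\varepsilon)$ gates and queries. -/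

import Mathlib

open scoped Matrix Kronecker ENNReal ComplexOrder

noncomputable section

namespace SparseIsometry

/-! ### Superoperators, trace norm, diamond norm -/

/-- The trace norm `‖A‖₁ = Tr √(A† A)`: the sum of the singular values of `A`, i.e. of the square
roots of the eigenvalues of `A† A`. -/
def traceNorm {ι : Type*} [Fintype ι] [DecidableEq ι] (A : Matrix ι ι ℂ) : ℝ :=
  ∑ i, √((Matrix.isHermitian_conjTranspose_mul_self A).eigenvalues i)

/-- The superoperator `T ⊗ id` on operators on `ℂ^ι ⊗ ℂ^γ`. -/
def ampliate {ι κ : Type*} (γ : Type*) (T : Matrix ι ι ℂ →ₗ[ℂ] Matrix κ κ ℂ)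
    (X : Matrix (ι × γ) (ι × γ) ℂ) : Matrix (κ × γ) (κ × γ) ℂ :=
  Matrix.of fun p q => T (Matrix.of fun x y => X (x, p.2) (y, q.2)) p.1 q.1

/-- The diamond norm of `T : L(ℂ^ι) → L(ℂ^κ)`, namely `sup_{‖X‖₁ = 1} ‖(T ⊗ id)(X)‖₁` with an
ancilla of the same dimension as the input space. -/
def diamondNorm {ι κ : Type*} [Fintype ι] [DecidableEq ι] [Fintype κ] [DecidableEq κ]
    (T : Matrix ι ι ℂ →ₗ[ℂ] Matrix κ κ ℂ) : ℝ≥0∞ :=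
  ⨆ X : Matrix (ι × ι) (ι × ι) ℂ, ⨆ _ : traceNorm X = 1,
    ENNReal.ofReal (traceNorm (ampliate ι T X))

/-- Quantum operations: completely positive trace-preserving linear maps. -/
def IsQuantumOperation {ι κ : Type*} [Fintype ι] [Fintype κ]
    (T : Matrix ι ι ℂ →ₗ[ℂ] Matrix κ κ ℂ) : Prop :=
  (∀ (k : ℕ) (X : Matrix (ι × Fin k) (ι × Fin k) ℂ), X.PosSemidef →
    (ampliate (Fin k) T X).PosSemidef) ∧
  ∀ ρ, (T ρ).trace = ρ.trace

/-- The partial trace over the second tensor factor (the ancilla). -/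
def traceAnc {α κ : Type*} [Fintype κ] :
    Matrix (α × κ) (α × κ) ℂ →ₗ[ℂ] Matrix α α ℂ where
  toFun X := Matrix.of fun x y => ∑ a, X (x, a) (y, a)
  map_add' X Y := by ext x y; simp [Finset.sum_add_distrib]
  map_smul' c X := by ext x y; simp [Finset.mul_sum]

/-- The map `ρ ↦ A ρ B`. -/
def sandwich {α β : Type*} [Fintype β] (A : Matrix α β ℂ) (B : Matrix β α ℂ) :
    Matrix β β ℂ →ₗ[ℂ] Matrix α α ℂ where
  toFun ρ := A * ρ * B
  map_add' X Y := by rw [Matrix.mul_add, Matrix.add_mul]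
  map_smul' c X := by simp

/-- The map `ρ ↦ Tr_anc [V ρ V†]` for `V : ℂ^β → ℂ^α ⊗ ℂ^κ`. -/
def stinespring {α κ β : Type*} [Fintype κ] [Fintype β] (V : Matrix (α × κ) β ℂ) :
    Matrix β β ℂ →ₗ[ℂ] Matrix α α ℂ :=
  traceAnc ∘ₗ sandwich V Vᴴ

/-- The spectral (operator) norm of a square matrix. -/
def spectralNorm {ι : Type*} [Fintype ι] [DecidableEq ι] (A : Matrix ι ι ℂ) : ℝ :=
  ‖Matrix.toEuclideanCLM (n := ι) (𝕜 := ℂ) A‖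

/-- Every row and every column of `V` has at most `s` nonzero entries. -/
def RowColSparse {ι κ : Type*} [Fintype ι] [Fintype κ] (V : Matrix ι κ ℂ) (s : ℕ) : Prop :=
  (∀ r, {x | V r x ≠ 0}.ncard ≤ s) ∧ ∀ x, {r | V r x ≠ 0}.ncard ≤ s

/-! ### The evolution under the block Hamiltonian -/

/-- The identification of the block space `(ℂ^N ⊗ ℂ^d) ⊕ ℂ^N` with `ℂ^N ⊗ ℂ^(d+1)`. The ancilla
basis of `ℂ^(d+1)` is indexed by `Fin d ⊕ Unit`; its last vector, `inr ()`, is the state `|d⟩`,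
and the block `ℂ^N` is `ℂ^N ⊗ |d⟩`. -/
def blockEquiv (N d : ℕ) : (Fin N × Fin d) ⊕ Fin N ≃ Fin N × (Fin d ⊕ Unit) where
  toFun := Sum.elim (fun p => (p.1, Sum.inl p.2)) (fun x => (x, Sum.inr ()))
  invFun p := Sum.elim (fun a => Sum.inl (p.1, a)) (fun _ => Sum.inr p.1) p.2
  left_inv := by rintro (⟨x, a⟩ | x) <;> rfl
  right_inv := by rintro ⟨x, a | u⟩ <;> rfl

/-- The Hamiltonian `H = [[0, V], [V†, 0]]` on `ℂ^N ⊗ ℂ^(d+1)`. -/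
def blockHamiltonian {N d : ℕ} (V : Matrix (Fin N × Fin d) (Fin N) ℂ) :
    Matrix (Fin N × (Fin d ⊕ Unit)) (Fin N × (Fin d ⊕ Unit)) ℂ :=
  Matrix.reindex (blockEquiv N d) (blockEquiv N d) (Matrix.fromBlocks 0 V Vᴴ 0)

/-- The map `ρ ↦ ρ ⊗ |d⟩⟨d|` attaching the ancilla in its last basis state. -/
def attachLast (N d : ℕ) :
    Matrix (Fin N) (Fin N) ℂ →ₗ[ℂ]
      Matrix (Fin N × (Fin d ⊕ Unit)) (Fin N × (Fin d ⊕ Unit)) ℂ where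
  toFun ρ := ρ ⊗ₖ Matrix.single (Sum.inr ()) (Sum.inr ()) 1
  map_add' X Y := Matrix.add_kronecker X Y _
  map_smul' c X := Matrix.smul_kronecker c X _

/-- The map `ρ ↦ Tr_anc [e^{-iHπ/2} (ρ ⊗ |d⟩⟨d|) e^{iHπ/2}]`, where `H` is the block Hamiltonian
of `V`. -/
def evolutionOp {N d : ℕ} (V : Matrix (Fin N × Fin d) (Fin N) ℂ) :
    Matrix (Fin N) (Fin N) ℂ →ₗ[ℂ] Matrix (Fin N) (Fin N) ℂ :=
  traceAnc ∘ₗ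
    sandwich (NormedSpace.exp ((-(Complex.I * (Real.pi / 2 : ℝ))) • blockHamiltonian V))
      (NormedSpace.exp ((Complex.I * (Real.pi / 2 : ℝ)) • blockHamiltonian V)) ∘ₗ
    attachLast N d

/-! ### Black-box access to a sparse matrix -/

/-- The number of qubits of a register that holds an element of `{0, …, M-1}`. -/
abbrev qubits (M : ℕ) : ℕ := Nat.clog 2 M

/-- Binary representation. -/
def bits (M : ℕ) (x : Fin M) : Fin (qubits M) → Bool := fun i => x.val.testBit i

theorem bits_injective (M : ℕ) : Function.Injective (bits M) := by
  intro x y h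
  apply Fin.ext
  apply Nat.eq_of_testBit_eq
  intro i
  by_cases hi : i < Nat.clog 2 M
  · exact congrFun h ⟨i, hi⟩
  · have hM : M ≤ 2 ^ i :=
      (Nat.le_pow_clog (by norm_num) M).trans (Nat.pow_le_pow_right (by norm_num) (by omega))
    rw [Nat.testBit_lt_two_pow (x.2.trans_le hM), Nat.testBit_lt_two_pow (y.2.trans_le hM)]

/-- Binary representation of a basis state of `ℂ^N ⊗ ℂ^d`. -/
def rowBits (N d : ℕ) (r : Fin N × Fin d) : Fin (qubits N) ⊕ Fin (qubits d) → Bool :=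
  Sum.elim (bits N r.1) (bits d r.2)

/-- A black box for the nonzero entries of `V`: given a column index (or a row index), it outputs
a list, in arbitrary order and without repetitions, of the positions of all nonzero entries in
that column (row). The list has `s` slots; unused slots hold `none`. -/
structure BlackBox {N d : ℕ} (V : Matrix (Fin N × Fin d) (Fin N) ℂ) (s : ℕ) where
  col : Fin N → Fin s → Option (Fin N × Fin d)
  row : Fin N × Fin d → Fin s → Option (Fin N)
  col_spec : ∀ x r, V r x ≠ 0 ↔ ∃ i, col x i = some r
  row_spec : ∀ r x, V r x ≠ 0 ↔ ∃ i, row r i = some x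
  col_inj : ∀ x i j r, col x i = some r → col x j = some r → i = j
  row_inj : ∀ r i j x, row r i = some x → row r j = some x → i = j

/-- The output bits of one slot of an answer of the black box: a flag telling whether the slot is
used, the position of the entry (with bits labelled by `P`), and the real and imaginary parts of
the value, with `b` fractional bits and `2 * b` bits altogether. -/
inductive SlotBit (P : Type) (b : ℕ) : Type
  | flag
  | pos (i : P)
  | re (t : Fin (2 * b))
  | im (t : Fin (2 * b))

open Classical in
/-- Bit `t` of the fixed-point (two's complement) representation of `x` with `b` fractional
bits. -/
def fixedPointBit (b : ℕ) (x : ℝ) (t : ℕ) : Bool :=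
  decide (Odd (⌊(2 : ℝ) ^ b * x⌋ / (2 : ℤ) ^ t))

/-- The content of a used slot for an entry of value `z` whose position has binary representation
`p`. -/
def slotContent {P : Type} {b : ℕ} (p : P → Bool) (z : ℂ) : SlotBit P b → Bool
  | .flag => true
  | .pos i => p i
  | .re t => fixedPointBit b z.re t
  | .im t => fixedPointBit b z.im t

open Classical in
/-- The answer to a column query with input bits `u` (all output bits are zero when `u` does not
represent an index, and in unused slots). -/
def colAnswer {N d s : ℕ} {V : Matrix (Fin N × Fin d) (Fin N) ℂ} (B : BlackBox V s) (b : ℕ)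
    (u : Fin (qubits N) → Bool)
    (o : Fin s × SlotBit (Fin (qubits N) ⊕ Fin (qubits d)) b) : Bool :=
  decide (∃ x r, bits N x = u ∧ B.col x o.1 = some r ∧
    slotContent (rowBits N d r) (V r x) o.2 = true)

open Classical in
/-- The answer to a row query with input bits `u`. -/
def rowAnswer {N d s : ℕ} {V : Matrix (Fin N × Fin d) (Fin N) ℂ} (B : BlackBox V s) (b : ℕ)
    (u : Fin (qubits N) ⊕ Fin (qubits d) → Bool)
    (o : Fin s × SlotBit (Fin (qubits N)) b) : Bool :=
  decide (∃ r x, rowBits N d r = u ∧ B.row r o.1 = some x ∧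
    slotContent (bits N x) (V r x) o.2 = true)

/-! ### Quantum circuits with black-box queries -/

/-- The elementary steps of a circuit on qubits labelled by `W`: an arbitrary 2-qubit gate, or a
query to the black box. A query names the distinct qubits that hold its input (`inl`) and those
that receive its output (`inr`). -/
inductive Gate (W : Type) (N d s b : ℕ) : Type
  | twoQubit (i j : W) (hij : i ≠ j) (U : Matrix.unitaryGroup (Bool × Bool) ℂ)
  | colQuery
      (w : Fin (qubits N) ⊕ (Fin s × SlotBit (Fin (qubits N) ⊕ Fin (qubits d)) b) ↪ W)
  | rowQuery
      (w : (Fin (qubits N) ⊕ Fin (qubits d)) ⊕ (Fin s × SlotBit (Fin (qubits N)) b) ↪ W)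

open Classical in
/-- The unitary `|u⟩|z⟩ ↦ |u⟩|z ⊕ F(u)⟩`, where `u` is the content of the qubits `w (inl _)` and
`z` the content of the qubits `w (inr _)`. -/
def queryMatrix {W I O : Type} (w : I ⊕ O ↪ W) (F : (I → Bool) → O → Bool) :
    Matrix (W → Bool) (W → Bool) ℂ :=
  Matrix.of fun g f =>
    if g = fun v => xor (f v)
      (decide (∃ o, w (Sum.inr o) = v ∧ F (fun i => f (w (Sum.inl i))) o = true))
    then 1 else 0

open Classical in
/-- The matrix of an elementary step in the computational basis. -/
def Gate.matrix {W : Type} {N d s b : ℕ} {V : Matrix (Fin N × Fin d) (Fin N) ℂ}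
    (B : BlackBox V s) : Gate W N d s b → Matrix (W → Bool) (W → Bool) ℂ
  | .twoQubit i j _ U => Matrix.of fun g f =>
      if ∀ v, v ≠ i → v ≠ j → g v = f v then
        (U : Matrix (Bool × Bool) (Bool × Bool) ℂ) (g i, g j) (f i, f j)
      else 0
  | .colQuery w => queryMatrix w (colAnswer B b)
  | .rowQuery w => queryMatrix w (rowAnswer B b)

/-- The qubits of a circuit: a system register for `ℂ^N`, and `k` ancilla qubits. -/
abbrev Wires (N k : ℕ) : Type := Fin (qubits N) ⊕ Fin k

/-- A circuit: the list of its steps, the first one being applied first. It does not depend on the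
matrix `V`, which it can only access through the queries. -/
abbrev Circuit (N d s b k : ℕ) : Type := List (Gate (Wires N k) N d s b)

/-- The unitary implemented by a circuit. -/
def Circuit.matrix {N d s b k : ℕ} {V : Matrix (Fin N × Fin d) (Fin N) ℂ} (B : BlackBox V s) :
    Circuit N d s b k → Matrix (Wires N k → Bool) (Wires N k → Bool) ℂ
  | [] => 1
  | g :: c => Circuit.matrix B c * Gate.matrix B g

/-- The isometry `|x⟩ ↦ |bits of x⟩` from `ℂ^N` to the system register. -/
def encoding (N : ℕ) : Matrix (Fin (qubits N) → Bool) (Fin N) ℂ :=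
  Matrix.of fun f x => if f = bits N x then 1 else 0

/-- The isometry `|x⟩ ↦ |bits of x⟩|0…0⟩`, which prepares the input of a circuit. -/
def inputMatrix (N k : ℕ) : Matrix (Wires N k → Bool) (Fin N) ℂ :=
  Matrix.of fun f x => if f = Sum.elim (bits N x) (fun _ => false) then 1 else 0

/-- The quantum operation implemented by a circuit: encode the input state in the system register,
set the ancilla qubits to zero, run the circuit, and discard the ancilla qubits. -/
def Circuit.op {N d s b k : ℕ} {V : Matrix (Fin N × Fin d) (Fin N) ℂ} (B : BlackBox V s)
    (c : Circuit N d s b k) :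
    Matrix (Fin N) (Fin N) ℂ →ₗ[ℂ]
      Matrix (Fin (qubits N) → Bool) (Fin (qubits N) → Bool) ℂ :=
  stinespring (Matrix.reindex (Equiv.sumArrowEquivProdArrow (Fin (qubits N)) (Fin k) Bool)
    (Equiv.refl (Fin N)) (Circuit.matrix B c * inputMatrix N k))

/-- The operation `ρ ↦ J (T ρ) J†`, which performs `T` and writes the result, encoded by the
isometry `J`, in the system register. -/
def encoded {N : ℕ} (T : Matrix (Fin N) (Fin N) ℂ →ₗ[ℂ] Matrix (Fin N) (Fin N) ℂ) :
    Matrix (Fin N) (Fin N) ℂ →ₗ[ℂ]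
      Matrix (Fin (qubits N) → Bool) (Fin (qubits N) → Bool) ℂ :=
  sandwich (encoding N) (encoding N)ᴴ ∘ₗ T

end SparseIsometry

end

/-!
Both parts compare channels through their Stinespring matrices: by trace-norm duality, channels with
Stinespring matrices `W` and `W'` differ in diamond norm by at most `‖W - W'‖ * (‖W‖ + ‖W'‖)`
(`diamondNorm_stinespring_sub_le`).

*The evolution.* Let `A` attach the ancilla in its last state, and let `H` be the block Hamiltonian.
Then `H ^ 2 - 1` acts as `V† V - 1` on the range of `A`, while `H` sends that range to `V`, and
`exp (-iπH/2) + iH = Q (H ^ 2 - 1)` with `Q` bounded. Hence `exp (-iπH/2) A` is within `O(ε)` of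
`-i V` (`diamondNorm_evolutionOp_sub_le`).

*The circuit.* The slots of the black box decompose `V` without any colouring of the graph of
nonzero entries: every nonzero entry stands in exactly one slot `i` of its column and one slot
`j` of its row, and for fixed `(i, j)` these entries form a matching of rows and columns. Taking
the entries bit by bit, the rounded matrix is a sum of real multiples of matching matrices whose
nonzero entries are all `1`, or all `i` (`norm_blockHamiltonian_sub_sum_terms_le`). The Hamiltonian `h` of
such a term satisfies `h ^ 3 = h`, so `exp (-iτh) = 1 + (cos τ - 1) h ^ 2 - i sin τ h`, and this
is implemented without error (`stepCircuit_mul_basisMatrix`): a flag qubit tells rows from columns;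
self-inverse queries and comparisons load the candidate partner and write the conjunction "the two
are matched and the bit is set" in an accumulator, a controlled rotation of the flag is applied, and
everything is uncomputed. The first-order product formula (`norm_rounds_sub_exp_le`) then gives the
evolution under `H`; its error is of second order in the sum of the coefficients, at most
`2 s ^ 2 2 ^ b`, so the number of rounds is polynomial in `s`, `2 ^ b` and `1 / δ`. Since the
evolution need only be accurate to `δ`, `b` is logarithmic in `s`, `ε` and `1 / δ`, and `2 ^ b` is
polynomial. At the end the ancilla index of `ℂ^(d+1)` stays in the discarded qubits, while the
`ℂ^N` part of the position moves to the system register (`circuit_op_eq_stinespring`).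
-/

noncomputable section

namespace SparseIsometry

open scoped Matrix.Norms.L2Operator

/-! ### Operator norms of matrices -/

section OperatorNorm

variable {m n l : Type*} [Fintype m] [Fintype n]

theorem l2_opNorm_le_bound [DecidableEq n] (A : Matrix m n ℂ) {c : ℝ} (hc : 0 ≤ c)
    (h : ∀ x : n → ℂ, ‖WithLp.toLp 2 (A *ᵥ x)‖ ≤ c * ‖WithLp.toLp 2 x‖) : ‖A‖ ≤ c := by
  rw [Matrix.l2_opNorm_def]
  exact ContinuousLinearMap.opNorm_le_bound _ hc fun x => h x.ofLp

theorem norm_mulVec_le [DecidableEq n] (A : Matrix m n ℂ) (x : n → ℂ) :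
    ‖WithLp.toLp 2 (A *ᵥ x)‖ ≤ ‖A‖ * ‖WithLp.toLp 2 x‖ :=
  A.l2_opNorm_mulVec (WithLp.toLp 2 x)

theorem norm_one_le [DecidableEq n] : ‖(1 : Matrix n n ℂ)‖ ≤ 1 := by
  rw [← Matrix.diagonal_one, Matrix.l2_opNorm_diagonal]
  exact (pi_norm_le_iff_of_nonneg zero_le_one).2 fun i => by simp

theorem norm_le_of_conjTranspose_mul_self [DecidableEq n] (A : Matrix m n ℂ) {c : ℝ} (hc : 0 ≤ c)
    (h : ‖Aᴴ * A‖ ≤ c ^ 2) : ‖A‖ ≤ c := by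
  rw [Matrix.l2_opNorm_conjTranspose_mul_self, ← sq] at h
  exact (sq_le_sq₀ (norm_nonneg _) hc).1 h

theorem norm_le_one_of_isometry [DecidableEq n] (A : Matrix m n ℂ) (h : Aᴴ * A = 1) :
    ‖A‖ ≤ 1 :=
  norm_le_of_conjTranspose_mul_self A zero_le_one (by rw [h]; simpa using norm_one_le)

theorem norm_col_sq {n : Type*} (Z : Matrix m n ℂ) (j : n) :
    ‖WithLp.toLp 2 (fun i => Z i j)‖ ^ 2 = ((Zᴴ * Z) j j).re := by
  rw [EuclideanSpace.norm_sq_eq, Matrix.mul_apply, Complex.re_sum]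
  refine Finset.sum_congr rfl fun i _ => ?_
  rw [Matrix.conjTranspose_apply, Complex.star_def, mul_comm, Complex.mul_conj,
    Complex.normSq_eq_norm_sq, Complex.ofReal_re]

theorem norm_mul_apply_le [DecidableEq n] (B : Matrix m n ℂ) (Z : Matrix n l ℂ) (i : m) (j : l) :
    ‖(B * Z) i j‖ ≤ ‖B‖ * √((Zᴴ * Z) j j).re := by
  rw [← norm_col_sq, Real.sqrt_sq (norm_nonneg _)]
  exact (PiLp.norm_apply_le (WithLp.toLp 2 (B *ᵥ fun k => Z k j)) i).trans (norm_mulVec_le _ _)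

theorem norm_apply_le [DecidableEq n] (A : Matrix m n ℂ) (i : m) (j : n) : ‖A i j‖ ≤ ‖A‖ := by
  have := norm_mul_apply_le A 1 i j
  simpa using this

/-- Tensoring a matrix with an identity matrix does not increase its norm; the pairs of indices are
relabelled by arbitrary equivalences, so that the identity may sit at any position. -/
theorem norm_tensor_one_le [DecidableEq n] {γ P Q : Type*} [Fintype γ] [DecidableEq γ] [Fintype P]
    [Fintype Q] [DecidableEq Q] (e : m × γ ≃ P) (e' : n × γ ≃ Q) (A : Matrix m n ℂ)
    (B : Matrix P Q ℂ)
    (h : ∀ x g y g', B (e (x, g)) (e' (y, g')) = if g = g' then A x y else 0) : ‖B‖ ≤ ‖A‖ := by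
  refine l2_opNorm_le_bound B (norm_nonneg _) fun v => ?_
  rw [← sq_le_sq₀ (norm_nonneg _) (by positivity), mul_pow, EuclideanSpace.norm_sq_eq,
    EuclideanSpace.norm_sq_eq, ← e.sum_comp, ← e'.sum_comp, Fintype.sum_prod_type_right,
    Fintype.sum_prod_type_right, Finset.mul_sum]
  refine Finset.sum_le_sum fun g _ => ?_
  have key : ∀ x, (B *ᵥ v) (e (x, g)) = (A *ᵥ fun y => v (e' (y, g))) x := fun x => by
    simp only [Matrix.mulVec, dotProduct]
    rw [← e'.sum_comp, Fintype.sum_prod_type]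
    refine Finset.sum_congr rfl fun y _ => ?_
    simp [h]
  have := norm_mulVec_le A fun y => v (e' (y, g))
  rw [← sq_le_sq₀ (norm_nonneg _) (by positivity), mul_pow, EuclideanSpace.norm_sq_eq,
    EuclideanSpace.norm_sq_eq] at this
  simpa [key] using this

/-- A matrix with at most one nonzero entry in each row and column has norm at most the largest
absolute value of its entries. -/
theorem norm_le_of_matching [DecidableEq n] (M : Matrix m n ℂ) {c : ℝ} (hc : 0 ≤ c)
    (hcol : ∀ p q q', M q p ≠ 0 → M q' p ≠ 0 → q = q')
    (hrow : ∀ q p p', M q p ≠ 0 → M q p' ≠ 0 → p = p') (hM : ∀ q p, ‖M q p‖ ≤ c) : ‖M‖ ≤ c := by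
  refine norm_le_of_conjTranspose_mul_self M hc ?_
  have hd : Mᴴ * M = Matrix.diagonal fun p => (Mᴴ * M) p p := by
    ext p p'
    by_cases hp : p = p'
    · subst hp; simp
    · rw [Matrix.diagonal_apply_ne _ hp, Matrix.mul_apply]
      refine Finset.sum_eq_zero fun q _ => ?_
      by_contra h
      rw [Matrix.conjTranspose_apply] at h
      exact hp (hrow q p p' (by rintro h0; simp [h0] at h) (by rintro h0; simp [h0] at h))
  rw [hd, Matrix.l2_opNorm_diagonal]
  refine (pi_norm_le_iff_of_nonneg (by positivity)).2 fun p => ?_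
  rw [Matrix.mul_apply]
  by_cases h : ∃ q, M q p ≠ 0
  · obtain ⟨q, hq⟩ := h
    rw [Finset.sum_eq_single q]
    · rw [Matrix.conjTranspose_apply, norm_mul, norm_star, ← sq]
      exact pow_le_pow_left₀ (norm_nonneg _) (hM q p) 2
    · intro q' _ hq'
      by_contra h0
      exact hq' (hcol p q' q (by rintro h1; simp [h1] at h0) hq)
    · simp
  · push Not at h
    simp [h]
    positivity

end OperatorNorm

/-! ### The trace norm and its duality with the operator norm -/

section TraceNorm

variable {ι : Type*} [Fintype ι] [DecidableEq ι]

/-- In an orthonormal eigenbasis `U` of `X† X`, the columns of `X U` are orthogonal. -/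
theorem exists_unitary_gram_diagonal (X : Matrix ι ι ℂ) :
    ∃ U : Matrix ι ι ℂ, Uᴴ * U = 1 ∧ U * Uᴴ = 1 ∧
      (X * U)ᴴ * (X * U) = Matrix.diagonal fun i =>
        (((Matrix.isHermitian_conjTranspose_mul_self X).eigenvalues i : ℝ) : ℂ) := by
  set hA := Matrix.isHermitian_conjTranspose_mul_self X
  have h1 : (hA.eigenvectorUnitary : Matrix ι ι ℂ)ᴴ * hA.eigenvectorUnitary = 1 :=
    Unitary.coe_star_mul_self _
  refine ⟨hA.eigenvectorUnitary.1, h1, Unitary.coe_mul_star_self _, ?_⟩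
  have h : Xᴴ * X = _ := hA.spectral_theorem
  rw [Unitary.conjStarAlgAut_apply, Matrix.star_eq_conjTranspose] at h
  rw [Matrix.conjTranspose_mul, Matrix.mul_assoc, ← Matrix.mul_assoc Xᴴ]
  set U : Matrix ι ι ℂ := hA.eigenvectorUnitary.1
  have h2 : Uᴴ * (Xᴴ * X * U) =
      Uᴴ * ((U * Matrix.diagonal (RCLike.ofReal ∘ hA.eigenvalues) * Uᴴ) * U) := by
    conv_lhs => rw [h]
  rw [h2, Matrix.mul_assoc, h1, Matrix.mul_one, ← Matrix.mul_assoc, h1, Matrix.one_mul]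
  rfl

theorem norm_trace_mul_le (K X : Matrix ι ι ℂ) : ‖(K * X).trace‖ ≤ ‖K‖ * traceNorm X := by
  obtain ⟨U, h1, h2, h3⟩ := exists_unitary_gram_diagonal X
  have : (K * X).trace = ((Uᴴ * K) * (X * U)).trace := by
    rw [Matrix.mul_assoc, Matrix.trace_mul_comm Uᴴ, Matrix.mul_assoc, Matrix.mul_assoc, h2,
      Matrix.mul_one]
  rw [this, Matrix.trace, traceNorm, Finset.mul_sum]
  refine (norm_sum_le _ _).trans (Finset.sum_le_sum fun i _ => ?_)
  refine (norm_mul_apply_le _ _ _ _).trans ?_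
  rw [h3, Matrix.diagonal_apply_eq, Complex.ofReal_re]
  refine mul_le_mul_of_nonneg_right ?_ (Real.sqrt_nonneg _)
  calc ‖Uᴴ * K‖ ≤ ‖Uᴴ‖ * ‖K‖ := Matrix.l2_opNorm_mul _ _
    _ ≤ 1 * ‖K‖ := mul_le_mul_of_nonneg_right
        (norm_le_one_of_isometry _ (by rwa [Matrix.conjTranspose_conjTranspose])) (norm_nonneg _)
    _ = ‖K‖ := one_mul _

/-- The trace norm is attained by pairing with a contraction. -/
theorem exists_contraction_trace_eq (X : Matrix ι ι ℂ) :
    ∃ K : Matrix ι ι ℂ, ‖K‖ ≤ 1 ∧ (K * X).trace = traceNorm X := by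
  obtain ⟨U, h1, h2, h3⟩ := exists_unitary_gram_diagonal X
  set lam := (Matrix.isHermitian_conjTranspose_mul_self X).eigenvalues
  have hlam : ∀ i, 0 ≤ lam i := (Matrix.posSemidef_conjTranspose_mul_self X).eigenvalues_nonneg
  set D : Matrix ι ι ℂ := Matrix.diagonal fun i => (((√(lam i))⁻¹ : ℝ) : ℂ)
  have hD : Dᴴ = D := by
    rw [Matrix.diagonal_conjTranspose]
    congr 1; ext i; simp
  -- The adjoint `Z D U†` of the contraction is the partial isometry of the polar decomposition.
  refine ⟨U * D * (X * U)ᴴ, ?_, ?_⟩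
  · rw [← Matrix.l2_opNorm_conjTranspose]
    refine norm_le_of_conjTranspose_mul_self _ zero_le_one ?_
    have h4 : D * ((X * U)ᴴ * (X * U)) * D =
        Matrix.diagonal fun i => if lam i = 0 then 0 else 1 := by
      rw [h3, Matrix.diagonal_mul_diagonal, Matrix.diagonal_mul_diagonal]
      congr 1; ext i
      rw [← Complex.ofReal_mul, ← Complex.ofReal_mul]
      split_ifs with h
      · simp [h]
      · have : √(lam i) ≠ 0 := (Real.sqrt_pos.2 (lt_of_le_of_ne (hlam i) (Ne.symm h))).ne'
        rw [mul_comm, ← mul_assoc, ← mul_inv, Real.mul_self_sqrt (hlam i), inv_mul_cancel₀ h]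
        simp
    have h5 : ((U * D * (X * U)ᴴ)ᴴ)ᴴ * (U * D * (X * U)ᴴ)ᴴ
        = U * (D * ((X * U)ᴴ * (X * U)) * D) * Uᴴ := by
      rw [Matrix.conjTranspose_conjTranspose, Matrix.conjTranspose_mul (U * D),
        Matrix.conjTranspose_mul U D, Matrix.conjTranspose_conjTranspose, hD]
      simp only [Matrix.mul_assoc]
    have hU : ‖U‖ ≤ 1 := norm_le_one_of_isometry _ h1
    have hU' : ‖Uᴴ‖ ≤ 1 := by rwa [Matrix.l2_opNorm_conjTranspose]
    rw [h5, h4, one_pow]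
    refine (Matrix.l2_opNorm_mul _ _).trans (mul_le_one₀ ?_ (norm_nonneg _) hU')
    refine (Matrix.l2_opNorm_mul _ _).trans (mul_le_one₀ hU (norm_nonneg _) ?_)
    rw [Matrix.l2_opNorm_diagonal]
    refine (pi_norm_le_iff_of_nonneg zero_le_one).2 fun i => ?_
    split_ifs <;> simp
  · rw [Matrix.mul_assoc, Matrix.mul_assoc, Matrix.trace_mul_comm, Matrix.mul_assoc,
      Matrix.mul_assoc, h3, Matrix.diagonal_mul_diagonal, Matrix.trace_diagonal, traceNorm,
      Complex.ofReal_sum]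
    refine Finset.sum_congr rfl fun i _ => ?_
    rw [← Complex.ofReal_mul]
    congr 1
    change (√(lam i))⁻¹ * lam i = √(lam i)
    by_cases h : lam i = 0
    · simp [h]
    · have h0 : √(lam i) ≠ 0 := (Real.sqrt_pos.2 (lt_of_le_of_ne (hlam i) (Ne.symm h))).ne'
      rw [inv_mul_eq_iff_eq_mul₀ h0, Real.mul_self_sqrt (hlam i)]

theorem traceNorm_le_of_trace_mul_le (X : Matrix ι ι ℂ) {c : ℝ}
    (h : ∀ K : Matrix ι ι ℂ, ‖K‖ ≤ 1 → ‖(K * X).trace‖ ≤ c) : traceNorm X ≤ c := by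
  obtain ⟨K, hK, hX⟩ := exists_contraction_trace_eq X
  have := h K hK
  rw [hX, Complex.norm_real] at this
  exact (le_abs_self _).trans this

end TraceNorm

/-! ### Channels in Stinespring form -/

section Channels

variable {α β κ γ : Type*} [Fintype α] [Fintype β] [Fintype κ] [Fintype γ]

/-- The matrix `W ⊗ 1` for `W : ℂ^β → ℂ^α ⊗ ℂ^κ`, with the extra factor `ℂ^γ` placed before
`ℂ^κ`. -/
def tensorOne (γ : Type*) [DecidableEq γ] (W : Matrix (α × κ) β ℂ) :
    Matrix ((α × γ) × κ) (β × γ) ℂ :=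
  Matrix.of fun p q => if p.1.2 = q.2 then W (p.1.1, p.2) q.1 else 0

theorem norm_tensorOne_le [DecidableEq β] [DecidableEq γ] (W : Matrix (α × κ) β ℂ) :
    ‖tensorOne γ W‖ ≤ ‖W‖ := by
  refine norm_tensor_one_le (Equiv.prodAssoc α κ γ |>.trans
    ((Equiv.refl α).prodCongr (Equiv.prodComm κ γ)) |>.trans (Equiv.prodAssoc α γ κ).symm)
    (Equiv.refl (β × γ)) W (tensorOne γ W) ?_
  rintro ⟨x, a⟩ g y g'
  rfl

theorem ampliate_stinespring_apply {α : Type*} [DecidableEq γ] (W : Matrix (α × κ) β ℂ)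
    (X : Matrix (β × γ) (β × γ) ℂ) :
    ampliate γ (stinespring W) X = traceAnc (tensorOne γ W * X * (tensorOne γ W)ᴴ) := by
  ext ⟨x, g⟩ ⟨y, g'⟩
  simp only [ampliate, stinespring, traceAnc, sandwich, LinearMap.coe_comp, LinearMap.coe_mk,
    AddHom.coe_mk, Function.comp_apply, Matrix.of_apply, Matrix.mul_apply,
    Matrix.conjTranspose_apply, tensorOne]
  refine Finset.sum_congr rfl fun a _ => ?_
  rw [Fintype.sum_prod_type]
  refine Finset.sum_congr rfl fun z _ => ?_
  rw [Finset.sum_eq_single g' (fun b _ hb => by simp [Ne.symm hb]) (by simp), if_pos rfl]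
  congr 1
  rw [Fintype.sum_prod_type]
  refine Finset.sum_congr rfl fun u _ => ?_
  rw [Finset.sum_eq_single g (fun b _ hb => by simp [Ne.symm hb]) (by simp), if_pos rfl]

/-- The matrix `K ⊗ 1` on `ℂ^P ⊗ ℂ^κ`. -/
def extendAnc {P : Type*} (κ : Type*) [DecidableEq κ] (K : Matrix P P ℂ) :
    Matrix (P × κ) (P × κ) ℂ :=
  Matrix.of fun p q => if p.2 = q.2 then K p.1 q.1 else 0

theorem norm_extendAnc_le {P : Type*} [Fintype P] [DecidableEq P] [DecidableEq κ]
    (K : Matrix P P ℂ) : ‖extendAnc κ K‖ ≤ ‖K‖ :=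
  norm_tensor_one_le (Equiv.refl _) (Equiv.refl _) K _ fun _ _ _ _ => rfl

theorem trace_mul_traceAnc {P : Type*} [Fintype P] [DecidableEq κ] (K : Matrix P P ℂ)
    (Y : Matrix (P × κ) (P × κ) ℂ) : (K * traceAnc Y).trace = (extendAnc κ K * Y).trace := by
  simp only [Matrix.trace, Matrix.diag_apply, Matrix.mul_apply, traceAnc, LinearMap.coe_mk,
    AddHom.coe_mk, Matrix.of_apply, extendAnc, Fintype.sum_prod_type, Finset.mul_sum]
  refine Finset.sum_congr rfl fun p _ => ?_
  rw [Finset.sum_comm]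
  refine Finset.sum_congr rfl fun a _ => ?_
  refine Finset.sum_congr rfl fun q _ => ?_
  simp

/-- Channels with close Stinespring matrices are close in diamond norm: pairing the difference with
a contraction `K` and moving everything to the input side leaves the operator
`W† (K ⊗ 1) W - W'† (K ⊗ 1) W'`. -/
theorem diamondNorm_stinespring_sub_le [DecidableEq α] [DecidableEq β] (W W' : Matrix (α × κ) β ℂ) :
    diamondNorm (stinespring W - stinespring W') ≤
      ENNReal.ofReal (‖W - W'‖ * (‖W‖ + ‖W'‖)) := by
  classical
  refine iSup₂_le fun X hX => ENNReal.ofReal_le_ofReal ?_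
  refine traceNorm_le_of_trace_mul_le _ fun K hK => ?_
  set A := tensorOne β W
  set A' := tensorOne β W'
  set L := extendAnc κ K
  have hA : ‖A‖ ≤ ‖W‖ := norm_tensorOne_le W
  have hA' : ‖A'‖ ≤ ‖W'‖ := norm_tensorOne_le W'
  have hL : ‖L‖ ≤ 1 := (norm_extendAnc_le K).trans hK
  have hsub : ‖A - A'‖ ≤ ‖W - W'‖ := by
    have : A - A' = tensorOne β (W - W') := by
      ext p q
      simp only [A, A', tensorOne, Matrix.sub_apply, Matrix.of_apply]
      split_ifs <;> simp
    rw [this]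
    exact norm_tensorOne_le _
  have h0 : ampliate β (stinespring W - stinespring W') X
      = ampliate β (stinespring W) X - ampliate β (stinespring W') X := by
    ext p q; simp [ampliate]
  have h1 : (K * ampliate β (stinespring W - stinespring W') X).trace
      = ((Aᴴ * L * A - A'ᴴ * L * A') * X).trace := by
    have aux : ∀ B : Matrix ((α × β) × κ) (β × β) ℂ,
        (L * (B * X * Bᴴ)).trace = (Bᴴ * L * B * X).trace := fun B => by
      rw [← Matrix.mul_assoc, Matrix.trace_mul_comm]
      simp only [Matrix.mul_assoc]
    rw [h0, ampliate_stinespring_apply, ampliate_stinespring_apply, Matrix.mul_sub,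
      Matrix.trace_sub, trace_mul_traceAnc, trace_mul_traceAnc, aux, aux, Matrix.sub_mul,
      Matrix.trace_sub]
  rw [h1]
  refine (norm_trace_mul_le _ _).trans ?_
  rw [hX, mul_one]
  have h2 : Aᴴ * L * A - A'ᴴ * L * A' = Aᴴ * (L * (A - A')) + (A - A')ᴴ * (L * A') := by
    rw [Matrix.conjTranspose_sub, Matrix.mul_sub, Matrix.mul_sub, Matrix.sub_mul]
    simp only [Matrix.mul_assoc]
    abel
  have bound : ∀ B C : Matrix ((α × β) × κ) (β × β) ℂ, ‖Bᴴ * (L * C)‖ ≤ ‖B‖ * ‖C‖ := fun B C => by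
    refine (Matrix.l2_opNorm_mul _ _).trans ?_
    rw [Matrix.l2_opNorm_conjTranspose]
    refine mul_le_mul_of_nonneg_left ((Matrix.l2_opNorm_mul _ _).trans ?_) (norm_nonneg _)
    exact (mul_le_mul_of_nonneg_right hL (norm_nonneg _)).trans_eq (one_mul _)
  rw [h2]
  calc _ ≤ ‖A‖ * ‖A - A'‖ + ‖A - A'‖ * ‖A'‖ :=
        (norm_add_le _ _).trans (add_le_add (bound _ _) (bound _ _))
    _ ≤ ‖W‖ * ‖W - W'‖ + ‖W - W'‖ * ‖W'‖ := by gcongr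
    _ = _ := by ring

theorem isQuantumOperation_stinespring [DecidableEq β] (W : Matrix (α × κ) β ℂ) (hW : Wᴴ * W = 1) :
    IsQuantumOperation (stinespring W) := by
  classical
  constructor
  · intro k X hX
    rw [ampliate_stinespring_apply]
    have h := hX.mul_mul_conjTranspose_same (tensorOne (Fin k) W)
    set Y := tensorOne (Fin k) W * X * (tensorOne (Fin k) W)ᴴ
    have : traceAnc Y = ∑ a, Y.submatrix (fun p => (p, a)) (fun p => (p, a)) := by
      ext p q
      simp [traceAnc, Matrix.sum_apply]
    rw [this]
    exact Matrix.posSemidef_sum _ fun a _ => h.submatrix _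
  · intro ρ
    have h := trace_mul_traceAnc (κ := κ) 1 (W * ρ * Wᴴ)
    have h1 : extendAnc κ (1 : Matrix α α ℂ) = 1 := by
      ext ⟨p, a⟩ ⟨q, b⟩
      simp only [extendAnc, Matrix.of_apply, Matrix.one_apply, Prod.mk.injEq]
      split_ifs <;> simp_all
    rw [Matrix.one_mul, h1, Matrix.one_mul, Matrix.trace_mul_comm, ← Matrix.mul_assoc, hW,
      Matrix.one_mul] at h
    exact h

end Channels

/-! ### Exponentials of Hermitian matrices -/

section HermitianExp

variable {ι : Type*} [Fintype ι] [DecidableEq ι]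

theorem exists_unitary_diagonalization {H : Matrix ι ι ℂ} (hH : H.IsHermitian) :
    ∃ (U : Matrix ι ι ℂ) (lam : ι → ℝ), Uᴴ * U = 1 ∧ U * Uᴴ = 1 ∧
      H = U * Matrix.diagonal (fun i => (lam i : ℂ)) * Uᴴ := by
  refine ⟨hH.eigenvectorUnitary.1, hH.eigenvalues, Unitary.coe_star_mul_self _,
    Unitary.coe_mul_star_self _, ?_⟩
  have h := hH.spectral_theorem
  rw [Unitary.conjStarAlgAut_apply, Matrix.star_eq_conjTranspose] at h
  exact h

theorem norm_conj_diagonal_le {U : Matrix ι ι ℂ} (hU : Uᴴ * U = 1) (v : ι → ℂ) {c : ℝ} (hc : 0 ≤ c)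
    (hv : ∀ i, ‖v i‖ ≤ c) : ‖U * Matrix.diagonal v * Uᴴ‖ ≤ c := by
  have h1 := norm_le_one_of_isometry U hU
  have h2 : ‖Uᴴ‖ ≤ 1 := by rwa [Matrix.l2_opNorm_conjTranspose]
  have h3 : ‖Matrix.diagonal v‖ ≤ c := by
    rw [Matrix.l2_opNorm_diagonal]
    exact (pi_norm_le_iff_of_nonneg hc).2 hv
  calc _ ≤ ‖U * Matrix.diagonal v‖ * ‖Uᴴ‖ := Matrix.l2_opNorm_mul _ _
    _ ≤ (‖U‖ * ‖Matrix.diagonal v‖) * ‖Uᴴ‖ := by gcongr; exact Matrix.l2_opNorm_mul _ _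
    _ ≤ (1 * c) * 1 := by gcongr
    _ = c := by ring

theorem exp_smul_conj_diagonal {U : Matrix ι ι ℂ} (hU : U * Uᴴ = 1) (v : ι → ℂ) (c : ℂ) :
    NormedSpace.exp (c • (U * Matrix.diagonal v * Uᴴ)) =
      U * Matrix.diagonal (fun i => Complex.exp (c * v i)) * Uᴴ := by
  have hinv : U⁻¹ = Uᴴ := Matrix.inv_eq_right_inv hU
  have h1 : c • (U * Matrix.diagonal v * Uᴴ) = U * Matrix.diagonal (c • v) * U⁻¹ := by
    rw [hinv, Matrix.diagonal_smul, Matrix.mul_smul, Matrix.smul_mul]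
  rw [h1, Matrix.exp_conj _ _ (.of_mul_eq_one _ hU), Matrix.exp_diagonal, hinv]
  congr 3
  ext i
  rw [Pi.coe_exp, Complex.exp_eq_exp_ℂ]
  rfl

theorem norm_exp_I_mul_le_one (x : ℝ) : ‖Complex.exp (-(Complex.I * x))‖ = 1 := by
  rw [show -(Complex.I * (x : ℂ)) = ((-x : ℝ) : ℂ) * Complex.I by push_cast; ring]
  exact Complex.norm_exp_ofReal_mul_I _

theorem norm_exp_sub_one_add_le (x : ℝ) :
    ‖Complex.exp (-(Complex.I * x)) - 1 + Complex.I * x‖ ≤ 3 * x ^ 2 := by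
  have hn : ‖-(Complex.I * (x : ℂ))‖ = |x| := by simp
  by_cases h : |x| ≤ 1
  · have := Complex.norm_exp_sub_one_sub_id_le (x := -(Complex.I * (x : ℂ))) (by rwa [hn])
    rw [hn, sq_abs, sub_neg_eq_add] at this
    nlinarith [sq_nonneg x]
  · push Not at h
    calc _ ≤ ‖Complex.exp (-(Complex.I * x))‖ + ‖(1 : ℂ)‖ + ‖Complex.I * x‖ :=
          (norm_add_le _ _).trans (add_le_add_left (norm_sub_le _ _) _)
      _ = 2 + |x| := by rw [norm_exp_I_mul_le_one]; simp; norm_num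
      _ ≤ 3 * x ^ 2 := by rw [← sq_abs]; nlinarith

/-- The function `exp (-iπx/2) + i x` vanishes at `x = ±1`. -/
theorem norm_exp_pi_half_add_le (x : ℝ) :
    ‖Complex.exp (-(Complex.I * (Real.pi / 2 : ℝ)) * x) + Complex.I * x‖ ≤
      (Real.pi / 2 + 1) * |x ^ 2 - 1| := by
  have key : ∀ y : ℝ, 0 ≤ y →
      ‖Complex.exp (-(Complex.I * (Real.pi / 2 : ℝ)) * y) + Complex.I * y‖ ≤
        (Real.pi / 2 + 1) * |y ^ 2 - 1| := fun y hy => by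
    have h1 : Complex.exp (-(Complex.I * (Real.pi / 2 : ℝ)) * y) =
        -Complex.I * Complex.exp (Complex.I * ((Real.pi / 2 * (1 - y) : ℝ) : ℂ)) := by
      have : -Complex.I = Complex.exp (-Real.pi / 2 * Complex.I) := by
        rw [Complex.exp_neg_pi_div_two_mul_I]
      rw [this, ← Complex.exp_add]
      congr 1; push_cast; ring
    have h2 : Complex.exp (-(Complex.I * (Real.pi / 2 : ℝ)) * y) + Complex.I * y =
        -Complex.I * (Complex.exp (Complex.I * ((Real.pi / 2 * (1 - y) : ℝ) : ℂ)) - 1)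
          - Complex.I * ((1 - y : ℝ) : ℂ) := by
      rw [h1]; push_cast; ring
    rw [h2]
    have h3 : ‖Complex.exp (Complex.I * ((Real.pi / 2 * (1 - y) : ℝ) : ℂ)) - 1‖ ≤
        Real.pi / 2 * |1 - y| := by
      refine (Real.norm_exp_I_mul_ofReal_sub_one_le (x := Real.pi / 2 * (1 - y))).trans_eq ?_
      rw [Real.norm_eq_abs, abs_mul, abs_of_pos (by positivity)]
    have h4 : |y ^ 2 - 1| = |1 - y| * (1 + y) := by
      rw [show y ^ 2 - 1 = -((1 - y) * (1 + y)) by ring, abs_neg, abs_mul,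
        abs_of_nonneg (show 0 ≤ 1 + y by linarith)]
    calc _ ≤ Real.pi / 2 * |1 - y| + |1 - y| := by
          refine (norm_sub_le _ _).trans (add_le_add ?_ ?_)
          · rw [norm_mul, norm_neg, Complex.norm_I, one_mul]; exact h3
          · rw [norm_mul, Complex.norm_I, one_mul, Complex.norm_real, Real.norm_eq_abs]
      _ = (Real.pi / 2 + 1) * (|1 - y| * 1) := by ring
      _ ≤ _ := by
          rw [h4]
          have := Real.pi_pos
          gcongr
          linarith
  rcases le_total 0 x with hx | hx
  · exact key x hx
  · have := key (-x) (by linarith)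
    rw [neg_sq] at this
    refine le_trans (le_of_eq ?_) this
    rw [← Complex.norm_conj]
    congr 1
    simp [← Complex.exp_conj, Complex.conj_ofNat]

theorem norm_exp_hermitian_le_one {H : Matrix ι ι ℂ} (hH : H.IsHermitian) (t : ℝ) :
    ‖NormedSpace.exp ((-(Complex.I * (t : ℝ))) • H)‖ ≤ 1 := by
  obtain ⟨U, lam, hU, hU', rfl⟩ := exists_unitary_diagonalization hH
  rw [exp_smul_conj_diagonal hU']
  refine norm_conj_diagonal_le hU _ zero_le_one fun i => ?_
  have := norm_exp_I_mul_le_one (t * lam i)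
  push_cast at this
  rw [show -(Complex.I * (t : ℂ)) * lam i = -(Complex.I * (t * lam i)) by ring, this]

theorem conjTranspose_exp_hermitian {H : Matrix ι ι ℂ} (hH : H.IsHermitian) (t : ℝ) :
    (NormedSpace.exp ((-(Complex.I * (t : ℝ))) • H))ᴴ =
      NormedSpace.exp ((Complex.I * (t : ℝ)) • H) := by
  rw [← Matrix.exp_conjTranspose, Matrix.conjTranspose_smul, hH.eq]
  simp

theorem exp_hermitian_isometry {H : Matrix ι ι ℂ} (hH : H.IsHermitian) (t : ℝ) :
    (NormedSpace.exp ((-(Complex.I * (t : ℝ))) • H))ᴴ *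
      NormedSpace.exp ((-(Complex.I * (t : ℝ))) • H) = 1 := by
  rw [conjTranspose_exp_hermitian hH, ← Matrix.exp_add_of_commute _ _
    (((Commute.refl H).smul_left _).smul_right _), ← add_smul, add_neg_cancel, zero_smul,
    NormedSpace.exp_zero]

theorem norm_exp_hermitian_sub_linear_le {H : Matrix ι ι ℂ} (hH : H.IsHermitian) (t : ℝ) :
    ‖NormedSpace.exp ((-(Complex.I * (t : ℝ))) • H) - (1 + (-(Complex.I * (t : ℝ))) • H)‖ ≤
      3 * (t * ‖H‖) ^ 2 := by
  obtain ⟨U, lam, hU, hU', hH'⟩ := exists_unitary_diagonalization hH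
  have hlam : ∀ i, |lam i| ≤ ‖H‖ := fun i => by
    have h1 : Matrix.diagonal (fun i => (lam i : ℂ)) = Uᴴ * H * U := by
      rw [hH']
      simp only [← Matrix.mul_assoc]
      rw [hU, Matrix.one_mul, Matrix.mul_assoc, hU, Matrix.mul_one]
    have h2 : ‖Matrix.diagonal (fun i => (lam i : ℂ))‖ ≤ ‖H‖ := by
      have h3 := norm_le_one_of_isometry U hU
      have h4 : ‖Uᴴ‖ ≤ 1 := by rwa [Matrix.l2_opNorm_conjTranspose]
      rw [h1]
      calc _ ≤ ‖Uᴴ * H‖ * ‖U‖ := Matrix.l2_opNorm_mul _ _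
        _ ≤ (‖Uᴴ‖ * ‖H‖) * ‖U‖ := by gcongr; exact Matrix.l2_opNorm_mul _ _
        _ ≤ (1 * ‖H‖) * 1 := by gcongr
        _ = ‖H‖ := by ring
    have h5 := norm_apply_le (Matrix.diagonal (fun i => (lam i : ℂ))) i i
    rw [Matrix.diagonal_apply_eq, Complex.norm_real, Real.norm_eq_abs] at h5
    exact h5.trans h2
  have hone : (1 : Matrix ι ι ℂ) = U * Matrix.diagonal (fun _ => 1) * Uᴴ := by
    rw [Matrix.diagonal_one, Matrix.mul_one, hU']
  have hlin : NormedSpace.exp ((-(Complex.I * (t : ℝ))) • H) - (1 + (-(Complex.I * (t : ℝ))) • H)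
      = U * Matrix.diagonal (fun i => Complex.exp (-(Complex.I * t) * lam i)
          - (1 + -(Complex.I * t) * lam i)) * Uᴴ := by
    conv_lhs => rw [hH', exp_smul_conj_diagonal hU', hone]
    rw [← Matrix.smul_mul, ← Matrix.mul_smul, ← Matrix.add_mul, ← Matrix.mul_add,
      ← Matrix.sub_mul, ← Matrix.mul_sub, ← Matrix.diagonal_smul, Matrix.diagonal_add,
      Matrix.diagonal_sub]
    rfl
  rw [hlin]
  refine norm_conj_diagonal_le hU _ (by positivity) fun i => ?_
  have h6 := norm_exp_sub_one_add_le (t * lam i)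
  push_cast at h6
  rw [show Complex.exp (-(Complex.I * t) * lam i) - (1 + -(Complex.I * t) * lam i)
    = Complex.exp (-(Complex.I * (t * lam i))) - 1 + Complex.I * (t * lam i) by
      rw [show -(Complex.I * (t : ℂ)) * lam i = -(Complex.I * (t * lam i)) by ring]; ring]
  refine h6.trans ?_
  rw [mul_pow, mul_pow]
  have := sq_le_sq₀ (abs_nonneg _) (norm_nonneg _) |>.2 (hlam i)
  rw [sq_abs] at this
  gcongr

/-- On the space where `H² = 1`, the evolution for time `π/2` is multiplication by `-iH`. -/
theorem exists_exp_pi_half_add {H : Matrix ι ι ℂ} (hH : H.IsHermitian) :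
    ∃ Q : Matrix ι ι ℂ, ‖Q‖ ≤ Real.pi / 2 + 1 ∧
      NormedSpace.exp ((-(Complex.I * (Real.pi / 2 : ℝ))) • H) + Complex.I • H
        = Q * (H * H - 1) := by
  obtain ⟨U, lam, hU, hU', hH'⟩ := exists_unitary_diagonalization hH
  set g : ι → ℂ := fun i => Complex.exp (-(Complex.I * (Real.pi / 2 : ℝ)) * lam i)
    + Complex.I * lam i
  have hg : ∀ i, ‖g i‖ ≤ (Real.pi / 2 + 1) * |lam i ^ 2 - 1| := fun i =>
    norm_exp_pi_half_add_le (lam i)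
  have hone : (1 : Matrix ι ι ℂ) = U * Matrix.diagonal (fun _ => 1) * Uᴴ := by
    rw [Matrix.diagonal_one, Matrix.mul_one, hU']
  have hsq : ∀ v w : ι → ℂ, (U * Matrix.diagonal v * Uᴴ) * (U * Matrix.diagonal w * Uᴴ)
      = U * Matrix.diagonal (fun i => v i * w i) * Uᴴ := fun v w => by
    rw [← Matrix.diagonal_mul_diagonal, Matrix.mul_assoc, Matrix.mul_assoc, ← Matrix.mul_assoc Uᴴ,
      ← Matrix.mul_assoc Uᴴ, hU, Matrix.one_mul]
    simp only [Matrix.mul_assoc]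
  -- Where `lam i ^ 2 = 1` the division by zero gives the junk value `0`, which is the right one.
  refine ⟨U * Matrix.diagonal (fun i => g i / ((lam i ^ 2 - 1 : ℝ) : ℂ)) * Uᴴ, ?_, ?_⟩
  · have := Real.pi_pos
    refine norm_conj_diagonal_le hU _ (by positivity) fun i => ?_
    rw [norm_div, Complex.norm_real, Real.norm_eq_abs]
    exact div_le_of_le_mul₀ (abs_nonneg _) (by positivity) (hg i)
  · conv_lhs => rw [hH', exp_smul_conj_diagonal hU']
    conv_rhs => rw [hH', hsq]; rw [hone]
    rw [← Matrix.sub_mul, ← Matrix.mul_sub, Matrix.diagonal_sub, hsq, ← Matrix.smul_mul,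
      ← Matrix.mul_smul, ← Matrix.add_mul, ← Matrix.mul_add, ← Matrix.diagonal_smul,
      Matrix.diagonal_add]
    congr 3
    ext i
    change g i = _
    by_cases h : lam i ^ 2 - 1 = 0
    · have h0 : g i = 0 := by
        have := hg i
        rw [h, abs_zero, mul_zero] at this
        exact norm_le_zero_iff.1 this
      rw [h0, zero_div, zero_mul]
    · rw [show (lam i : ℂ) * lam i - 1 = ((lam i ^ 2 - 1 : ℝ) : ℂ) by push_cast; ring,
        div_mul_cancel₀]
      exact_mod_cast h

end HermitianExp

/-! ### The evolution under the block Hamiltonian -/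

section Block

variable {N d : ℕ}

/-- The isometry `|x⟩ ↦ |x⟩|d⟩`. -/
def attachMatrix (N d : ℕ) : Matrix (Fin N × (Fin d ⊕ Unit)) (Fin N) ℂ :=
  Matrix.of fun p x => if p = (x, Sum.inr ()) then 1 else 0

/-- `V` followed by the inclusion of `ℂ^N ⊗ ℂ^d` in `ℂ^N ⊗ ℂ^(d+1)`. -/
def liftRows (V : Matrix (Fin N × Fin d) (Fin N) ℂ) :
    Matrix (Fin N × (Fin d ⊕ Unit)) (Fin N) ℂ :=
  Matrix.of fun p x => Sum.elim (fun a => V (p.1, a) x) (fun _ => 0) p.2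

@[simp] theorem blockHamiltonian_inl_inr (V : Matrix (Fin N × Fin d) (Fin N) ℂ) (y x : Fin N)
    (a : Fin d) (u : Unit) : blockHamiltonian V (y, Sum.inl a) (x, Sum.inr u) = V (y, a) x := rfl

@[simp] theorem blockHamiltonian_inr_inl (V : Matrix (Fin N × Fin d) (Fin N) ℂ) (y x : Fin N)
    (a : Fin d) (u : Unit) :
    blockHamiltonian V (x, Sum.inr u) (y, Sum.inl a) = star (V (y, a) x) := rfl

@[simp] theorem blockHamiltonian_inl_inl (V : Matrix (Fin N × Fin d) (Fin N) ℂ) (y x : Fin N)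
    (a a' : Fin d) : blockHamiltonian V (x, Sum.inl a) (y, Sum.inl a') = 0 := rfl

@[simp] theorem blockHamiltonian_inr_inr (V : Matrix (Fin N × Fin d) (Fin N) ℂ) (y x : Fin N)
    (u u' : Unit) : blockHamiltonian V (x, Sum.inr u) (y, Sum.inr u') = 0 := rfl

theorem blockHamiltonian_isHermitian (V : Matrix (Fin N × Fin d) (Fin N) ℂ) :
    (blockHamiltonian V).IsHermitian := by
  ext ⟨x, a | u⟩ ⟨y, a' | u'⟩ <;> simp

theorem attachMatrix_isometry : (attachMatrix N d)ᴴ * attachMatrix N d = 1 := by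
  ext x y
  simp only [Matrix.mul_apply, Matrix.conjTranspose_apply, attachMatrix, Matrix.of_apply]
  rw [Finset.sum_eq_single (x, Sum.inr ()) (fun b _ hb => by simp [hb]) (by simp)]
  simp [Matrix.one_apply]

theorem norm_attachMatrix_le : ‖attachMatrix N d‖ ≤ 1 :=
  norm_le_one_of_isometry _ attachMatrix_isometry

theorem mul_attachMatrix_apply {P : Type*} (A : Matrix P (Fin N × (Fin d ⊕ Unit)) ℂ) (p : P)
    (x : Fin N) : (A * attachMatrix N d) p x = A p (x, Sum.inr ()) := by
  simp only [Matrix.mul_apply, attachMatrix, Matrix.of_apply]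
  rw [Finset.sum_eq_single (x, Sum.inr ()) (fun b _ hb => by simp [hb]) (by simp)]
  simp

theorem blockHamiltonian_mul_attachMatrix (V : Matrix (Fin N × Fin d) (Fin N) ℂ) :
    blockHamiltonian V * attachMatrix N d = liftRows V := by
  ext ⟨y, a | u⟩ x
  · rw [mul_attachMatrix_apply]; rfl
  · rw [mul_attachMatrix_apply]; rfl

theorem blockHamiltonian_mul_liftRows (V : Matrix (Fin N × Fin d) (Fin N) ℂ) :
    blockHamiltonian V * liftRows V = attachMatrix N d * (Vᴴ * V) := by
  ext ⟨y, a | u⟩ x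
  · simp [Matrix.mul_apply, attachMatrix, liftRows, Fintype.sum_prod_type]
  · have h : ∀ z : Fin N, (attachMatrix N d (y, Sum.inr u) z) = if y = z then 1 else 0 :=
      fun z => by simp [attachMatrix]
    rw [Matrix.mul_apply, Matrix.mul_apply]
    simp only [h, Fintype.sum_prod_type, Fintype.sum_sum_type]
    simp [liftRows, Matrix.mul_apply, Fintype.sum_prod_type]

theorem attachLast_eq (ρ : Matrix (Fin N) (Fin N) ℂ) :
    attachLast N d ρ = attachMatrix N d * ρ * (attachMatrix N d)ᴴ := by
  ext ⟨y, a⟩ ⟨x, b⟩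
  simp only [attachLast, LinearMap.coe_mk, AddHom.coe_mk, Matrix.kroneckerMap_apply,
    Matrix.mul_apply, Matrix.conjTranspose_apply, attachMatrix, Matrix.of_apply]
  rcases a with a | a <;> rcases b with b | b <;> simp

theorem evolutionOp_eq_stinespring (V : Matrix (Fin N × Fin d) (Fin N) ℂ) :
    evolutionOp V = stinespring
      (NormedSpace.exp ((-(Complex.I * (Real.pi / 2 : ℝ))) • blockHamiltonian V) *
        attachMatrix N d) := by
  refine LinearMap.ext fun ρ => ?_
  simp only [evolutionOp, stinespring, LinearMap.comp_apply, attachLast_eq]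
  congr 1
  simp only [sandwich, LinearMap.coe_mk, AddHom.coe_mk, Matrix.conjTranspose_mul,
    conjTranspose_exp_hermitian (blockHamiltonian_isHermitian V), Matrix.mul_assoc]

/-- A phase in front of a Stinespring matrix has no effect; `-i` is the one that the evolution for
time `π/2` produces. -/
theorem stinespring_eq_liftRows (V : Matrix (Fin N × Fin d) (Fin N) ℂ) :
    stinespring V = stinespring (-(Complex.I • liftRows V)) := by
  refine LinearMap.ext fun ρ => ?_
  ext x y
  simp only [stinespring, sandwich, traceAnc, LinearMap.coe_comp, LinearMap.coe_mk, AddHom.coe_mk,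
    Function.comp_apply, Matrix.of_apply, Fintype.sum_sum_type]
  have : ∀ a b, (-(Complex.I • liftRows V) * ρ * (-(Complex.I • liftRows V))ᴴ) (x, a) (y, b)
      = (liftRows V * ρ * (liftRows V)ᴴ) (x, a) (y, b) := fun a b => by
    rw [Matrix.conjTranspose_neg, Matrix.conjTranspose_smul]
    simp [← mul_assoc]
  simp only [this]
  simp [Matrix.mul_apply, liftRows]

theorem norm_liftRows_sq_le {V : Matrix (Fin N × Fin d) (Fin N) ℂ} {ε : ℝ}
    (hV : spectralNorm (Vᴴ * V - 1) ≤ ε) : ‖liftRows V‖ ^ 2 ≤ 1 + ε := by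
  have h1 : (liftRows V)ᴴ * liftRows V = Vᴴ * V := by
    ext x y
    simp [Matrix.mul_apply, liftRows, Fintype.sum_prod_type]
  rw [sq, ← Matrix.l2_opNorm_conjTranspose_mul_self, h1]
  calc ‖Vᴴ * V‖ = ‖1 + (Vᴴ * V - 1)‖ := by rw [add_sub_cancel]
    _ ≤ ‖(1 : Matrix (Fin N) (Fin N) ℂ)‖ + ‖Vᴴ * V - 1‖ := norm_add_le _ _
    _ ≤ 1 + ε := add_le_add norm_one_le hV

theorem norm_entry_le {V : Matrix (Fin N × Fin d) (Fin N) ℂ} {ε : ℝ}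
    (hV : spectralNorm (Vᴴ * V - 1) ≤ ε) (r : Fin N × Fin d) (x : Fin N) :
    ‖V r x‖ ^ 2 ≤ 1 + ε := by
  have h := norm_apply_le (liftRows V) (r.1, Sum.inl r.2) x
  change ‖V r x‖ ≤ _ at h
  exact (pow_le_pow_left₀ (norm_nonneg _) h 2).trans (norm_liftRows_sq_le hV)

theorem isQuantumOperation_evolutionOp (V : Matrix (Fin N × Fin d) (Fin N) ℂ) :
    IsQuantumOperation (evolutionOp V) := by
  rw [evolutionOp_eq_stinespring]
  refine isQuantumOperation_stinespring _ ?_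
  rw [Matrix.conjTranspose_mul, Matrix.mul_assoc, ← Matrix.mul_assoc _ _ (attachMatrix N d),
    exp_hermitian_isometry (blockHamiltonian_isHermitian V), Matrix.one_mul, attachMatrix_isometry]

theorem diamondNorm_evolutionOp_sub_le {V : Matrix (Fin N × Fin d) (Fin N) ℂ} {ε : ℝ} (hε : 0 ≤ ε)
    (hV : spectralNorm (Vᴴ * V - 1) ≤ ε) :
    diamondNorm (evolutionOp V - stinespring V) ≤ ENNReal.ofReal (12 * ε) := by
  rw [evolutionOp_eq_stinespring, stinespring_eq_liftRows]
  refine (diamondNorm_stinespring_sub_le _ _).trans (ENNReal.ofReal_le_ofReal ?_)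
  set H := blockHamiltonian V
  set E := NormedSpace.exp ((-(Complex.I * (Real.pi / 2 : ℝ))) • H)
  have hW : ‖E * attachMatrix N d‖ ≤ 1 :=
    (Matrix.l2_opNorm_mul _ _).trans (mul_le_one₀
      (norm_exp_hermitian_le_one (blockHamiltonian_isHermitian V) _) (norm_nonneg _)
      norm_attachMatrix_le)
  have hW' : ‖-(Complex.I • liftRows V)‖ = ‖liftRows V‖ := by
    rw [norm_neg, norm_smul, Complex.norm_I, one_mul]
  have hL := norm_liftRows_sq_le hV
  have hdiff : ‖E * attachMatrix N d - -(Complex.I • liftRows V)‖ ≤ (Real.pi / 2 + 1) * ε := by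
    obtain ⟨Q, hQ, hEQ⟩ := exists_exp_pi_half_add (blockHamiltonian_isHermitian V)
    have h1 : E * attachMatrix N d - -(Complex.I • liftRows V)
        = Q * (attachMatrix N d * (Vᴴ * V - 1)) := by
      rw [sub_neg_eq_add, ← blockHamiltonian_mul_attachMatrix, ← Matrix.smul_mul, ← Matrix.add_mul,
        hEQ, Matrix.mul_assoc, Matrix.sub_mul, Matrix.mul_assoc, blockHamiltonian_mul_attachMatrix,
        blockHamiltonian_mul_liftRows, Matrix.one_mul, Matrix.mul_sub (attachMatrix N d),
        Matrix.mul_one]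
    rw [h1]
    have hpi := Real.pi_pos
    refine (Matrix.l2_opNorm_mul _ _).trans (mul_le_mul hQ ?_ (norm_nonneg _) (by positivity))
    refine (Matrix.l2_opNorm_mul _ _).trans ?_
    exact (mul_le_mul norm_attachMatrix_le hV (norm_nonneg _) zero_le_one).trans_eq (one_mul _)
  rw [hW']
  have hpi : Real.pi / 2 + 1 ≤ 4 := by linarith [Real.pi_le_four]
  have hdiff' := hdiff.trans (mul_le_mul_of_nonneg_right hpi hε)
  have hdiff2 : ‖E * attachMatrix N d - -(Complex.I • liftRows V)‖ ≤ 1 + ‖liftRows V‖ :=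
    (norm_sub_le _ _).trans (by rw [hW']; exact add_le_add_left hW _)
  have hD := norm_nonneg (E * attachMatrix N d - -(Complex.I • liftRows V))
  have hw := norm_nonneg (E * attachMatrix N d)
  generalize ‖E * attachMatrix N d - -(Complex.I • liftRows V)‖ = D at hdiff' hdiff2 hD ⊢
  generalize ‖E * attachMatrix N d‖ = w at hW hw ⊢
  have hn := norm_nonneg (liftRows V)
  generalize ‖liftRows V‖ = l at hL hdiff2 hn ⊢
  -- For `ε` above `1` the norm of `V` is only `O(√ε)`, and the trivial bound on `D` suffices.
  rcases le_total ε 1 with h | h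
  · have h2 : l ≤ 2 := by nlinarith
    calc D * (w + l) ≤ (4 * ε) * (1 + 2) := by gcongr
      _ = 12 * ε := by ring
  · calc D * (w + l) ≤ (1 + l) * (1 + l) := by gcongr
      _ ≤ 12 * ε := by nlinarith [sq_nonneg (l - 1)]

end Block

/-! ### Controlled gates and classical reversible circuits -/

section Circuits

variable {W : Type} [Fintype W] [DecidableEq W] {N d s b : ℕ}
  {V : Matrix (Fin N × Fin d) (Fin N) ℂ} (B : BlackBox V s)

/-- The computational basis state `|f⟩`. -/
abbrev ket (f : W → Bool) : (W → Bool) → ℂ := Pi.single f 1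

/-- The unitary implemented by a list of gates on qubits with arbitrary labels. -/
def circuitMatrix : List (Gate W N d s b) → Matrix (W → Bool) (W → Bool) ℂ
  | [] => 1
  | g :: c => circuitMatrix c * g.matrix B

theorem circuitMatrix_append (c c' : List (Gate W N d s b)) :
    circuitMatrix B (c ++ c') = circuitMatrix B c' * circuitMatrix B c := by
  induction c with
  | nil => simp [circuitMatrix]
  | cons g c ih => rw [List.cons_append, circuitMatrix, ih, circuitMatrix, Matrix.mul_assoc]

theorem circuitMatrix_singleton (g : Gate W N d s b) : circuitMatrix B [g] = g.matrix B := by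
  simp [circuitMatrix]

/-- If every block of a circuit is its own inverse, the reversed sequence of blocks undoes it. -/
theorem circuitMatrix_reverse_flatten (L : List (List (Gate W N d s b)))
    (h : ∀ c ∈ L, circuitMatrix B c * circuitMatrix B c = 1) :
    circuitMatrix B L.reverse.flatten * circuitMatrix B L.flatten = 1 := by
  induction L with
  | nil => simp [circuitMatrix]
  | cons c L ih =>
    rw [List.reverse_cons, List.flatten_append, List.flatten_cons, List.flatten_cons,
      List.flatten_nil, List.append_nil, circuitMatrix_append, circuitMatrix_append,
      Matrix.mul_assoc, ← Matrix.mul_assoc (circuitMatrix B L.reverse.flatten),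
      ih fun c hc => h c (List.mem_cons_of_mem _ hc), Matrix.one_mul]
    exact h c List.mem_cons_self

/-- The circuit `c` maps every basis state `|f⟩` to the basis state `|φ f⟩`. -/
def Implements (c : List (Gate W N d s b)) (φ : (W → Bool) → W → Bool) : Prop :=
  ∀ f, circuitMatrix B c *ᵥ ket f = ket (φ f)

variable {B}

theorem Implements.mul_self {c : List (Gate W N d s b)} {φ : (W → Bool) → W → Bool}
    (h : Implements B c φ) (hφ : ∀ f, φ (φ f) = f) :
    circuitMatrix B c * circuitMatrix B c = 1 := by
  refine Matrix.ext_of_mulVec_single fun f => ?_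
  rw [← Matrix.mulVec_mulVec, h, h, hφ, Matrix.one_mulVec]

/-! ### Controlled one-qubit gates -/

/-- The two-qubit unitary that applies `M` to the second qubit if the first one is in state `p`. -/
def ctlUnitary (p : Bool) (M : Matrix.unitaryGroup Bool ℂ) :
    Matrix.unitaryGroup (Bool × Bool) ℂ :=
  ⟨Matrix.of fun x y => if x.1 = y.1 then
    (if x.1 = p then (M : Matrix Bool Bool ℂ) x.2 y.2 else if x.2 = y.2 then 1 else 0) else 0, by
    have h := Matrix.mem_unitaryGroup_iff.1 M.2
    rw [Matrix.mem_unitaryGroup_iff]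
    ext ⟨a, x⟩ ⟨a', x'⟩
    have hx := congrFun (congrFun h x) x'
    simp only [Matrix.mul_apply, Matrix.star_apply, Matrix.one_apply, Fintype.sum_bool] at hx
    simp only [Matrix.mul_apply, Matrix.star_apply, Matrix.one_apply, Fintype.sum_prod_type,
      Fintype.sum_bool, Matrix.of_apply, Prod.mk.injEq]
    revert hx
    cases p <;> cases a <;> cases a' <;> cases x <;> cases x' <;> simp⟩

/-- The gate that applies `M` to the qubit `t` if the qubit `c` is in state `p`. -/
def ctl (c : W) (p : Bool) (t : W) (h : c ≠ t) (M : Matrix.unitaryGroup Bool ℂ) :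
    Gate W N d s b :=
  .twoQubit c t h (ctlUnitary p M)

/-- The state `∑ y, a y |f[t := y]⟩`, in which only the qubit `t` is in superposition. -/
def superpose (t : W) (f : W → Bool) (a : Bool → ℂ) : (W → Bool) → ℂ :=
  ∑ y, a y • ket (Function.update f t y)

theorem ket_eq_superpose (t : W) (f : W → Bool) : ket f = superpose t f (Pi.single (f t) 1) := by
  rw [superpose, Finset.sum_eq_single (f t) (fun y _ hy => by simp [hy]) (by simp)]
  simp

theorem superpose_single (t : W) (f : W → Bool) (y : Bool) :
    superpose t f (Pi.single y 1) = ket (Function.update f t y) := by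
  rw [superpose, Finset.sum_eq_single y (fun z _ hz => by simp [hz]) (by simp)]
  simp

theorem superpose_update (t : W) (f : W → Bool) (y : Bool) (a : Bool → ℂ) :
    superpose t (Function.update f t y) a = superpose t f a := by
  simp [superpose]

theorem ctl_mulVec_ket (c : W) (p : Bool) (t : W) (h : c ≠ t) (M : Matrix.unitaryGroup Bool ℂ)
    (f : W → Bool) :
    Gate.matrix B (ctl (b := b) c p t h M) *ᵥ ket f =
      superpose t f (if f c = p then (M : Matrix Bool Bool ℂ) *ᵥ Pi.single (f t) 1
        else Pi.single (f t) 1) := by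
  ext g
  rw [Matrix.mulVec_single_one, superpose, Finset.sum_apply]
  simp only [Matrix.col_apply, ctl, Gate.matrix, Matrix.of_apply, ctlUnitary, Pi.smul_apply,
    smul_eq_mul]
  by_cases hg : ∀ v, v ≠ t → g v = f v
  · rw [if_pos fun v _ hv => hg v hv, if_pos (hg c h), hg c h, Finset.sum_eq_single (g t)]
    · have : g = Function.update f t (g t) := by
        ext v
        by_cases hv : v = t
        · subst hv; simp
        · simp [hv, hg v hv]
      rw [← this]
      split_ifs with h1 h2
      · simp
      · simp [h2]
      · simp [h2]
    · intro y _ hy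
      rw [ket, Pi.single_eq_of_ne, mul_zero]
      rintro rfl
      simp at hy
    · simp
  · rw [Finset.sum_eq_zero]
    · split_ifs with h1 h2
      all_goals try rfl
      all_goals
        exfalso
        refine hg fun v hv => ?_
        by_cases hvc : v = c
        · rw [hvc, h2]
        · exact h1 v hvc hv
    · intro y _
      rw [ket, Pi.single_eq_of_ne, mul_zero]
      rintro rfl
      exact hg fun v hv => by simp [hv]

theorem ctl_mulVec_superpose (c : W) (p : Bool) (t : W) (h : c ≠ t)
    (M : Matrix.unitaryGroup Bool ℂ) (f : W → Bool) (a : Bool → ℂ) :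
    Gate.matrix B (ctl (b := b) c p t h M) *ᵥ superpose t f a =
      superpose t f (if f c = p then (M : Matrix Bool Bool ℂ) *ᵥ a else a) := by
  conv_lhs => rw [superpose]
  rw [Matrix.mulVec_sum]
  simp only [Matrix.mulVec_smul, ctl_mulVec_ket, superpose_update, Function.update_self,
    Function.update_of_ne h]
  split_ifs
  · ext g
    simp only [superpose, Fintype.sum_bool, Pi.add_apply, Pi.smul_apply, smul_eq_mul,
      Matrix.mulVec, dotProduct]
    simp only [Pi.single_apply, reduceCtorEq, if_true, if_false]
    ring
  · simp [superpose]

/-- The Pauli matrix `X`. -/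
def pauliX : Matrix.unitaryGroup Bool ℂ :=
  ⟨Matrix.of fun x y => if x = y then 0 else 1, by
    rw [Matrix.mem_unitaryGroup_iff]
    ext x y
    cases x <;> cases y <;> simp [Matrix.mul_apply]⟩

theorem pauliX_mulVec_single (y : Bool) :
    (pauliX : Matrix Bool Bool ℂ) *ᵥ Pi.single y 1 = Pi.single (!y) 1 := by
  ext x
  cases x <;> cases y <;> simp [pauliX]

/-- A square root of the Pauli matrix `X`. -/
def sqrtX : Matrix.unitaryGroup Bool ℂ :=
  ⟨Matrix.of fun x y => if x = y then (1 + Complex.I) / 2 else (1 - Complex.I) / 2, by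
    rw [Matrix.mem_unitaryGroup_iff]
    have h2 : (starRingEnd ℂ) 2 = 2 := Complex.conj_ofNat 2
    ext x y
    cases x <;> cases y <;>
      simp [Matrix.mul_apply, h2] <;> ring_nf <;> simp <;> norm_num⟩

theorem sqrtX_mul_self : (sqrtX : Matrix Bool Bool ℂ) * sqrtX = pauliX := by
  ext x y
  cases x <;> cases y <;> simp [Matrix.mul_apply, sqrtX, pauliX] <;> ring_nf <;> simp <;> norm_num

theorem sqrtX_mul_inv : (sqrtX : Matrix Bool Bool ℂ) * (sqrtX⁻¹ : Matrix.unitaryGroup Bool ℂ) = 1 :=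
  congrArg Subtype.val (mul_inv_cancel sqrtX)

theorem sqrtX_inv_mul : ((sqrtX⁻¹ : Matrix.unitaryGroup Bool ℂ) : Matrix Bool Bool ℂ) * sqrtX = 1 :=
  congrArg Subtype.val (inv_mul_cancel sqrtX)

/-- The map on basis states that adds `u f` to the bit `t`. -/
def xorAt (t : W) (u : (W → Bool) → Bool) (f : W → Bool) : W → Bool :=
  Function.update f t (xor (f t) (u f))

theorem xorAt_xorAt {W : Type} [DecidableEq W] (t : W) (u : (W → Bool) → Bool)
    (hu : ∀ f y, u (Function.update f t y) = u f) (f : W → Bool) : xorAt t u (xorAt t u f) = f := by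
  simp [xorAt, hu]

/-- The controlled NOT gate: flip `t` if `c` is in state `p`. -/
def cnot (c : W) (p : Bool) (t : W) (h : c ≠ t) : List (Gate W N d s b) := [ctl c p t h pauliX]

theorem cnot_mulVec_ket (c : W) (p : Bool) (t : W) (h : c ≠ t) (f : W → Bool) :
    Gate.matrix B (ctl (b := b) c p t h pauliX) *ᵥ ket f =
      ket (xorAt t (fun f => f c == p) f) := by
  rw [ctl_mulVec_ket, xorAt]
  split_ifs with hc
  · rw [pauliX_mulVec_single, superpose_single]
    simp [hc]
  · rw [superpose_single]
    have : (f c == p) = false := by simpa using hc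
    simp [this]

theorem implements_cnot (c : W) (p : Bool) (t : W) (h : c ≠ t) :
    Implements B (cnot (b := b) c p t h) (xorAt t fun f => f c == p) := fun f => by
  rw [cnot, circuitMatrix_singleton, cnot_mulVec_ket]

/-- The Toffoli gate, built from five controlled gates: flip `t` if `a` is in state `p` and `c` is
in state `q`. -/
def toffoli (a : W) (p : Bool) (c : W) (q : Bool) (t : W) (hac : a ≠ c) (hat : a ≠ t)
    (hct : c ≠ t) : List (Gate W N d s b) :=
  [ctl c q t hct sqrtX, ctl a p c hac pauliX, ctl c q t hct sqrtX⁻¹, ctl a p c hac pauliX,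
    ctl a p t hat sqrtX]

theorem cnot_mulVec_superpose (a : W) (p : Bool) (c t : W) (hac : a ≠ c) (hat : a ≠ t)
    (hct : c ≠ t) (f : W → Bool) (v : Bool → ℂ) :
    Gate.matrix B (ctl (b := b) a p c hac pauliX) *ᵥ superpose t f v =
      superpose t (xorAt c (fun f => f a == p) f) v := by
  simp only [superpose, Matrix.mulVec_sum, Matrix.mulVec_smul, cnot_mulVec_ket, xorAt,
    Function.update_of_ne hat, Function.update_of_ne hct, Function.update_comm hct]

/-- With `√X` raised to the powers `[c = q]`, `-([c = q] ⊕ [a = p])`, `[a = p]`, the exponents add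
up to `2 [a = p] [c = q]`. -/
theorem implements_toffoli (a : W) (p : Bool) (c : W) (q : Bool) (t : W) (hac : a ≠ c)
    (hat : a ≠ t) (hct : c ≠ t) :
    Implements B (toffoli (b := b) a p c q t hac hat hct)
      (xorAt t fun f => f a == p && f c == q) := fun f => by
  have hX : xorAt c (fun f => f a == p) (xorAt c (fun f => f a == p) f) = f :=
    xorAt_xorAt c _ (fun f y => by simp [hac]) f
  simp only [toffoli, circuitMatrix, Matrix.one_mul, ← Matrix.mulVec_mulVec]
  rw [ket_eq_superpose t f, ctl_mulVec_superpose, cnot_mulVec_superpose _ _ _ _ _ hat hct,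
    ctl_mulVec_superpose, cnot_mulVec_superpose _ _ _ _ _ hat hct, hX, ctl_mulVec_superpose]
  have h1 : xorAt c (fun f => f a == p) f c = xor (f c) (f a == p) := by simp [xorAt]
  rw [h1]
  have key : ∀ y, superpose t f (Pi.single (xor (f t) y) 1)
      = ket (Function.update f t (xor (f t) y)) := fun y => superpose_single _ _ _
  rw [xorAt, ← key]
  congr 1
  by_cases ha : f a = p
  · by_cases hc : f c = q
    · have : ¬ (xor (f c) true = q) := by rw [hc]; cases q <;> simp
      simp only [ha, hc, beq_self_eq_true, if_true, Bool.and_self]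
      rw [hc] at this
      rw [if_neg this, Matrix.mulVec_mulVec, sqrtX_mul_self, pauliX_mulVec_single, Bool.xor_true]
    · have : xor (f c) true = q := by revert hc; cases f c <;> cases q <;> simp
      have hc' : (f c == q) = false := by simpa using hc
      simp only [ha, hc, hc', beq_self_eq_true, if_true, if_false, Bool.and_false, Bool.xor_false,
        this, Matrix.mulVec_mulVec, sqrtX_mul_inv, Matrix.one_mulVec]
  · have ha' : (f a == p) = false := by simpa using ha
    simp only [ha, ha', Bool.xor_false, if_false, Bool.false_and]
    split_ifs
    · rw [Matrix.mulVec_mulVec, sqrtX_inv_mul, Matrix.one_mulVec]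
    · rfl

theorem cnot_mul_self (c : W) (p : Bool) (t : W) (h : c ≠ t) :
    circuitMatrix B (cnot (b := b) c p t h) * circuitMatrix B (cnot (b := b) c p t h) = 1 :=
  (implements_cnot c p t h).mul_self (xorAt_xorAt _ _ fun f y => by simp [h])

theorem toffoli_mul_self (a : W) (p : Bool) (c : W) (q : Bool) (t : W) (hac : a ≠ c) (hat : a ≠ t)
    (hct : c ≠ t) :
    circuitMatrix B (toffoli (b := b) a p c q t hac hat hct) *
      circuitMatrix B (toffoli (b := b) a p c q t hac hat hct) = 1 :=
  (implements_toffoli a p c q t hac hat hct).mul_self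
    (xorAt_xorAt _ _ fun f y => by simp [hat, hct])

/-- Parallel `xorAt` operations with distinct targets, none of which influences the others. -/
theorem flatten_mulVec_ket_of_xorAt {κ : Type*} (L : List κ) (hL : L.Nodup)
    (C : κ → List (Gate W N d s b)) (t : κ → W) (ht : Function.Injective t)
    (u : κ → (W → Bool) → Bool) (hC : ∀ k, Implements B (C k) (xorAt (t k) (u k)))
    (hu : ∀ k l f y, u k (Function.update f (t l) y) = u k f) (f g : W → Bool)
    (hg : ∀ k ∈ L, g (t k) = xor (f (t k)) (u k f)) (hg' : ∀ v, (∀ k ∈ L, t k ≠ v) → g v = f v) :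
    circuitMatrix B (L.map C).flatten *ᵥ ket f = ket g := by
  induction L generalizing f with
  | nil =>
    have : g = f := funext fun v => hg' v (by simp)
    rw [List.map_nil, List.flatten_nil, circuitMatrix, Matrix.one_mulVec, this]
  | cons k L ih =>
    rw [List.nodup_cons] at hL
    rw [List.map_cons, List.flatten_cons, circuitMatrix_append, ← Matrix.mulVec_mulVec, hC]
    refine ih hL.2 _ (fun l hl => ?_) fun v hv => ?_
    · have hlk : t l ≠ t k := fun h => hL.1 (ht h ▸ hl)
      rw [hg l (List.mem_cons_of_mem _ hl), xorAt, Function.update_of_ne hlk, hu]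
    · by_cases hvk : t k = v
      · subst hvk
        rw [hg k List.mem_cons_self, xorAt, Function.update_self]
      · rw [xorAt, Function.update_of_ne (Ne.symm hvk)]
        refine hg' v fun l hl => ?_
        rcases List.mem_cons.1 hl with rfl | hl
        · exact hvk
        · exact hv l hl

/-! ### Queries -/

open Classical in
/-- The map on basis states performed by a query. -/
def queryMap {W I O : Type} (w : I ⊕ O ↪ W) (F : (I → Bool) → O → Bool) (f : W → Bool) : W → Bool :=
  fun v => xor (f v) (decide (∃ o, w (Sum.inr o) = v ∧ F (fun i => f (w (Sum.inl i))) o = true))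

theorem queryMap_output {W I O : Type} (w : I ⊕ O ↪ W) (F : (I → Bool) → O → Bool) (f : W → Bool)
    (o : O) : queryMap w F f (w (Sum.inr o)) =
      xor (f (w (Sum.inr o))) (F (fun i => f (w (Sum.inl i))) o) := by
  have : (∃ o', w (Sum.inr o') = w (Sum.inr o) ∧ F (fun i => f (w (Sum.inl i))) o' = true) ↔
      F (fun i => f (w (Sum.inl i))) o = true := by
    constructor
    · rintro ⟨o', h1, h2⟩
      rwa [← Sum.inr_injective (w.injective h1)]
    · exact fun h => ⟨o, rfl, h⟩
  simp only [queryMap, this, Bool.decide_eq_true]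

theorem queryMap_of_ne {W I O : Type} (w : I ⊕ O ↪ W) (F : (I → Bool) → O → Bool) (f : W → Bool)
    (v : W) (hv : ∀ o, w (Sum.inr o) ≠ v) : queryMap w F f v = f v := by
  have : ¬ ∃ o, w (Sum.inr o) = v ∧ F (fun i => f (w (Sum.inl i))) o = true := by
    rintro ⟨o, h, -⟩; exact hv o h
  simp only [queryMap, this, decide_false, Bool.xor_false]

theorem queryMap_queryMap {W I O : Type} (w : I ⊕ O ↪ W) (F : (I → Bool) → O → Bool)
    (f : W → Bool) : queryMap w F (queryMap w F f) = f := by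
  have hin : ∀ i, queryMap w F f (w (Sum.inl i)) = f (w (Sum.inl i)) := fun i =>
    queryMap_of_ne w F f _ fun o h => by cases w.injective h
  ext v
  by_cases hv : ∃ o, w (Sum.inr o) = v
  · obtain ⟨o, rfl⟩ := hv
    simp [queryMap_output, hin]
  · push Not at hv
    rw [queryMap_of_ne w F _ v hv, queryMap_of_ne w F _ v hv]

theorem queryMatrix_mulVec_ket {I O : Type} (w : I ⊕ O ↪ W) (F : (I → Bool) → O → Bool)
    (f : W → Bool) : queryMatrix w F *ᵥ ket f = ket (queryMap w F f) := by
  classical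
  ext h
  rw [Matrix.mulVec_single_one, Matrix.col_apply, queryMatrix, Matrix.of_apply, ket,
    Pi.single_apply]
  congr 1

/-! ### Relabelling the qubits -/

/-- Relabelling the qubits of a gate. -/
def Gate.relabel {W' : Type} (e : W ≃ W') : Gate W N d s b → Gate W' N d s b
  | .twoQubit i j h U => .twoQubit (e i) (e j) (e.injective.ne h) U
  | .colQuery w => .colQuery (w.trans e.toEmbedding)
  | .rowQuery w => .rowQuery (w.trans e.toEmbedding)

theorem queryMatrix_relabel {W W' I O : Type} (e : W ≃ W') (w : I ⊕ O ↪ W)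
    (F : (I → Bool) → O → Bool) (g f : W' → Bool) :
    queryMatrix (w.trans e.toEmbedding) F g f = queryMatrix w F (g ∘ e) (f ∘ e) := by
  simp only [queryMatrix, Matrix.of_apply]
  congr 1
  apply propext
  constructor
  · rintro rfl
    ext v
    simp
  · intro h
    ext v
    have := congrFun h (e.symm v)
    simp only [Function.comp_apply, Equiv.apply_symm_apply] at this
    rw [this]
    simp [Equiv.eq_symm_apply]

theorem Gate.relabel_matrix {W' : Type} (e : W ≃ W') (γ : Gate W N d s b) (g f : W' → Bool) :
    (γ.relabel e).matrix B g f = γ.matrix B (g ∘ e) (f ∘ e) := by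
  cases γ with
  | twoQubit i j h U =>
    simp only [Gate.relabel, Gate.matrix, Matrix.of_apply, Function.comp_apply]
    congr 1
    apply propext
    constructor
    · exact fun h1 v hi hj => h1 (e v) (e.injective.ne hi) (e.injective.ne hj)
    · intro h1 v hi hj
      have := h1 (e.symm v) (fun h => hi (by rw [← h]; simp)) (fun h => hj (by rw [← h]; simp))
      simpa using this
  | colQuery w => exact queryMatrix_relabel e w _ g f
  | rowQuery w => exact queryMatrix_relabel e w _ g f

theorem circuitMatrix_relabel {W' : Type} [Fintype W'] [DecidableEq W'] (e : W ≃ W')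
    (c : List (Gate W N d s b)) (g f : W' → Bool) :
    circuitMatrix B (c.map (Gate.relabel e)) g f = circuitMatrix B c (g ∘ e) (f ∘ e) := by
  induction c generalizing f with
  | nil =>
    simp only [List.map_nil, circuitMatrix, Matrix.one_apply]
    congr 1
    apply propext
    exact ⟨fun h => by rw [h], fun h => e.surjective.injective_comp_right h⟩
  | cons γ c ih =>
    rw [List.map_cons, circuitMatrix, circuitMatrix, Matrix.mul_apply, Matrix.mul_apply,
      ← (e.arrowCongr (Equiv.refl Bool)).sum_comp]
    refine Finset.sum_congr rfl fun h _ => ?_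
    have h1 : (e.arrowCongr (Equiv.refl Bool)) h ∘ e = h := by ext v; simp [Equiv.arrowCongr]
    rw [ih, Gate.relabel_matrix, h1]

end Circuits

theorem circuitMatrix_eq {N d s b k : ℕ} {V : Matrix (Fin N × Fin d) (Fin N) ℂ} (B : BlackBox V s)
    (c : Circuit N d s b k) : Circuit.matrix B c = circuitMatrix B c := by
  induction c with
  | nil => rfl
  | cons g c ih => rw [Circuit.matrix, circuitMatrix, ih]

/-! ### Conjunction of many bits -/

section AndChain

variable {W : Type} {N d s b : ℕ}

/-- The wires of a circuit that computes conjunctions: `m` literals, each a wire `lit j` together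
with the value `pol j` it should have, accumulator wires `acc 0, …, acc m` distinct from them and a
further wire `z`. -/
structure AndLayout (W : Type) (m : ℕ) where
  acc : Fin (m + 1) → W
  lit : Fin m → W
  pol : Fin m → Bool
  z : W
  acc_inj : Function.Injective acc
  acc_ne_lit : ∀ k j, acc k ≠ lit j
  acc_ne_z : ∀ k, acc k ≠ z

namespace AndLayout

variable {m : ℕ} (A : AndLayout W m)

/-- The Toffoli gates that write the conjunction of the first `j + 1` literals to `acc (j + 1)`, for
all `j < n`. -/
def steps : (n : ℕ) → n ≤ m → List (List (Gate W N d s b))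
  | 0, _ => []
  | n + 1, h => steps n (by omega) ++
      [toffoli (A.acc ⟨n, by omega⟩) true (A.lit ⟨n, h⟩) (A.pol ⟨n, h⟩) (A.acc ⟨n + 1, by omega⟩)
        (A.acc_ne_lit _ _) (A.acc_inj.ne (by simp)) (A.acc_ne_lit _ _).symm]

/-- The blocks of the circuit: `acc 0` is set to one by two oppositely controlled gates. -/
def blocks : List (List (Gate W N d s b)) :=
  [cnot A.z true (A.acc 0) (A.acc_ne_z 0).symm, cnot A.z false (A.acc 0) (A.acc_ne_z 0).symm] ++
    A.steps m le_rfl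

theorem length_steps (n : ℕ) (h : n ≤ m) :
    (A.steps n h : List (List (Gate W N d s b))).length = n := by
  induction n with
  | zero => rfl
  | succ n ih => rw [steps, List.length_append, ih, List.length_singleton]

open Classical in
/-- The final content of the wires: `acc k` holds the conjunction of the first `k` literals. -/
def result (n : ℕ) (f : W → Bool) (v : W) : Bool :=
  if ∃ k, A.acc k = v then
    decide (∃ k : Fin (m + 1), A.acc k = v ∧ k.val ≤ n ∧ ∀ j : Fin m, j.val < k.val →
      f (A.lit j) = A.pol j)
  else f v

theorem result_acc (n : ℕ) (f : W → Bool) (k : Fin (m + 1)) : A.result n f (A.acc k) = true ↔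
    k.val ≤ n ∧ ∀ j : Fin m, j.val < k.val → f (A.lit j) = A.pol j := by
  classical
  rw [result, if_pos ⟨k, rfl⟩, decide_eq_true_iff]
  constructor
  · rintro ⟨k', h, h'⟩
    rwa [A.acc_inj h] at h'
  · exact fun h => ⟨k, rfl, h⟩

theorem result_of_ne (n : ℕ) (f : W → Bool) (v : W) (hv : ∀ k, A.acc k ≠ v) :
    A.result n f v = f v :=
  if_neg fun ⟨k, hk⟩ => hv k hk

theorem blocks_length_le : ∀ c ∈ (A.blocks : List (List (Gate W N d s b))), c.length ≤ 5 := by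
  have h : ∀ n hn, ∀ c ∈ (A.steps n hn : List (List (Gate W N d s b))), c.length ≤ 5 :=
      fun n hn => by
    induction n with
    | zero => simp [steps]
    | succ n ih =>
      intro c hc
      rw [steps, List.mem_append, List.mem_singleton] at hc
      rcases hc with hc | rfl
      · exact ih _ c hc
      · simp [toffoli]
  intro c hc
  rw [blocks, List.mem_append] at hc
  rcases hc with hc | hc
  · rw [List.mem_pair] at hc
    rcases hc with rfl | rfl <;> simp [cnot]
  · exact h m le_rfl c hc

variable [Fintype W] [DecidableEq W] {V : Matrix (Fin N × Fin d) (Fin N) ℂ} {B : BlackBox V s}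

theorem steps_mulVec_ket (n : ℕ) (h : n ≤ m) (f : W → Bool) :
    circuitMatrix B (A.steps n h : List (List (Gate W N d s b))).flatten *ᵥ ket (A.result 0 f) =
      ket (A.result n f) := by
  induction n with
  | zero => rw [steps, List.flatten_nil, circuitMatrix, Matrix.one_mulVec]
  | succ n ih =>
    rw [steps, List.flatten_append, circuitMatrix_append, ← Matrix.mulVec_mulVec, ih,
      List.flatten_singleton, implements_toffoli]
    congr 1
    ext v
    have hlit : ∀ j, A.result n f (A.lit j) = f (A.lit j) := fun j =>
      A.result_of_ne _ _ _ fun k => A.acc_ne_lit k j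
    by_cases hv : ∃ k, A.acc k = v
    · obtain ⟨k, rfl⟩ := hv
      by_cases hk : k = ⟨n + 1, by omega⟩
      · subst hk
        rw [xorAt, Function.update_self, hlit, Bool.eq_iff_iff, result_acc]
        have h0 : A.result n f (A.acc ⟨n + 1, by omega⟩) = false := by
          rw [← Bool.not_eq_true, result_acc]
          simp
        rw [h0, Bool.false_xor, Bool.and_eq_true, beq_iff_eq, beq_iff_eq, result_acc]
        constructor
        · rintro ⟨⟨-, h1⟩, h2⟩
          refine ⟨le_rfl, fun j hj => ?_⟩
          rcases Nat.lt_succ_iff_lt_or_eq.1 hj with hj | hj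
          · exact h1 j hj
          · have : j = ⟨n, h⟩ := Fin.ext hj
            rw [this, h2]
        · exact fun h1 => ⟨⟨le_rfl, fun j hj => h1.2 j (hj.trans (Nat.lt_succ_self n))⟩,
            h1.2 _ (Nat.lt_succ_self n)⟩
      · rw [xorAt, Function.update_of_ne (A.acc_inj.ne hk), Bool.eq_iff_iff, result_acc, result_acc]
        have : k.val ≠ n + 1 := fun h => hk (Fin.ext h)
        constructor
        · exact fun h1 => ⟨by omega, h1.2⟩
        · exact fun h1 => ⟨by omega, h1.2⟩
    · push Not at hv
      rw [xorAt, Function.update_of_ne (hv _).symm, A.result_of_ne _ _ _ hv,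
        A.result_of_ne _ _ _ hv]

theorem blocks_mulVec_ket (f : W → Bool) (hf : ∀ k, f (A.acc k) = false) :
    circuitMatrix B (A.blocks : List (List (Gate W N d s b))).flatten *ᵥ ket f =
      ket (A.result m f) := by
  rw [blocks, List.flatten_append, circuitMatrix_append, ← Matrix.mulVec_mulVec, List.flatten_cons,
    List.flatten_singleton, circuitMatrix_append, ← Matrix.mulVec_mulVec, implements_cnot,
    implements_cnot, ← steps_mulVec_ket (B := B) A m le_rfl]
  congr 2
  ext v
  by_cases hv : ∃ k, A.acc k = v
  · obtain ⟨k, rfl⟩ := hv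
    by_cases hk : k = 0
    · subst hk
      have h1 : A.result 0 f (A.acc 0) = true := (A.result_acc 0 f 0).2 ⟨le_rfl, by simp⟩
      rw [h1]
      have hz := (A.acc_ne_z 0).symm
      cases h : f A.z <;> simp [xorAt, hf, hz, h]
    · have h1 : A.result 0 f (A.acc k) = false := by
        rw [← Bool.not_eq_true, result_acc]
        rintro ⟨h, -⟩
        exact hk (Fin.ext (by simpa using h))
      rw [h1, xorAt, Function.update_of_ne (A.acc_inj.ne hk), xorAt,
        Function.update_of_ne (A.acc_inj.ne hk), hf]
  · push Not at hv
    rw [A.result_of_ne _ _ _ hv, xorAt, Function.update_of_ne (hv _).symm, xorAt,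
      Function.update_of_ne (hv _).symm]

theorem blocks_self_inverse : ∀ c ∈ (A.blocks : List (List (Gate W N d s b))),
    circuitMatrix B c * circuitMatrix B c = 1 := by
  have h : ∀ n hn, ∀ c ∈ (A.steps n hn : List (List (Gate W N d s b))),
      circuitMatrix B c * circuitMatrix B c = 1 := fun n hn => by
    induction n with
    | zero => simp [steps]
    | succ n ih =>
      intro c hc
      rw [steps, List.mem_append, List.mem_singleton] at hc
      rcases hc with hc | rfl
      · exact ih _ c hc
      · exact toffoli_mul_self ..
  intro c hc
  rw [blocks, List.mem_append] at hc
  rcases hc with hc | hc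
  · rw [List.mem_pair] at hc
    rcases hc with rfl | rfl <;> exact cnot_mul_self ..
  · exact h m le_rfl c hc

end AndLayout

end AndChain

/-! ### The registers -/

section Registers

instance SlotBit.instDecidableEq {P : Type} {b : ℕ} : DecidableEq (SlotBit P b) :=
  Classical.decEq _

/-- The bits of a slot: the flag, the position bits, and twice `2 * b` value bits. -/
def SlotBit.equivSum (P : Type) (b : ℕ) : SlotBit P b ≃ Unit ⊕ P ⊕ Fin (2 * b) ⊕ Fin (2 * b) where
  toFun
    | .flag => .inl ()
    | .pos i => .inr (.inl i)
    | .re t => .inr (.inr (.inl t))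
    | .im t => .inr (.inr (.inr t))
  invFun
    | .inl _ => .flag
    | .inr (.inl i) => .pos i
    | .inr (.inr (.inl t)) => .re t
    | .inr (.inr (.inr t)) => .im t
  left_inv x := by cases x <;> rfl
  right_inv x := by rcases x with _ | _ | _ | _ <;> rfl

instance SlotBit.instFintype {P : Type} [Fintype P] {b : ℕ} : Fintype (SlotBit P b) :=
  Fintype.ofEquiv _ (SlotBit.equivSum P b).symm

theorem SlotBit.card_eq (P : Type) [Fintype P] (b : ℕ) :
    Fintype.card (SlotBit P b) = 1 + (Fintype.card P + (2 * b + 2 * b)) := by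
  simp [Fintype.card_congr (SlotBit.equivSum P b)]

/-- The qubits of a register that holds a row index. -/
abbrev RowPos (N d : ℕ) : Type := Fin (qubits N) ⊕ Fin (qubits d)

/-- The literals of the test whether an entry contributes: two positions are compared bit by bit,
the flag of a row slot and a value bit of a column slot are inspected. -/
abbrev Literal (N d : ℕ) : Type := RowPos N d ⊕ Fin (qubits N) ⊕ Bool

/-- The number of literals. -/
abbrev numLiterals (N d : ℕ) : ℕ := Fintype.card (Literal N d)

/-- The ancilla qubits: a flag that tells rows (`true`) from columns (`false`), a register for row
indices, buffers for the answers to column and row queries, and accumulators. -/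
inductive Anc (N d s b : ℕ) : Type
  | flag
  | row (p : RowPos N d)
  | colBuf (o : Fin s × SlotBit (RowPos N d) b)
  | rowBuf (o : Fin s × SlotBit (Fin (qubits N)) b)
  | acc (k : Fin (numLiterals N d + 1))

instance Anc.instDecidableEq {N d s b : ℕ} : DecidableEq (Anc N d s b) := Classical.decEq _

/-- The ancilla qubits, register by register. -/
def Anc.equivSum (N d s b : ℕ) : Anc N d s b ≃ Unit ⊕ RowPos N d ⊕
    (Fin s × SlotBit (RowPos N d) b) ⊕ (Fin s × SlotBit (Fin (qubits N)) b) ⊕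
      Fin (numLiterals N d + 1) where
  toFun
    | .flag => .inl ()
    | .row p => .inr (.inl p)
    | .colBuf o => .inr (.inr (.inl o))
    | .rowBuf o => .inr (.inr (.inr (.inl o)))
    | .acc k => .inr (.inr (.inr (.inr k)))
  invFun
    | .inl _ => .flag
    | .inr (.inl p) => .row p
    | .inr (.inr (.inl o)) => .colBuf o
    | .inr (.inr (.inr (.inl o))) => .rowBuf o
    | .inr (.inr (.inr (.inr k))) => .acc k
  left_inv x := by cases x <;> rfl
  right_inv x := by rcases x with _ | _ | _ | _ | _ <;> rfl

instance Anc.instFintype {N d s b : ℕ} : Fintype (Anc N d s b) :=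
  Fintype.ofEquiv _ (Anc.equivSum N d s b).symm

theorem Anc.card_eq (N d s b : ℕ) : Fintype.card (Anc N d s b) =
    1 + ((qubits N + qubits d) + (s * (1 + ((qubits N + qubits d) + (2 * b + 2 * b))) +
      (s * (1 + (qubits N + (2 * b + 2 * b))) +
        ((qubits N + qubits d) + (qubits N + 2) + 1)))) := by
  simp [Fintype.card_congr (Anc.equivSum N d s b), SlotBit.card_eq]

/-- All qubits: the system register and the ancilla qubits. -/
abbrev Reg (N d s b : ℕ) : Type := Fin (qubits N) ⊕ Anc N d s b

/-- The basis state with given contents of the registers. -/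
def regState {N d s b : ℕ} (F : Bool) (X : Fin (qubits N) → Bool) (R : RowPos N d → Bool)
    (CB : Fin s × SlotBit (RowPos N d) b → Bool)
    (RB : Fin s × SlotBit (Fin (qubits N)) b → Bool)
    (A : Fin (numLiterals N d + 1) → Bool) : Reg N d s b → Bool
  | .inl i => X i
  | .inr .flag => F
  | .inr (.row p) => R p
  | .inr (.colBuf o) => CB o
  | .inr (.rowBuf o) => RB o
  | .inr (.acc k) => A k

end Registers

/-! ### Computing the partner of a row or column -/

section Load

variable {N d s b : ℕ} {V : Matrix (Fin N × Fin d) (Fin N) ℂ} {B : BlackBox V s}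
  (F : Bool) (X : Fin (qubits N) → Bool) (R : RowPos N d → Bool)
  (CB : Fin s × SlotBit (RowPos N d) b → Bool) (RB : Fin s × SlotBit (Fin (qubits N)) b → Bool)
  (A : Fin (numLiterals N d + 1) → Bool)

/-- The wires of a column query from the system register to the column buffer. -/
def colWires (N d s b : ℕ) :
    Fin (qubits N) ⊕ (Fin s × SlotBit (RowPos N d) b) ↪ Reg N d s b where
  toFun := Sum.elim Sum.inl fun o => Sum.inr (.colBuf o)
  inj' := by rintro (_ | _) (_ | _) h <;> simp_all

/-- The wires of a row query from the row register to the row buffer. -/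
def rowWires (N d s b : ℕ) :
    RowPos N d ⊕ (Fin s × SlotBit (Fin (qubits N)) b) ↪ Reg N d s b where
  toFun := Sum.elim (fun p => Sum.inr (.row p)) fun o => Sum.inr (.rowBuf o)
  inj' := by rintro (_ | _) (_ | _) h <;> simp_all

/-- The column query. -/
def queryCol (N d s b : ℕ) : List (Gate (Reg N d s b) N d s b) := [.colQuery (colWires N d s b)]

/-- The row query. -/
def queryRow (N d s b : ℕ) : List (Gate (Reg N d s b) N d s b) := [.rowQuery (rowWires N d s b)]

theorem queryCol_mulVec : circuitMatrix B (queryCol N d s b) *ᵥ ket (regState F X R CB RB A) =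
    ket (regState F X R (fun o => xor (CB o) (colAnswer B b X o)) RB A) := by
  rw [queryCol, circuitMatrix_singleton, Gate.matrix, queryMatrix_mulVec_ket]
  congr 1
  ext v
  by_cases hv : ∃ o, v = Sum.inr (.colBuf o)
  · obtain ⟨o, rfl⟩ := hv
    exact queryMap_output (colWires N d s b) _ _ o
  · rw [queryMap_of_ne _ _ _ _ fun o h => hv ⟨o, h.symm⟩]
    rcases v with v | (_ | _ | o | _ | _) <;> first | rfl | exact absurd ⟨o, rfl⟩ hv

theorem queryRow_mulVec : circuitMatrix B (queryRow N d s b) *ᵥ ket (regState F X R CB RB A) =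
    ket (regState F X R CB (fun o => xor (RB o) (rowAnswer B b R o)) A) := by
  rw [queryRow, circuitMatrix_singleton, Gate.matrix, queryMatrix_mulVec_ket]
  congr 1
  ext v
  by_cases hv : ∃ o, v = Sum.inr (.rowBuf o)
  · obtain ⟨o, rfl⟩ := hv
    exact queryMap_output (rowWires N d s b) _ _ o
  · rw [queryMap_of_ne _ _ _ _ fun o h => hv ⟨o, h.symm⟩]
    rcases v with v | (_ | _ | _ | o | _) <;> first | rfl | exact absurd ⟨o, rfl⟩ hv

theorem queryCol_mul_self :
    circuitMatrix B (queryCol N d s b) * circuitMatrix B (queryCol N d s b) = 1 :=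
  Implements.mul_self (φ := queryMap (colWires N d s b) (colAnswer B b))
    (fun f => by rw [queryCol, circuitMatrix_singleton, Gate.matrix, queryMatrix_mulVec_ket])
    (queryMap_queryMap _ _)

theorem queryRow_mul_self :
    circuitMatrix B (queryRow N d s b) * circuitMatrix B (queryRow N d s b) = 1 :=
  Implements.mul_self (φ := queryMap (rowWires N d s b) (rowAnswer B b))
    (fun f => by rw [queryRow, circuitMatrix_singleton, Gate.matrix, queryMatrix_mulVec_ket])
    (queryMap_queryMap _ _)

/-- Add the position in slot `i` of the column buffer to the row register, if the flag is unset. -/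
def copyCol (N d b : ℕ) {s : ℕ} (i : Fin s) : List (List (Gate (Reg N d s b) N d s b)) :=
  Finset.univ.toList.map fun p : RowPos N d =>
    toffoli (Sum.inr .flag) false (Sum.inr (.colBuf (i, .pos p))) true (Sum.inr (.row p))
      (by simp) (by simp) (by simp)

/-- Add the position in slot `j` of the row buffer to the system register, if the flag is set. -/
def copyRow (N d b : ℕ) {s : ℕ} (j : Fin s) : List (List (Gate (Reg N d s b) N d s b)) :=
  Finset.univ.toList.map fun p : Fin (qubits N) =>
    toffoli (Sum.inr .flag) true (Sum.inr (.rowBuf (j, .pos p))) true (Sum.inl p)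
      (by simp) (by simp) (by simp)

/-- Add the row register to the position in slot `i` of the column buffer. -/
def compareCol (N d b : ℕ) {s : ℕ} (i : Fin s) : List (List (Gate (Reg N d s b) N d s b)) :=
  Finset.univ.toList.map fun p : RowPos N d =>
    cnot (Sum.inr (.row p)) true (Sum.inr (.colBuf (i, .pos p))) (by simp)

/-- Add the system register to the position in slot `j` of the row buffer. -/
def compareRow (N d b : ℕ) {s : ℕ} (j : Fin s) : List (List (Gate (Reg N d s b) N d s b)) :=
  Finset.univ.toList.map fun p : Fin (qubits N) =>
    cnot (Sum.inl p) true (Sum.inr (.rowBuf (j, .pos p))) (by simp)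

/-- The content of a buffer after the bits `r` have been added to the position in slot `i`. -/
def addToSlot {P : Type} {s b : ℕ} (i : Fin s) (r : P → Bool) (buf : Fin s × SlotBit P b → Bool) :
    Fin s × SlotBit P b → Bool
  | (i', .pos p) => if i' = i then xor (buf (i', .pos p)) (r p) else buf (i', .pos p)
  | o => buf o

theorem copyCol_mulVec (i : Fin s) :
    circuitMatrix B (copyCol N d b i).flatten *ᵥ ket (regState F X R CB RB A) =
      ket (regState F X (fun p => xor (R p) (!F && CB (i, .pos p))) CB RB A) := by
  rw [copyCol]
  refine flatten_mulVec_ket_of_xorAt _ (Finset.nodup_toList _) _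
    (fun p : RowPos N d => (Sum.inr (.row p) : Reg N d s b))
    (fun p q h => by simpa using h)
    (fun p f => f (Sum.inr .flag) == false && f (Sum.inr (.colBuf (i, .pos p))) == true)
    (fun p => implements_toffoli _ _ _ _ _ _ _ _) ?_ _ _ ?_ ?_
  · intro p q f y; simp
  · intro p _; cases F <;> simp [regState]
  · intro v hv
    rcases v with v | (_ | p | _ | _ | _) <;> first | rfl | exact absurd rfl (hv p (by simp))

theorem copyRow_mulVec (j : Fin s) :
    circuitMatrix B (copyRow N d b j).flatten *ᵥ ket (regState F X R CB RB A) =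
      ket (regState F (fun p => xor (X p) (F && RB (j, .pos p))) R CB RB A) := by
  rw [copyRow]
  refine flatten_mulVec_ket_of_xorAt _ (Finset.nodup_toList _) _
    (fun p : Fin (qubits N) => (Sum.inl p : Reg N d s b))
    (fun p q h => by simpa using h)
    (fun p f => f (Sum.inr .flag) == true && f (Sum.inr (.rowBuf (j, .pos p))) == true)
    (fun p => implements_toffoli _ _ _ _ _ _ _ _) ?_ _ _ ?_ ?_
  · intro p q f y; simp
  · intro p _; cases F <;> simp [regState]
  · intro v hv
    rcases v with p | (_ | _ | _ | _ | _) <;> first | rfl | exact absurd rfl (hv p (by simp))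

theorem compareCol_mulVec (i : Fin s) :
    circuitMatrix B (compareCol N d b i).flatten *ᵥ ket (regState F X R CB RB A) =
      ket (regState F X R (addToSlot i R CB) RB A) := by
  rw [compareCol]
  refine flatten_mulVec_ket_of_xorAt _ (Finset.nodup_toList _) _
    (fun p : RowPos N d => (Sum.inr (.colBuf (i, .pos p)) : Reg N d s b))
    (fun p q h => by simpa using h)
    (fun p f => f (Sum.inr (.row p)) == true) (fun p => implements_cnot _ _ _ _) ?_ _ _ ?_ ?_
  · intro p q f y; simp
  · intro p _; simp [regState, addToSlot]
  · intro v hv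
    rcases v with v | (_ | _ | ⟨i', o⟩ | _ | _) <;> try rfl
    cases o <;> try rfl
    rename_i p
    by_cases h : i' = i
    · subst h; exact absurd rfl (hv p (by simp))
    · simp [regState, addToSlot, h]

theorem compareRow_mulVec (j : Fin s) :
    circuitMatrix B (compareRow N d b j).flatten *ᵥ ket (regState F X R CB RB A) =
      ket (regState F X R CB (addToSlot j X RB) A) := by
  rw [compareRow]
  refine flatten_mulVec_ket_of_xorAt _ (Finset.nodup_toList _) _
    (fun p : Fin (qubits N) => (Sum.inr (.rowBuf (j, .pos p)) : Reg N d s b))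
    (fun p q h => by simpa using h)
    (fun p f => f (Sum.inl p) == true) (fun p => implements_cnot _ _ _ _) ?_ _ _ ?_ ?_
  · intro p q f y; simp
  · intro p _; simp [regState, addToSlot]
  · intro v hv
    rcases v with v | (_ | _ | _ | ⟨j', o⟩ | _) <;> try rfl
    cases o <;> try rfl
    rename_i p
    by_cases h : j' = j
    · subst h; exact absurd rfl (hv p (by simp))
    · simp [regState, addToSlot, h]

/-- The bit with index `t` of the real (`comp = false`) or imaginary part of a value. -/
def valueBit {P : Type} {b : ℕ} (comp : Bool) (t : Fin (2 * b)) : SlotBit P b :=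
  if comp then .im t else .re t

/-- The wires inspected by the test whether an entry contributes to the term of the Hamiltonian
given by the slots `i`, `j` and the value bit `t`. -/
def testWire (i j : Fin s) (comp : Bool) (t : Fin (2 * b)) : Literal N d → Reg N d s b
  | .inl p => Sum.inr (.colBuf (i, .pos p))
  | .inr (.inl p) => Sum.inr (.rowBuf (j, .pos p))
  | .inr (.inr false) => Sum.inr (.rowBuf (j, .flag))
  | .inr (.inr true) => Sum.inr (.colBuf (i, valueBit comp t))

/-- The values that the inspected wires should have: after the comparison, positions that agree have
become zero. -/
def testValue : Literal N d → Bool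
  | .inl _ => false
  | .inr (.inl _) => false
  | .inr (.inr _) => true

/-- The wires of the circuit that performs the test. -/
def testLayout (i j : Fin s) (comp : Bool) (t : Fin (2 * b)) :
    AndLayout (Reg N d s b) (numLiterals N d) where
  acc k := Sum.inr (.acc k)
  lit l := testWire i j comp t ((Fintype.equivFin (Literal N d)).symm l)
  pol l := testValue ((Fintype.equivFin (Literal N d)).symm l)
  z := Sum.inr .flag
  acc_inj _ _ h := by simpa using h
  acc_ne_lit k l := by
    rcases (Fintype.equivFin (Literal N d)).symm l with p | p | _ | _ <;> simp [testWire]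
  acc_ne_z k := by simp

/-- The blocks of the circuit that turns columns and rows into pairs of a column and a row, and
tests whether the entry at the resulting position contributes. -/
def loadBlocks (i j : Fin s) (comp : Bool) (t : Fin (2 * b)) :
    List (List (Gate (Reg N d s b) N d s b)) :=
  [queryCol N d s b] ++ copyCol N d b i ++ [queryCol N d s b] ++
  [queryRow N d s b] ++ copyRow N d b j ++ [queryRow N d s b] ++
  [queryCol N d s b] ++ [queryRow N d s b] ++ compareCol N d b i ++ compareRow N d b j ++
  (testLayout i j comp t).blocks

theorem loadBlocks_self_inverse (i j : Fin s) (comp : Bool) (t : Fin (2 * b)) :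
    ∀ c ∈ (loadBlocks i j comp t : List (List (Gate (Reg N d s b) N d s b))),
      circuitMatrix B c * circuitMatrix B c = 1 := by
  intro c hc
  simp only [loadBlocks, List.mem_append, List.mem_singleton, copyCol, copyRow, compareCol,
    compareRow, List.mem_map] at hc
  rcases hc with (((((((((rfl | ⟨p, -, rfl⟩) | rfl) | rfl) | ⟨p, -, rfl⟩) | rfl) | rfl) | rfl) |
    ⟨p, -, rfl⟩) | ⟨p, -, rfl⟩) | hc
  · exact queryCol_mul_self
  · exact toffoli_mul_self ..
  · exact queryCol_mul_self
  · exact queryRow_mul_self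
  · exact toffoli_mul_self ..
  · exact queryRow_mul_self
  · exact queryCol_mul_self
  · exact queryRow_mul_self
  · exact cnot_mul_self ..
  · exact cnot_mul_self ..
  · exact AndLayout.blocks_self_inverse _ c hc

theorem length_flatten_loadBlocks (i j : Fin s) (comp : Bool) (t : Fin (2 * b)) :
    (loadBlocks i j comp t : List (List (Gate (Reg N d s b) N d s b))).flatten.length ≤
      5 * (10 + 6 * qubits N + 3 * qubits d) := by
  have h : ∀ c ∈ (loadBlocks i j comp t : List (List (Gate (Reg N d s b) N d s b))),
      c.length ≤ 5 := by
    intro c hc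
    simp only [loadBlocks, List.mem_append, List.mem_singleton, copyCol, copyRow, compareCol,
      compareRow, List.mem_map] at hc
    rcases hc with (((((((((rfl | ⟨p, -, rfl⟩) | rfl) | rfl) | ⟨p, -, rfl⟩) | rfl) | rfl) | rfl) |
      ⟨p, -, rfl⟩) | ⟨p, -, rfl⟩) | hc
    all_goals first
      | exact AndLayout.blocks_length_le _ c hc
      | simp [queryCol, queryRow, toffoli, cnot]
  rw [List.length_flatten]
  refine (List.sum_le_card_nsmul _ 5 fun n hn => ?_).trans ?_
  · obtain ⟨c, hc, rfl⟩ := List.mem_map.1 hn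
    exact h c hc
  · simp only [loadBlocks, List.length_map, List.length_append, copyCol,
      copyRow, compareCol, compareRow, Finset.length_toList, AndLayout.blocks, List.length_cons,
      List.length_nil, AndLayout.length_steps, Finset.card_univ, Fintype.card_sum, Fintype.card_fin,
      Fintype.card_bool, smul_eq_mul, numLiterals, Literal]
    omega

/-- The state of all registers once a column `X` and a row `R` have been computed. -/
def loaded (B : BlackBox V s) (i j : Fin s) (comp : Bool) (t : Fin (2 * b)) (F : Bool)
    (X : Fin (qubits N) → Bool) (R : RowPos N d → Bool) : Reg N d s b → Bool :=
  (testLayout i j comp t).result (numLiterals N d) (regState F X R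
    (addToSlot i R (colAnswer B b X)) (addToSlot j X (rowAnswer B b R)) fun _ => false)

theorem loaded_flag (i j : Fin s) (comp : Bool) (t : Fin (2 * b)) :
    loaded B i j comp t F X R (Sum.inr .flag) = F :=
  AndLayout.result_of_ne _ _ _ _ fun k => by simp [testLayout]

/-- No wire inspected by the test depends on the flag, so the flag can be changed between loading
and unloading. -/
theorem update_loaded_flag (i j : Fin s) (comp : Bool) (t : Fin (2 * b)) (F' : Bool) :
    Function.update (loaded B i j comp t F X R) (Sum.inr .flag) F' =
      loaded B i j comp t F' X R := by
  ext v
  by_cases hv : v = Sum.inr .flag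
  · subst hv; rw [Function.update_self, loaded_flag]
  rw [Function.update_of_ne hv]
  by_cases hacc : ∃ k, v = Sum.inr (.acc k)
  · obtain ⟨k, rfl⟩ := hacc
    rw [Bool.eq_iff_iff, loaded, loaded]
    refine ((testLayout i j comp t).result_acc _ _ k).trans
      (Iff.trans ?_ ((testLayout i j comp t).result_acc _ _ k).symm)
    refine and_congr_right fun _ => forall_congr' fun l => imp_congr_right fun _ => ?_
    simp only [testLayout]
    rcases (Fintype.equivFin (Literal N d)).symm l with p | p | _ | _ <;> rfl
  · rw [loaded, loaded, AndLayout.result_of_ne, AndLayout.result_of_ne]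
    · rcases v with v | (_ | _ | _ | _ | _) <;> first | rfl | exact absurd rfl hv
    · exact fun k h => hacc ⟨k, h.symm⟩
    · exact fun k h => hacc ⟨k, h.symm⟩

theorem addToSlot_valueBit {P : Type} (comp : Bool) (t : Fin (2 * b)) (i : Fin s) (r : P → Bool)
    (buf : Fin s × SlotBit P b → Bool) :
    addToSlot i r buf (i, valueBit comp t) = buf (i, valueBit comp t) := by
  cases comp <;> rfl

/-- The outcome of the test. -/
theorem loaded_last (i j : Fin s) (comp : Bool) (t : Fin (2 * b)) :
    loaded B i j comp t F X R (Sum.inr (.acc (Fin.last _))) = true ↔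
      (∀ p, colAnswer B b X (i, .pos p) = R p) ∧ (∀ p, rowAnswer B b R (j, .pos p) = X p) ∧
      rowAnswer B b R (j, .flag) = true ∧ colAnswer B b X (i, valueBit comp t) = true := by
  rw [loaded]
  refine ((testLayout i j comp t).result_acc _ _ (Fin.last _)).trans ?_
  have h1 : ((Fin.last (numLiterals N d)).val ≤ numLiterals N d ∧
      ∀ l : Fin (numLiterals N d), l.val < (Fin.last (numLiterals N d)).val →
        regState F X R (addToSlot i R (colAnswer B b X)) (addToSlot j X (rowAnswer B b R))
          (fun _ => false) ((testLayout i j comp t).lit l) = (testLayout i j comp t).pol l) ↔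
      ∀ l : Literal N d, regState F X R (addToSlot i R (colAnswer B b X))
        (addToSlot j X (rowAnswer B b R)) (fun _ => false) (testWire i j comp t l) =
          testValue l :=
    ⟨fun h l => by simpa [testLayout] using h.2 (Fintype.equivFin _ l) (Fin.is_lt _),
      fun h => ⟨le_rfl, fun l _ => h ((Fintype.equivFin (Literal N d)).symm l)⟩⟩
  have hxor : ∀ x y : Bool, xor x y = false ↔ x = y := by decide
  rw [h1]
  constructor
  · intro h
    refine ⟨fun p => ?_, fun p => ?_, h (.inr (.inr false)), ?_⟩
    · have := h (.inl p)
      rwa [testWire, testValue, regState, addToSlot, if_pos rfl, hxor] at this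
    · have := h (.inr (.inl p))
      rwa [testWire, testValue, regState, addToSlot, if_pos rfl, hxor] at this
    · have := h (.inr (.inr true))
      rwa [testWire, testValue, regState, addToSlot_valueBit] at this
  · rintro ⟨h2, h3, h4, h5⟩ (p | p | _ | _)
    · rw [testWire, testValue, regState, addToSlot, if_pos rfl, hxor, h2]
    · rw [testWire, testValue, regState, addToSlot, if_pos rfl, hxor, h3]
    · exact h4
    · rw [testWire, testValue, regState, addToSlot_valueBit, h5]

/-- A column (unset flag) writes the row in its slot `i` to the row register, and a row (set flag)
writes the column in its slot `j` to the system register. Each of these queries is repeated to clear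
its buffer before the comparison. -/
theorem loadBlocks_mulVec (i j : Fin s) (comp : Bool) (t : Fin (2 * b)) :
    circuitMatrix B (loadBlocks i j comp t).flatten *ᵥ
        ket (regState F X R (fun _ => false) (fun _ => false) fun _ => false) =
      ket (loaded B i j comp t F
        (fun p => xor (X p) (F && rowAnswer B b
          (fun q => xor (R q) (!F && colAnswer B b X (i, .pos q))) (j, .pos p)))
        (fun q => xor (R q) (!F && colAnswer B b X (i, .pos q)))) := by
  simp only [loadBlocks, List.flatten_append, circuitMatrix_append, List.flatten_singleton,
    ← Matrix.mulVec_mulVec, queryCol_mulVec, queryRow_mulVec, copyCol_mulVec, copyRow_mulVec,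
    compareCol_mulVec, compareRow_mulVec, Bool.false_xor, Bool.xor_self]
  rw [AndLayout.blocks_mulVec_ket _ _ fun k => rfl]
  rfl

end Load

/-! ### Simulating one matching -/

section Step

variable {N d s b : ℕ} {V : Matrix (Fin N × Fin d) (Fin N) ℂ} (B : BlackBox V s)

/-- The real (`comp = false`) or imaginary part. -/
def part (comp : Bool) (z : ℂ) : ℝ := if comp then z.im else z.re

/-- The entry in row `r` and column `x` stands in slot `i` of its column and in slot `j` of its row,
and bit `t` of its real or imaginary part is set. For given `i`, `j` this is a partial matching of
columns with rows. -/
def Matched (b : ℕ) (i j : Fin s) (comp : Bool) (t : ℕ) (r : Fin N × Fin d) (x : Fin N) : Prop :=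
  B.col x i = some r ∧ B.row r j = some x ∧ fixedPointBit b (part comp (V r x)) t = true

open Classical in
/-- The matrix with entries `w` at the matched positions. -/
def matchMatrix (b : ℕ) (i j : Fin s) (comp : Bool) (t : ℕ) (w : ℂ) :
    Matrix (Fin N × Fin d) (Fin N) ℂ :=
  Matrix.of fun r x => if Matched B b i j comp t r x then w else 0

variable {B}

theorem Matched.row_unique {i j : Fin s} {comp : Bool} {t : ℕ} {r r' : Fin N × Fin d} {x : Fin N}
    (h : Matched B b i j comp t r x) (h' : Matched B b i j comp t r' x) : r = r' :=
  Option.some_injective _ (h.1.symm.trans h'.1)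

theorem Matched.col_unique {i j : Fin s} {comp : Bool} {t : ℕ} {r : Fin N × Fin d} {x x' : Fin N}
    (h : Matched B b i j comp t r x) (h' : Matched B b i j comp t r x') : x = x' :=
  Option.some_injective _ (h.2.1.symm.trans h'.2.1)

theorem rowBits_injective (N d : ℕ) : Function.Injective (rowBits N d) := by
  rintro ⟨x, a⟩ ⟨y, a'⟩ h
  have h1 : bits N x = bits N y := funext fun i => congrFun h (Sum.inl i)
  have h2 : bits d a = bits d a' := funext fun i => congrFun h (Sum.inr i)
  rw [bits_injective N h1, bits_injective d h2]

theorem colAnswer_bits (x : Fin N) (o : Fin s × SlotBit (RowPos N d) b) :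
    colAnswer B b (bits N x) o = true ↔
      ∃ r, B.col x o.1 = some r ∧ slotContent (rowBits N d r) (V r x) o.2 = true := by
  rw [colAnswer, decide_eq_true_iff]
  constructor
  · rintro ⟨x', r, h1, h2, h3⟩
    cases bits_injective N h1
    exact ⟨r, h2, h3⟩
  · rintro ⟨r, h2, h3⟩
    exact ⟨x, r, rfl, h2, h3⟩

theorem rowAnswer_rowBits (r : Fin N × Fin d) (o : Fin s × SlotBit (Fin (qubits N)) b) :
    rowAnswer B b (rowBits N d r) o = true ↔
      ∃ x, B.row r o.1 = some x ∧ slotContent (bits N x) (V r x) o.2 = true := by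
  rw [rowAnswer, decide_eq_true_iff]
  constructor
  · rintro ⟨r', x, h1, h2, h3⟩
    cases rowBits_injective N d h1
    exact ⟨x, h2, h3⟩
  · rintro ⟨x, h2, h3⟩
    exact ⟨r, x, rfl, h2, h3⟩

theorem colAnswer_pos {x : Fin N} {i : Fin s} {r : Fin N × Fin d} (h : B.col x i = some r)
    (p : RowPos N d) : colAnswer B b (bits N x) (i, .pos p) = rowBits N d r p := by
  rw [Bool.eq_iff_iff, colAnswer_bits]
  constructor
  · rintro ⟨r', h1, h2⟩
    rw [h, Option.some_inj] at h1
    rw [h1]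
    exact h2
  · exact fun h1 => ⟨r, h, h1⟩

theorem rowAnswer_pos {r : Fin N × Fin d} {j : Fin s} {x : Fin N} (h : B.row r j = some x)
    (p : Fin (qubits N)) : rowAnswer B b (rowBits N d r) (j, .pos p) = bits N x p := by
  rw [Bool.eq_iff_iff, rowAnswer_rowBits]
  constructor
  · rintro ⟨x', h1, h2⟩
    rw [h, Option.some_inj] at h1
    rw [h1]
    exact h2
  · exact fun h1 => ⟨x, h, h1⟩

theorem rowAnswer_flag (r : Fin N × Fin d) (j : Fin s) :
    rowAnswer B b (rowBits N d r) (j, .flag) = true ↔ ∃ x, B.row r j = some x := by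
  rw [rowAnswer_rowBits]
  exact exists_congr fun x => and_iff_left rfl

theorem colAnswer_valueBit (x : Fin N) (i : Fin s) (comp : Bool) (t : Fin (2 * b)) :
    colAnswer B b (bits N x) (i, valueBit comp t) = true ↔
      ∃ r, B.col x i = some r ∧ fixedPointBit b (part comp (V r x)) t = true := by
  rw [colAnswer_bits]
  cases comp <;> rfl

/-- The basis states that represent columns `(x, inr ())` and rows `(y, inl a)` between the
steps. -/
def basisState (s b : ℕ) (p : Fin N × (Fin d ⊕ Unit)) : Reg N d s b → Bool :=
  Sum.elim
    (fun a => regState true (fun _ => false) (rowBits N d (p.1, a)) (fun _ => false)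
      (fun _ => false) fun _ => false)
    (fun _ => regState false (bits N p.1) (fun _ => false) (fun _ => false) (fun _ => false)
      fun _ => false) p.2

/-- The row register of a column after loading: the position in slot `i`. -/
def loadedRow (B : BlackBox V s) (b : ℕ) (i : Fin s) (x : Fin N) : RowPos N d → Bool :=
  fun q => colAnswer B b (bits N x) (i, .pos q)

/-- The system register of a row after loading: the position in slot `j`. -/
def loadedCol (B : BlackBox V s) (b : ℕ) (j : Fin s) (r : Fin N × Fin d) : Fin (qubits N) → Bool :=
  fun p => rowAnswer B b (rowBits N d r) (j, .pos p)

theorem load_col (i j : Fin s) (comp : Bool) (t : Fin (2 * b)) (x : Fin N) (u : Unit) :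
    circuitMatrix B (loadBlocks i j comp t).flatten *ᵥ
        ket (basisState (d := d) s b (x, Sum.inr u)) =
      ket (loaded B i j comp t false (bits N x) (loadedRow B b i x)) := by
  rw [basisState, Sum.elim_inr, loadBlocks_mulVec]
  simp only [Bool.false_and, Bool.xor_false, Bool.not_false, Bool.true_and, Bool.false_xor]
  rfl

theorem load_row (i j : Fin s) (comp : Bool) (t : Fin (2 * b)) (r : Fin N × Fin d) :
    circuitMatrix B (loadBlocks i j comp t).flatten *ᵥ ket (basisState s b (r.1, Sum.inl r.2)) =
      ket (loaded B i j comp t true (loadedCol B b j r) (rowBits N d r)) := by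
  rw [basisState, Sum.elim_inl, loadBlocks_mulVec]
  simp only [Bool.xor_false, Bool.not_true, Bool.true_and, Bool.false_and, Bool.false_xor]
  rfl

theorem Matched.loadedRow_eq {i j : Fin s} {comp : Bool} {t : ℕ} {r : Fin N × Fin d} {x : Fin N}
    (h : Matched B b i j comp t r x) : loadedRow B b i x = rowBits N d r :=
  funext fun p => colAnswer_pos h.1 p

theorem Matched.loadedCol_eq {i j : Fin s} {comp : Bool} {t : ℕ} {r : Fin N × Fin d} {x : Fin N}
    (h : Matched B b i j comp t r x) : loadedCol B b j r = bits N x :=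
  funext fun p => rowAnswer_pos h.2.1 p

theorem test_col (i j : Fin s) (comp : Bool) (t : Fin (2 * b)) (F : Bool) (x : Fin N) :
    loaded B i j comp t F (bits N x) (loadedRow B b i x) (Sum.inr (.acc (Fin.last _))) = true ↔
      ∃ r, Matched B b i j comp t r x := by
  rw [loaded_last, colAnswer_valueBit]
  constructor
  · rintro ⟨-, h2, h3, r, h4, h5⟩
    have hR : loadedRow B b i x = rowBits N d r := funext fun p => colAnswer_pos h4 p
    rw [hR] at h2 h3
    obtain ⟨x', h6⟩ := (rowAnswer_flag r j).1 h3
    have : bits N x' = bits N x := funext fun p => by rw [← h2, rowAnswer_pos h6]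
    rw [bits_injective N this] at h6
    exact ⟨r, h4, h6, h5⟩
  · rintro ⟨r, h⟩
    rw [h.loadedRow_eq]
    exact ⟨fun p => colAnswer_pos h.1 p, fun p => rowAnswer_pos h.2.1 p,
      (rowAnswer_flag r j).2 ⟨x, h.2.1⟩, r, h.1, h.2.2⟩

/-- Loading starts from a column or from a row; the test accepts the same pairs either way. -/
theorem test_row (i j : Fin s) (comp : Bool) (t : Fin (2 * b)) (F : Bool) (r : Fin N × Fin d) :
    loaded B i j comp t F (loadedCol B b j r) (rowBits N d r) (Sum.inr (.acc (Fin.last _))) = true ↔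
      ∃ x, Matched B b i j comp t r x := by
  rw [loaded_last]
  constructor
  · rintro ⟨h1, -, h3, h4⟩
    obtain ⟨x, h6⟩ := (rowAnswer_flag r j).1 h3
    have hX : loadedCol B b j r = bits N x := funext fun p => rowAnswer_pos h6 p
    rw [hX] at h1 h4
    obtain ⟨r', h7, h8⟩ := (colAnswer_valueBit x i comp t).1 h4
    have : rowBits N d r' = rowBits N d r := funext fun p => by rw [← h1, colAnswer_pos h7]
    rw [rowBits_injective N d this] at h7 h8
    exact ⟨x, h7, h6, h8⟩
  · rintro ⟨x, h⟩
    rw [h.loadedCol_eq]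
    exact ⟨fun p => colAnswer_pos h.1 p, fun p => rowAnswer_pos h.2.1 p,
      (rowAnswer_flag r j).2 ⟨x, h.2.1⟩, (colAnswer_valueBit x i comp t).2 ⟨r, h.1, h.2.2⟩⟩

/-- The one-qubit rotation `cos τ - i sin τ (w |1⟩⟨0| + w̄ |0⟩⟨1|)`, for a phase `w`. -/
def rotation (τ : ℝ) (w : ℂ) (hw : w * star w = 1) : Matrix.unitaryGroup Bool ℂ :=
  ⟨Matrix.of fun x y => if x = y then (Real.cos τ : ℂ) else
    -(Complex.I * Real.sin τ) * (if x then w else star w), by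
    have h1 : (Real.cos τ : ℂ) * Real.cos τ + Real.sin τ * Real.sin τ = 1 := by
      rw [← Complex.ofReal_mul, ← Complex.ofReal_mul, ← Complex.ofReal_add, ← sq, ← sq,
        Real.cos_sq_add_sin_sq, Complex.ofReal_one]
    have hI := Complex.I_mul_I
    rw [Complex.star_def] at hw
    rw [Matrix.mem_unitaryGroup_iff]
    ext x y
    cases x <;> cases y <;>
      simp [Matrix.mul_apply, -Complex.ofReal_cos, -Complex.ofReal_sin]
    · linear_combination h1 + (Real.sin τ * Real.sin τ : ℂ) * hw
        - (Real.sin τ * Real.sin τ * (w * (starRingEnd ℂ) w) : ℂ) * hI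
    · ring
    · ring
    · linear_combination h1 + (Real.sin τ * Real.sin τ : ℂ) * hw
        - (Real.sin τ * Real.sin τ * (w * (starRingEnd ℂ) w) : ℂ) * hI⟩

/-- The circuit of one simulation step: load, rotate the flag if the test has succeeded, unload. -/
def stepCircuit (i j : Fin s) (comp : Bool) (t : Fin (2 * b)) (M : Matrix.unitaryGroup Bool ℂ) :
    List (Gate (Reg N d s b) N d s b) :=
  (loadBlocks i j comp t).flatten ++
    [ctl (Sum.inr (.acc (Fin.last _))) true (Sum.inr .flag) (by simp) M] ++
    (loadBlocks i j comp t).reverse.flatten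

theorem length_stepCircuit (i j : Fin s) (comp : Bool) (t : Fin (2 * b))
    (M : Matrix.unitaryGroup Bool ℂ) :
    (stepCircuit i j comp t M : List (Gate (Reg N d s b) N d s b)).length ≤
      101 + 60 * qubits N + 30 * qubits d := by
  have h := length_flatten_loadBlocks (N := N) (d := d) i j comp t
  have h' :
      (loadBlocks i j comp t : List (List (Gate (Reg N d s b) N d s b))).reverse.flatten.length =
        (loadBlocks i j comp t : List (List (Gate (Reg N d s b) N d s b))).flatten.length := by
    simp [List.length_flatten, List.map_reverse, List.sum_reverse]
  rw [stepCircuit, List.length_append, List.length_append, h', List.length_singleton]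
  omega

theorem unload_mulVec (i j : Fin s) (comp : Bool) (t : Fin (2 * b))
    (v w : (Reg N d s b → Bool) → ℂ)
    (h : circuitMatrix B (loadBlocks i j comp t).flatten *ᵥ v = w) :
    circuitMatrix B (loadBlocks i j comp t).reverse.flatten *ᵥ w = v := by
  rw [← h, Matrix.mulVec_mulVec,
    circuitMatrix_reverse_flatten _ _ (loadBlocks_self_inverse i j comp t), Matrix.one_mulVec]

theorem stepCircuit_mulVec_of_test_false (i j : Fin s) (comp : Bool) (t : Fin (2 * b))
    (M : Matrix.unitaryGroup Bool ℂ) (f : Reg N d s b → Bool) (F : Bool)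
    (X : Fin (qubits N) → Bool) (R : RowPos N d → Bool)
    (hf : circuitMatrix B (loadBlocks i j comp t).flatten *ᵥ ket f =
      ket (loaded B i j comp t F X R))
    (h : ¬ loaded B i j comp t F X R (Sum.inr (.acc (Fin.last _))) = true) :
    circuitMatrix B (stepCircuit i j comp t M) *ᵥ ket f = ket f := by
  rw [stepCircuit, circuitMatrix_append, circuitMatrix_append, ← Matrix.mulVec_mulVec,
    ← Matrix.mulVec_mulVec, hf, circuitMatrix_singleton, ctl_mulVec_ket, if_neg h,
    ← ket_eq_superpose]
  exact unload_mulVec i j comp t _ _ hf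

theorem stepCircuit_mulVec_of_matched {i j : Fin s} {comp : Bool} {t : Fin (2 * b)}
    (M : Matrix.unitaryGroup Bool ℂ) {r : Fin N × Fin d} {x : Fin N}
    (hm : Matched B b i j comp t r x) (f : Reg N d s b → Bool) (F : Bool)
    (hf : circuitMatrix B (loadBlocks i j comp t).flatten *ᵥ ket f =
      ket (loaded B i j comp t F (bits N x) (rowBits N d r))) :
    circuitMatrix B (stepCircuit i j comp t M) *ᵥ ket f =
      (M : Matrix Bool Bool ℂ) true F • ket (basisState s b (r.1, Sum.inl r.2)) +
        (M : Matrix Bool Bool ℂ) false F • ket (basisState s b (x, Sum.inr ())) := by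
  have hacc : loaded B i j comp t F (bits N x) (rowBits N d r) (Sum.inr (.acc (Fin.last _)))
      = true := by
    have := (test_col i j comp t F x).2 ⟨r, hm⟩
    rwa [hm.loadedRow_eq] at this
  have hcol := load_col (B := B) i j comp t x ()
  have hrow := load_row (B := B) i j comp t r
  rw [hm.loadedRow_eq] at hcol
  rw [hm.loadedCol_eq] at hrow
  rw [stepCircuit, circuitMatrix_append, circuitMatrix_append, ← Matrix.mulVec_mulVec,
    ← Matrix.mulVec_mulVec, hf, circuitMatrix_singleton, ctl_mulVec_ket, if_pos hacc, loaded_flag,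
    superpose, Fintype.sum_bool, update_loaded_flag, update_loaded_flag, Matrix.mulVec_add,
    Matrix.mulVec_smul, Matrix.mulVec_smul, unload_mulVec i j comp t _ _ hcol,
    unload_mulVec i j comp t _ _ hrow, Matrix.mulVec_single_one]
  rfl

/-- The isometry from `ℂ^N ⊗ ℂ^(d+1)` to the registers. -/
def basisMatrix (N d s b : ℕ) :
    Matrix (Reg N d s b → Bool) (Fin N × (Fin d ⊕ Unit)) ℂ :=
  Matrix.of fun f p => if f = basisState s b p then 1 else 0

theorem basisMatrix_mulVec (p : Fin N × (Fin d ⊕ Unit)) :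
    basisMatrix N d s b *ᵥ Pi.single p 1 = ket (basisState s b p) := by
  ext f
  rw [Matrix.mulVec_single_one, Matrix.col_apply, basisMatrix, Matrix.of_apply, ket,
    Pi.single_apply]

/-- The evolution `exp (-iτh)`, written out as it is for a Hermitian `h` with `h³ = h`:
`cos τ - i sin τ h` on the range of `h`, and the identity on its kernel. -/
def stepMatrix {ι : Type*} [Fintype ι] [DecidableEq ι] (τ : ℝ) (h : Matrix ι ι ℂ) :
    Matrix ι ι ℂ :=
  1 + ((Real.cos τ - 1 : ℝ) : ℂ) • (h * h) - (Complex.I * Real.sin τ) • h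

theorem stepMatrix_mulVec_of_eq_zero {ι : Type*} [Fintype ι] [DecidableEq ι] (τ : ℝ)
    {h : Matrix ι ι ℂ} {v : ι → ℂ} (hv : h *ᵥ v = 0) : stepMatrix τ h *ᵥ v = v := by
  rw [stepMatrix, Matrix.sub_mulVec, Matrix.add_mulVec, Matrix.smul_mulVec, Matrix.smul_mulVec,
    ← Matrix.mulVec_mulVec, hv]
  simp

theorem stepMatrix_mulVec_of_eq_smul {ι : Type*} [Fintype ι] [DecidableEq ι] (τ : ℝ)
    {h : Matrix ι ι ℂ} {v v' : ι → ℂ} {w : ℂ} (hw : w * star w = 1) (hv : h *ᵥ v = w • v')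
    (hv' : h *ᵥ v' = star w • v) :
    stepMatrix τ h *ᵥ v = (Real.cos τ : ℂ) • v + (-(Complex.I * Real.sin τ) * w) • v' := by
  rw [stepMatrix, Matrix.sub_mulVec, Matrix.add_mulVec, Matrix.smul_mulVec, Matrix.smul_mulVec,
    ← Matrix.mulVec_mulVec, hv, Matrix.mulVec_smul, hv', Matrix.one_mulVec, smul_smul w, hw]
  ext q
  simp only [Pi.sub_apply, Pi.add_apply, Pi.smul_apply, smul_eq_mul]
  push_cast
  ring

variable (B) in
theorem matchHamiltonian_mulVec_col {i j : Fin s} {comp : Bool} {t : ℕ} (w : ℂ)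
    {r : Fin N × Fin d} {x : Fin N} (hm : Matched B b i j comp t r x) :
    blockHamiltonian (matchMatrix B b i j comp t w) *ᵥ Pi.single (x, Sum.inr ()) 1 =
      w • Pi.single (r.1, Sum.inl r.2) 1 := by
  ext ⟨y, a | u⟩
  · rw [Matrix.mulVec_single_one, Matrix.col_apply, blockHamiltonian_inl_inr, matchMatrix,
      Matrix.of_apply, Pi.smul_apply, Pi.single_apply, smul_eq_mul, mul_ite, mul_one, mul_zero]
    congr 1
    apply propext
    constructor
    · intro h; rw [← h.row_unique hm]
    · intro h
      have : (y, a) = r := by simpa [Prod.ext_iff] using h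
      rwa [this]
  · simp

variable (B) in
theorem matchHamiltonian_mulVec_row {i j : Fin s} {comp : Bool} {t : ℕ} (w : ℂ)
    {r : Fin N × Fin d} {x : Fin N} (hm : Matched B b i j comp t r x) :
    blockHamiltonian (matchMatrix B b i j comp t w) *ᵥ Pi.single (r.1, Sum.inl r.2) 1 =
      star w • Pi.single (x, Sum.inr ()) 1 := by
  ext ⟨y, a | u⟩
  · simp
  · rw [Matrix.mulVec_single_one, Matrix.col_apply, blockHamiltonian_inr_inl, matchMatrix,
      Matrix.of_apply, Pi.smul_apply, Pi.single_apply, smul_eq_mul, mul_ite, mul_one, mul_zero,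
      apply_ite star, star_zero]
    congr 1
    apply propext
    constructor
    · intro h; rw [h.col_unique hm]
    · intro h
      have : y = x := by simpa [Prod.ext_iff] using h
      rwa [this]

theorem matchHamiltonian_mulVec_col_eq_zero {i j : Fin s} {comp : Bool} {t : ℕ} (w : ℂ)
    {x : Fin N} (hm : ¬ ∃ r, Matched B b i j comp t r x) :
    blockHamiltonian (matchMatrix B b i j comp t w) *ᵥ Pi.single (x, Sum.inr ()) 1 = 0 := by
  ext ⟨y, a | u⟩
  · rw [Matrix.mulVec_single_one, Matrix.col_apply, blockHamiltonian_inl_inr, matchMatrix,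
      Matrix.of_apply, if_neg fun h => hm ⟨_, h⟩]
    rfl
  · simp

theorem matchHamiltonian_mulVec_row_eq_zero {i j : Fin s} {comp : Bool} {t : ℕ} (w : ℂ)
    {r : Fin N × Fin d} (hm : ¬ ∃ x, Matched B b i j comp t r x) :
    blockHamiltonian (matchMatrix B b i j comp t w) *ᵥ Pi.single (r.1, Sum.inl r.2) 1 = 0 := by
  ext ⟨y, a | u⟩
  · simp
  · rw [Matrix.mulVec_single_one, Matrix.col_apply, blockHamiltonian_inr_inl, matchMatrix,
      Matrix.of_apply, if_neg fun h => hm ⟨_, h⟩]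
    simp

/-- The step circuit performs `stepMatrix` exactly and restores all ancilla qubits. -/
theorem stepCircuit_mul_basisMatrix (i j : Fin s) (comp : Bool) (t : Fin (2 * b)) (τ : ℝ) (w : ℂ)
    (hw : w * star w = 1) :
    circuitMatrix B (stepCircuit i j comp t (rotation τ w hw)) * basisMatrix N d s b =
      basisMatrix N d s b * stepMatrix τ (blockHamiltonian (matchMatrix B b i j comp t w)) := by
  refine Matrix.ext_of_mulVec_single fun p => ?_
  rw [← Matrix.mulVec_mulVec, ← Matrix.mulVec_mulVec, basisMatrix_mulVec]
  obtain ⟨y, a | u⟩ := p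
  · by_cases h : ∃ x, Matched B b i j comp t (y, a) x
    · obtain ⟨x, hm⟩ := h
      have hload := load_row (B := B) i j comp t (y, a)
      rw [hm.loadedCol_eq] at hload
      rw [stepCircuit_mulVec_of_matched _ hm _ true hload,
        stepMatrix_mulVec_of_eq_smul τ (w := star w) (by rw [star_star, mul_comm, hw])
          (matchHamiltonian_mulVec_row B w hm)
          (by rw [star_star]; exact matchHamiltonian_mulVec_col B w hm),
        Matrix.mulVec_add, Matrix.mulVec_smul, Matrix.mulVec_smul, basisMatrix_mulVec,
        basisMatrix_mulVec]
      rfl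
    · rw [stepMatrix_mulVec_of_eq_zero τ (matchHamiltonian_mulVec_row_eq_zero w h),
        basisMatrix_mulVec]
      exact stepCircuit_mulVec_of_test_false i j comp t _ _ _ _ _ (load_row i j comp t (y, a))
        fun h' => h ((test_row i j comp t true (y, a)).1 h')
  · by_cases h : ∃ r, Matched B b i j comp t r y
    · obtain ⟨r, hm⟩ := h
      have hload := load_col (B := B) i j comp t y u
      rw [hm.loadedRow_eq] at hload
      rw [stepCircuit_mulVec_of_matched _ hm _ false hload,
        stepMatrix_mulVec_of_eq_smul τ hw (matchHamiltonian_mulVec_col B w hm)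
          (matchHamiltonian_mulVec_row B w hm),
        Matrix.mulVec_add, Matrix.mulVec_smul, Matrix.mulVec_smul, basisMatrix_mulVec,
        basisMatrix_mulVec, add_comm]
      rfl
    · rw [stepMatrix_mulVec_of_eq_zero τ (matchHamiltonian_mulVec_col_eq_zero w h),
        basisMatrix_mulVec]
      exact stepCircuit_mulVec_of_test_false i j comp t _ _ _ _ _ (load_col i j comp t y u)
        fun h' => h ((test_col i j comp t false y).1 h')

end Step

/-! ### Delivering the output -/

section Output

variable {N d s b : ℕ} {V : Matrix (Fin N × Fin d) (Fin N) ℂ} {B : BlackBox V s}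

/-- Add the `ℂ^N` part of the row register to the system register. -/
def outputCopy (N d s b : ℕ) : List (List (Gate (Reg N d s b) N d s b)) :=
  Finset.univ.toList.map fun p : Fin (qubits N) =>
    cnot (Sum.inr (.row (Sum.inl p))) true (Sum.inl p) (by simp)

/-- If the flag is set, add the system register to the `ℂ^N` part of the row register. -/
def outputClear (N d s b : ℕ) : List (List (Gate (Reg N d s b) N d s b)) :=
  Finset.univ.toList.map fun p : Fin (qubits N) =>
    toffoli (Sum.inr .flag) true (Sum.inl p) true (Sum.inr (.row (Sum.inl p)))
      (by simp) (by simp) (by simp)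

/-- The circuit that moves the `ℂ^N` part of a row index to the system register. -/
def outputCircuit (N d s b : ℕ) : List (Gate (Reg N d s b) N d s b) :=
  (outputCopy N d s b).flatten ++ (outputClear N d s b).flatten

theorem length_outputCircuit : (outputCircuit N d s b).length = 6 * qubits N := by
  simp only [outputCircuit, outputCopy, outputClear, List.length_append, List.length_flatten,
    List.map_map, Function.comp_def, cnot, toffoli, List.length_cons, List.length_nil,
    List.map_const', List.sum_replicate, Finset.length_toList, Finset.card_univ, Fintype.card_fin,
    smul_eq_mul]
  omega

/-- The content of the ancilla qubits at the end, which depends on the index in `ℂ^(d+1)` only. -/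
def garbage (N s b : ℕ) {d : ℕ} (q : Fin d ⊕ Unit) : Anc N d s b → Bool := fun v =>
  Sum.elim
    (fun a => regState true (fun _ => false) (Sum.elim (fun _ => false) (bits d a)) (fun _ => false)
      (fun _ => false) fun _ => false)
    (fun _ => regState false (fun _ => false) (fun _ => false) (fun _ => false) (fun _ => false)
      fun _ => false) q (Sum.inr v : Reg N d s b)

theorem garbage_injective (N s b d : ℕ) : Function.Injective (garbage N s b (d := d)) := by
  rintro (a | u) (a' | u') h
  · have : bits d a = bits d a' := funext fun i => congrFun h (.row (Sum.inr i))
    rw [bits_injective d this]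
  · exact absurd (congrFun h .flag) (by simp [garbage, regState])
  · exact absurd (congrFun h .flag) (by simp [garbage, regState])
  · rfl

theorem outputCopy_mulVec (F : Bool) (X : Fin (qubits N) → Bool) (R : RowPos N d → Bool)
    (CB : Fin s × SlotBit (RowPos N d) b → Bool) (RB : Fin s × SlotBit (Fin (qubits N)) b → Bool)
    (A : Fin (numLiterals N d + 1) → Bool) :
    circuitMatrix B (outputCopy N d s b).flatten *ᵥ ket (regState F X R CB RB A) =
      ket (regState F (fun p => xor (X p) (R (Sum.inl p))) R CB RB A) := by
  rw [outputCopy]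
  refine flatten_mulVec_ket_of_xorAt _ (Finset.nodup_toList _) _
    (fun p : Fin (qubits N) => (Sum.inl p : Reg N d s b)) (fun p q h => by simpa using h)
    (fun p f => f (Sum.inr (.row (Sum.inl p))) == true) (fun p => implements_cnot _ _ _ _)
    ?_ _ _ ?_ ?_
  · intro p q f y; simp
  · intro p _; simp [regState]
  · intro v hv
    rcases v with p | (_ | _ | _ | _ | _) <;> first | rfl | exact absurd rfl (hv p (by simp))

theorem outputClear_mulVec (F : Bool) (X : Fin (qubits N) → Bool) (R : RowPos N d → Bool)
    (CB : Fin s × SlotBit (RowPos N d) b → Bool) (RB : Fin s × SlotBit (Fin (qubits N)) b → Bool)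
    (A : Fin (numLiterals N d + 1) → Bool) :
    circuitMatrix B (outputClear N d s b).flatten *ᵥ ket (regState F X R CB RB A) =
      ket (regState F X (Sum.elim (fun p => xor (R (Sum.inl p)) (F && X p))
        (fun p => R (Sum.inr p))) CB RB A) := by
  rw [outputClear]
  refine flatten_mulVec_ket_of_xorAt _ (Finset.nodup_toList _) _
    (fun p : Fin (qubits N) => (Sum.inr (.row (Sum.inl p)) : Reg N d s b))
    (fun p q h => by simpa using h)
    (fun p f => f (Sum.inr .flag) == true && f (Sum.inl p) == true)
    (fun p => implements_toffoli _ _ _ _ _ _ _ _) ?_ _ _ ?_ ?_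
  · intro p q f y; simp
  · intro p _; simp [regState]
  · intro v hv
    rcases v with _ | (_ | (p | _) | _ | _ | _) <;> first | rfl | exact absurd rfl (hv p (by simp))

theorem outputCircuit_mulVec (p : Fin N × (Fin d ⊕ Unit)) :
    circuitMatrix B (outputCircuit N d s b) *ᵥ ket (basisState s b p) =
      ket (Sum.elim (bits N p.1) (garbage N s b p.2)) := by
  rw [outputCircuit, circuitMatrix_append, ← Matrix.mulVec_mulVec]
  obtain ⟨y, a | u⟩ := p
  · rw [basisState, Sum.elim_inl, outputCopy_mulVec, outputClear_mulVec]
    congr 1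
    ext v
    rcases v with v | (_ | (p | p) | _ | _ | _) <;> simp [regState, garbage, rowBits]
  · rw [basisState, Sum.elim_inr, outputCopy_mulVec, outputClear_mulVec]
    congr 1
    ext v
    rcases v with v | (_ | (p | p) | _ | _ | _) <;> simp [regState, garbage]

/-- The number of ancilla qubits. -/
abbrev numAnc (N d s b : ℕ) : ℕ := Fintype.card (Anc N d s b)

/-- The numbering of the qubits. -/
def wireEquiv (N d s b : ℕ) : Reg N d s b ≃ Wires N (numAnc N d s b) :=
  Equiv.sumCongr (Equiv.refl _) (Fintype.equivFin _)

/-- The isometry that maps `|x⟩|q⟩` to the encoding of `x` in the system register and the garbage of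
`q` in the ancilla qubits. -/
def outputMatrix (N d s b : ℕ) :
    Matrix ((Fin (qubits N) → Bool) × (Fin (numAnc N d s b) → Bool)) (Fin N × (Fin d ⊕ Unit)) ℂ :=
  Matrix.of fun z p => if z = (bits N p.1, garbage N s b p.2 ∘ (Fintype.equivFin _).symm)
    then 1 else 0

theorem outputMatrix_index_injective : Function.Injective fun p : Fin N × (Fin d ⊕ Unit) =>
    (bits N p.1, garbage N s b p.2 ∘ (Fintype.equivFin (Anc N d s b)).symm) := by
  rintro ⟨x, q⟩ ⟨y, q'⟩ h
  obtain ⟨h1, h2⟩ := Prod.ext_iff.1 h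
  have h3 : garbage N s b q = garbage N s b q' :=
    (Fintype.equivFin (Anc N d s b)).symm.surjective.injective_comp_right h2
  exact Prod.ext (bits_injective N h1) (garbage_injective N s b d h3)

theorem norm_outputMatrix_le : ‖outputMatrix N d s b‖ ≤ 1 := by
  refine norm_le_of_matching _ zero_le_one (fun p q q' h h' => ?_) (fun q p p' h h' => ?_)
    fun q p => ?_
  · simp only [outputMatrix, Matrix.of_apply, ne_eq, ite_eq_right_iff, one_ne_zero, imp_false,
      not_not] at h h'
    rw [h, h']
  · simp only [outputMatrix, Matrix.of_apply, ne_eq, ite_eq_right_iff, one_ne_zero, imp_false,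
      not_not] at h h'
    exact outputMatrix_index_injective (h.symm.trans h')
  · rw [outputMatrix, Matrix.of_apply]
    split_ifs <;> simp

/-- Discarding the garbage qubits instead of the ancilla `ℂ^(d+1)` makes no difference, because the
garbage determines the ancilla index and is determined by it. -/
theorem encoded_stinespring (W : Matrix (Fin N × (Fin d ⊕ Unit)) (Fin N) ℂ) :
    encoded (stinespring W) = stinespring (outputMatrix N d s b * W) := by
  refine LinearMap.ext fun ρ => ?_
  have h1 : stinespring (outputMatrix N d s b * W) ρ =
      traceAnc (outputMatrix N d s b * (W * ρ * Wᴴ) * (outputMatrix N d s b)ᴴ) := by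
    simp only [stinespring, sandwich, LinearMap.comp_apply, LinearMap.coe_mk, AddHom.coe_mk,
      Matrix.conjTranspose_mul, Matrix.mul_assoc]
  have h2 : encoded (stinespring W) ρ =
      encoding N * traceAnc (W * ρ * Wᴴ) * (encoding N)ᴴ := rfl
  rw [h1, h2]
  generalize W * ρ * Wᴴ = Y
  set e := Fintype.equivFin (Anc N d s b)
  have hg : Function.Injective fun q : Fin d ⊕ Unit => garbage N s b q ∘ e.symm := fun q q' h =>
    garbage_injective N s b d (e.symm.surjective.injective_comp_right h)
  have hL : ∀ u z p, outputMatrix N d s b (u, z) p =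
      if z = garbage N s b p.2 ∘ e.symm then encoding N u p.1 else 0 := fun u z p => by
    simp only [outputMatrix, encoding, Matrix.of_apply, Prod.mk.injEq, ite_and]
    split_ifs <;> rfl
  have hsplit : encoding N * traceAnc Y * (encoding N)ᴴ = ∑ q, encoding N *
      Y.submatrix (fun x => (x, q)) (fun x => (x, q)) * (encoding N)ᴴ := by
    rw [← Matrix.sum_mul, ← Matrix.mul_sum]
    congr 2
    ext x y
    simp [traceAnc, Matrix.sum_apply]
  rw [hsplit]
  ext u u'
  rw [Matrix.sum_apply]
  refine Fintype.sum_of_injective _ hg _ _ (fun z hz => ?_) fun q => ?_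
  · have : ∀ p, outputMatrix N d s b (u', z) p = 0 := fun p => by
      rw [hL, if_neg fun h => hz ⟨p.2, h.symm⟩]
    rw [Matrix.mul_apply]
    exact Finset.sum_eq_zero fun p _ => by
      rw [Matrix.conjTranspose_apply, this, star_zero, mul_zero]
  · have h3 : ∀ (v : Fin (qubits N) → Bool) (p : Fin N × (Fin d ⊕ Unit)),
        outputMatrix N d s b (v, garbage N s b q ∘ e.symm) p =
          if q = p.2 then encoding N v p.1 else 0 := fun v p => by
      rw [hL]
      congr 1
      exact propext hg.eq_iff
    rw [Matrix.mul_apply, Matrix.mul_apply, Fintype.sum_prod_type]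
    refine Finset.sum_congr rfl fun y _ => ?_
    rw [Finset.sum_eq_single q (fun q' _ hq' => by
      rw [Matrix.conjTranspose_apply, h3, if_neg (Ne.symm hq'), star_zero, mul_zero]) (by simp),
      Matrix.conjTranspose_apply, Matrix.conjTranspose_apply, h3, if_pos rfl]
    congr 1
    rw [Matrix.mul_apply, Matrix.mul_apply, Fintype.sum_prod_type]
    refine Finset.sum_congr rfl fun x _ => ?_
    rw [Finset.sum_eq_single q (fun q' _ hq' => by
      rw [h3, if_neg (Ne.symm hq'), zero_mul]) (by simp), h3, if_pos rfl]
    rfl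

/-- A circuit that acts as the matrix `A` on the registers implements the channel with Stinespring
matrix `A (· ⊗ |d⟩)`, once the output has been delivered. -/
theorem circuit_op_eq_stinespring (c : List (Gate (Reg N d s b) N d s b))
    {A : Matrix (Fin N × (Fin d ⊕ Unit)) (Fin N × (Fin d ⊕ Unit)) ℂ}
    (hc : circuitMatrix B c * basisMatrix N d s b = basisMatrix N d s b * A) :
    Circuit.op B ((c ++ outputCircuit N d s b).map (Gate.relabel (wireEquiv N d s b))) =
      stinespring (outputMatrix N d s b * (A * attachMatrix N d)) := by
  rw [Circuit.op, circuitMatrix_eq]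
  congr 1
  ext ⟨u, z⟩ x
  have h0 : (Sum.elim (bits N x) (fun _ => false) : Wires N (numAnc N d s b) → Bool) ∘
      wireEquiv N d s b = basisState (d := d) s b (x, Sum.inr ()) := by
    ext v
    rcases v with v | (_ | _ | _ | _ | _) <;> rfl
  have h1 : (Sum.elim u z : Wires N (numAnc N d s b) → Bool) ∘ wireEquiv N d s b =
      Sum.elim u (z ∘ Fintype.equivFin _) := by
    ext v
    rcases v with v | v <;> rfl
  have h2 : circuitMatrix B (outputCircuit N d s b) * basisMatrix N d s b =
      Matrix.of fun f p => if f = Sum.elim (bits N p.1) (garbage N s b p.2) then 1 else 0 := by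
    refine Matrix.ext_of_mulVec_single fun p => ?_
    rw [← Matrix.mulVec_mulVec, basisMatrix_mulVec, outputCircuit_mulVec]
    ext f
    rw [Matrix.mulVec_single_one, Matrix.col_apply, Matrix.of_apply, ket, Pi.single_apply]
  have h3 : (circuitMatrix B ((c ++ outputCircuit N d s b).map (Gate.relabel (wireEquiv N d s b))) *
      inputMatrix N (numAnc N d s b)) (Sum.elim u z) x =
      (circuitMatrix B (c ++ outputCircuit N d s b) * basisMatrix N d s b)
        (Sum.elim u (z ∘ Fintype.equivFin _)) (x, Sum.inr ()) := by
    rw [Matrix.mul_apply, Matrix.mul_apply,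
      Finset.sum_eq_single (Sum.elim (bits N x) fun _ => false)
      (fun f _ hf => by simp [inputMatrix, hf]) (by simp), circuitMatrix_relabel, h0, h1,
      Finset.sum_eq_single (basisState s b (x, Sum.inr ()))
      (fun f _ hf => by simp [basisMatrix, hf]) (by simp)]
    simp [inputMatrix, basisMatrix]
  refine h3.trans ?_
  rw [circuitMatrix_append, Matrix.mul_assoc, hc, ← Matrix.mul_assoc, h2, ← Matrix.mul_assoc,
    mul_attachMatrix_apply, Matrix.mul_apply, Matrix.mul_apply]
  refine Finset.sum_congr rfl fun p _ => ?_
  congr 1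
  rw [Matrix.of_apply, outputMatrix, Matrix.of_apply]
  congr 1
  apply propext
  rw [Prod.mk.injEq, Equiv.eq_comp_symm]
  constructor
  · exact fun h => ⟨congrArg (· ∘ Sum.inl) h, congrArg (· ∘ Sum.inr) h⟩
  · rintro ⟨rfl, h⟩
    rw [h]

end Output

/-! ### Product formulas -/

section ProductFormula

variable {ι κ : Type*} [Fintype ι] [DecidableEq ι]

theorem norm_list_sum_map_le {κ : Type*} (D : κ → Matrix ι ι ℂ) (ρ : κ → ℝ) (h : ∀ k, ‖D k‖ ≤ ρ k)
    (L : List κ) : ‖(L.map D).sum‖ ≤ (L.map ρ).sum := by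
  induction L with
  | nil => simp
  | cons k L ih =>
    rw [List.map_cons, List.map_cons, List.sum_cons, List.sum_cons]
    exact (norm_add_le _ _).trans (add_le_add (h k) ih)

theorem norm_list_prod_le_one (L : List (Matrix ι ι ℂ)) (h : ∀ A ∈ L, ‖A‖ ≤ 1) : ‖L.prod‖ ≤ 1 := by
  induction L with
  | nil => exact norm_one_le
  | cons A L ih =>
    rw [List.prod_cons]
    exact (Matrix.l2_opNorm_mul _ _).trans (mul_le_one₀ (h A List.mem_cons_self) (norm_nonneg _)
      (ih fun A' hA' => h A' (List.mem_cons_of_mem _ hA')))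

/-- A product of contractions close to the identity agrees to first order with the sum of their
first-order terms. -/
theorem norm_prod_sub_linear_le (A D : κ → Matrix ι ι ℂ) (ρ : κ → ℝ) (hρ : ∀ k, 0 ≤ ρ k)
    (hA : ∀ k, ‖A k‖ ≤ 1) (hA1 : ∀ k, ‖A k - 1‖ ≤ 2 * ρ k) (hD : ∀ k, ‖D k‖ ≤ ρ k)
    (hAD : ∀ k, ‖A k - 1 - D k‖ ≤ 4 * ρ k ^ 2) (L : List κ) :
    ‖(L.map A).reverse.prod - (1 + (L.map D).sum)‖ ≤ 4 * (L.map ρ).sum ^ 2 := by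
  induction L with
  | nil => simp
  | cons k L ih =>
    set P := (L.map A).reverse.prod
    set S := (L.map D).sum
    set σ := (L.map ρ).sum
    have hσ : 0 ≤ σ := List.sum_nonneg fun x hx => by
      obtain ⟨k, -, rfl⟩ := List.mem_map.1 hx
      exact hρ k
    have hS : ‖S‖ ≤ σ := norm_list_sum_map_le D ρ hD L
    have hsplit : ((k :: L).map A).reverse.prod - (1 + ((k :: L).map D).sum) =
        (P - (1 + S)) * A k + (A k - 1 - D k) + S * (A k - 1) := by
      rw [List.map_cons, List.reverse_cons, List.prod_append, List.prod_singleton, List.map_cons,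
        List.sum_cons]
      change P * A k - (1 + (D k + S)) = _
      noncomm_ring
    rw [hsplit, List.map_cons, List.sum_cons]
    change _ ≤ 4 * (ρ k + σ) ^ 2
    have h1 : ‖(P - (1 + S)) * A k‖ ≤ 4 * σ ^ 2 :=
      (Matrix.l2_opNorm_mul _ _).trans ((mul_le_mul ih (hA k) (norm_nonneg _)
        (by positivity)).trans_eq (mul_one _))
    have h2 : ‖S * (A k - 1)‖ ≤ σ * (2 * ρ k) :=
      (Matrix.l2_opNorm_mul _ _).trans (mul_le_mul hS (hA1 k) (norm_nonneg _) hσ)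
    calc _ ≤ 4 * σ ^ 2 + 4 * ρ k ^ 2 + σ * (2 * ρ k) :=
          (norm_add_le _ _).trans (add_le_add ((norm_add_le _ _).trans (add_le_add h1 (hAD k))) h2)
      _ ≤ 4 * (ρ k + σ) ^ 2 := by nlinarith [mul_nonneg hσ (hρ k)]

theorem norm_pow_le_one {A : Matrix ι ι ℂ} (hA : ‖A‖ ≤ 1) (n : ℕ) : ‖A ^ n‖ ≤ 1 := by
  have := norm_list_prod_le_one (List.replicate n A) fun B hB => by
    rwa [List.eq_of_mem_replicate hB]
  rwa [List.prod_replicate] at this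

theorem norm_pow_sub_pow_le {A E : Matrix ι ι ℂ} (hA : ‖A‖ ≤ 1) (hE : ‖E‖ ≤ 1) (n : ℕ) :
    ‖A ^ n - E ^ n‖ ≤ n * ‖A - E‖ := by
  induction n with
  | zero => simp
  | succ n ih =>
    have hsplit : A ^ (n + 1) - E ^ (n + 1) = (A ^ n - E ^ n) * A + E ^ n * (A - E) := by
      rw [pow_succ, pow_succ]; noncomm_ring
    rw [hsplit]
    calc _ ≤ ‖A ^ n - E ^ n‖ * ‖A‖ + ‖E ^ n‖ * ‖A - E‖ :=
          (norm_add_le _ _).trans (add_le_add (Matrix.l2_opNorm_mul _ _) (Matrix.l2_opNorm_mul _ _))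
      _ ≤ (n * ‖A - E‖) * 1 + 1 * ‖A - E‖ := by
          gcongr
          exact norm_pow_le_one hE n
      _ = _ := by push_cast; ring

theorem abs_cos_sub_one_le (x : ℝ) : |Real.cos x - 1| ≤ |x| := by
  have h1 := Real.one_sub_sq_div_two_le_cos (x := x)
  have h2 := Real.cos_le_one x
  have h3 := Real.neg_one_le_cos x
  rw [abs_of_nonpos (by linarith)]
  have h4 := sq_abs x
  rcases le_total |x| 2 with h | h <;> nlinarith [abs_nonneg x]

theorem abs_cos_sub_one_le_sq (x : ℝ) : |Real.cos x - 1| ≤ x ^ 2 := by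
  have h1 := Real.one_sub_sq_div_two_le_cos (x := x)
  have h2 := Real.cos_le_one x
  rw [abs_of_nonpos (by linarith)]
  nlinarith [sq_nonneg x]

theorem abs_sin_sub_self_le_sq (x : ℝ) : |Real.sin x - x| ≤ 3 * x ^ 2 := by
  have h := (Complex.abs_im_le_norm _).trans (norm_exp_sub_one_add_le x)
  have h1 : Complex.exp (-(Complex.I * x)) = Complex.exp (((-x : ℝ) : ℂ) * Complex.I) := by
    congr 1; push_cast; ring
  rw [h1, Complex.add_im, Complex.sub_im, Complex.exp_ofReal_mul_I_im, Real.sin_neg] at h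
  rw [abs_sub_comm]
  simpa [sub_eq_add_neg, add_comm] using h

variable {h : Matrix ι ι ℂ}

theorem norm_stepMatrix_le_one (hh : hᴴ = h) (h3 : h * h * h = h) (τ : ℝ) :
    ‖stepMatrix τ h‖ ≤ 1 := by
  refine norm_le_one_of_isometry _ ?_
  set c : ℂ := ((Real.cos τ - 1 : ℝ) : ℂ)
  set e : ℂ := Complex.I * Real.sin τ
  have h4 : h * h * (h * h) = h * h := by rw [← Matrix.mul_assoc, h3]
  have h5 : h * (h * h) = h := by rw [← Matrix.mul_assoc, h3]
  have hce : 2 * c + c * c - e * e = 0 := by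
    have h6 := Real.sin_sq_add_cos_sq τ
    have h7 : ((Real.sin τ : ℂ)) ^ 2 + (Real.cos τ : ℂ) ^ 2 = 1 := by exact_mod_cast h6
    simp only [c, e]
    push_cast at h7 ⊢
    linear_combination h7 - (Complex.sin τ) ^ 2 * Complex.I_mul_I
  have hadj : (stepMatrix τ h)ᴴ = 1 + c • (h * h) + e • h := by
    rw [stepMatrix, Matrix.conjTranspose_sub, Matrix.conjTranspose_add, Matrix.conjTranspose_one,
      Matrix.conjTranspose_smul, Matrix.conjTranspose_smul, Matrix.conjTranspose_mul, hh]
    have h8 : star c = c := Complex.conj_ofReal _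
    have h9 : star e = -e := by
      simp only [e, Complex.star_def, map_mul, Complex.conj_I, Complex.conj_ofReal, neg_mul]
    rw [h8, h9, neg_smul, sub_neg_eq_add]
  rw [hadj, stepMatrix]
  change (1 + c • (h * h) + e • h) * (1 + c • (h * h) - e • h) = 1
  have : (1 + c • (h * h) + e • h) * (1 + c • (h * h) - e • h) =
      1 + (2 * c + c * c - e * e) • (h * h) := by
    simp only [mul_sub, mul_add, add_mul, one_mul, mul_one, smul_mul_assoc, mul_smul_comm, h3, h4,
      h5]
    module
  rw [this, hce, zero_smul, add_zero]

theorem norm_stepMatrix_sub_one_le (hn : ‖h‖ ≤ 1) (τ : ℝ) : ‖stepMatrix τ h - 1‖ ≤ 2 * |τ| := by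
  have h1 : stepMatrix τ h - 1 =
      ((Real.cos τ - 1 : ℝ) : ℂ) • (h * h) - (Complex.I * Real.sin τ) • h := by
    rw [stepMatrix]; abel
  have h2 : ‖h * h‖ ≤ 1 := (Matrix.l2_opNorm_mul _ _).trans (mul_le_one₀ hn (norm_nonneg _) hn)
  rw [h1]
  refine (norm_sub_le _ _).trans ?_
  rw [norm_smul, norm_smul, norm_mul Complex.I, Complex.norm_I, one_mul, Complex.norm_real,
    Complex.norm_real,
    Real.norm_eq_abs, Real.norm_eq_abs]
  have h3 := abs_cos_sub_one_le τ
  have h4 : |Real.sin τ| ≤ |τ| := Real.abs_sin_le_abs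
  calc _ ≤ |τ| * 1 + |τ| * 1 := by gcongr
    _ = _ := by ring

theorem norm_stepMatrix_sub_linear_le (hn : ‖h‖ ≤ 1) (τ : ℝ) :
    ‖stepMatrix τ h - 1 - (-(Complex.I * τ)) • h‖ ≤ 4 * |τ| ^ 2 := by
  have h1 : stepMatrix τ h - 1 - (-(Complex.I * τ)) • h =
      ((Real.cos τ - 1 : ℝ) : ℂ) • (h * h) - (Complex.I * ((Real.sin τ - τ : ℝ) : ℂ)) • h := by
    rw [stepMatrix]
    push_cast
    module
  have h2 : ‖h * h‖ ≤ 1 := (Matrix.l2_opNorm_mul _ _).trans (mul_le_one₀ hn (norm_nonneg _) hn)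
  rw [h1]
  refine (norm_sub_le _ _).trans ?_
  rw [norm_smul, norm_smul, norm_mul Complex.I, Complex.norm_I, one_mul, Complex.norm_real,
    Complex.norm_real,
    Real.norm_eq_abs, Real.norm_eq_abs, sq_abs]
  have h3 := abs_cos_sub_one_le_sq τ
  have h4 := abs_sin_sub_self_le_sq τ
  calc _ ≤ τ ^ 2 * 1 + 3 * τ ^ 2 * 1 := by gcongr
    _ = _ := by ring

/-- The product formula: one round of steps with Hamiltonians `h k` and coefficients `c k`, each of
angle `τ * c k`, approximates the evolution under any Hamiltonian `H` close to `∑ k, c k • h k`. -/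
theorem norm_round_sub_exp_le (h : κ → Matrix ι ι ℂ) (c : κ → ℝ) (hh : ∀ k, (h k)ᴴ = h k)
    (h3 : ∀ k, h k * h k * h k = h k) (hn : ∀ k, ‖h k‖ ≤ 1) (L : List κ) {H : Matrix ι ι ℂ}
    (hH : H.IsHermitian) {η Λ : ℝ} (hΛ : (L.map fun k => |c k|).sum ≤ Λ)
    (hη : ‖H - (L.map fun k => (c k : ℂ) • h k).sum‖ ≤ η) {τ : ℝ} (hτ : 0 ≤ τ) :
    ‖(L.map fun k => stepMatrix (τ * c k) (h k)).reverse.prod -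
        NormedSpace.exp ((-(Complex.I * (τ : ℝ))) • H)‖ ≤ 7 * (τ * (Λ + η)) ^ 2 + τ * η := by
  set P := (L.map fun k => stepMatrix (τ * c k) (h k)).reverse.prod
  set S := (L.map fun k => (c k : ℂ) • h k).sum
  set E := NormedSpace.exp ((-(Complex.I * (τ : ℝ))) • H)
  have hη0 : 0 ≤ η := (norm_nonneg _).trans hη
  have hS : ‖S‖ ≤ Λ := by
    refine (norm_list_sum_map_le _ (fun k => |c k|) (fun k => ?_) L).trans hΛ
    rw [norm_smul, Complex.norm_real, Real.norm_eq_abs]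
    exact mul_le_of_le_one_right (abs_nonneg _) (hn k)
  have hΛ0 : 0 ≤ Λ := (norm_nonneg _).trans hS
  have hP : ‖P - (1 + (L.map fun k => (-(Complex.I * ((τ * c k : ℝ) : ℂ))) • h k).sum)‖ ≤
      4 * (L.map fun k => |τ * c k|).sum ^ 2 := by
    refine norm_prod_sub_linear_le (fun k => stepMatrix (τ * c k) (h k)) _ _
      (fun k => abs_nonneg _) (fun k => norm_stepMatrix_le_one (hh k) (h3 k) _)
      (fun k => norm_stepMatrix_sub_one_le (hn k) _) (fun k => ?_)
      (fun k => norm_stepMatrix_sub_linear_le (hn k) _) L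
    rw [norm_smul, norm_neg, norm_mul, Complex.norm_I, one_mul, Complex.norm_real, Real.norm_eq_abs]
    exact mul_le_of_le_one_right (abs_nonneg _) (hn k)
  have hsum : (L.map fun k => (-(Complex.I * ((τ * c k : ℝ) : ℂ))) • h k).sum =
      (-(Complex.I * (τ : ℂ))) • S := by
    rw [List.smul_sum, List.map_map]
    congr 1
    refine List.map_congr_left fun k _ => ?_
    rw [Function.comp_apply, smul_smul]
    push_cast
    congr 1
    ring
  have habs : (L.map fun k => |τ * c k|).sum ≤ τ * Λ := by
    simp only [abs_mul, abs_of_nonneg hτ]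
    rw [List.sum_map_mul_left]
    gcongr
  have habs0 : 0 ≤ (L.map fun k => |τ * c k|).sum := List.sum_nonneg fun x hx => by
    obtain ⟨k, -, rfl⟩ := List.mem_map.1 hx
    exact abs_nonneg _
  rw [hsum] at hP
  have hE := norm_exp_hermitian_sub_linear_le hH τ
  have hHn : ‖H‖ ≤ Λ + η := by
    calc ‖H‖ = ‖S + (H - S)‖ := by rw [add_sub_cancel]
      _ ≤ Λ + η := (norm_add_le _ _).trans (add_le_add hS hη)
  have hsplit : P - E = (P - (1 + (-(Complex.I * (τ : ℂ))) • S)) -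
      (E - (1 + (-(Complex.I * (τ : ℝ))) • H)) - (-(Complex.I * (τ : ℂ))) • (H - S) := by
    rw [smul_sub]; abel
  have hlast : ‖(-(Complex.I * (τ : ℂ))) • (H - S)‖ ≤ τ * η := by
    rw [norm_smul, norm_neg, norm_mul, Complex.norm_I, one_mul, Complex.norm_real, Real.norm_eq_abs,
      abs_of_nonneg hτ]
    gcongr
  rw [hsplit]
  calc _ ≤ 4 * (L.map fun k => |τ * c k|).sum ^ 2 + 3 * (τ * ‖H‖) ^ 2 + τ * η :=
        (norm_sub_le _ _).trans (add_le_add ((norm_sub_le _ _).trans (add_le_add hP hE)) hlast)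
    _ ≤ 4 * (τ * (Λ + η)) ^ 2 + 3 * (τ * (Λ + η)) ^ 2 + τ * η := by
        gcongr
        exact habs.trans (by gcongr; linarith)
    _ = _ := by ring

/-- The errors of the `n` rounds, each for time `π / (2 n)`, add up. -/
theorem norm_rounds_sub_exp_le (h : κ → Matrix ι ι ℂ) (c : κ → ℝ) (hh : ∀ k, (h k)ᴴ = h k)
    (h3 : ∀ k, h k * h k * h k = h k) (hn : ∀ k, ‖h k‖ ≤ 1) (L : List κ) {H : Matrix ι ι ℂ}
    (hH : H.IsHermitian) {η Λ : ℝ} (hΛ : (L.map fun k => |c k|).sum ≤ Λ)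
    (hη : ‖H - (L.map fun k => (c k : ℂ) • h k).sum‖ ≤ η) {n : ℕ} (hn0 : 0 < n) :
    ‖(L.map fun k => stepMatrix (Real.pi / 2 / n * c k) (h k)).reverse.prod ^ n -
        NormedSpace.exp ((-(Complex.I * (Real.pi / 2 : ℝ))) • H)‖ ≤
      28 * (Λ + η) ^ 2 / n + 2 * η := by
  set τ : ℝ := Real.pi / 2 / n
  have hn' : (0 : ℝ) < n := by exact_mod_cast hn0
  have hpi := Real.pi_pos
  have hτ : 0 ≤ τ := by positivity
  have hnτ : n * τ = Real.pi / 2 := by simp only [τ]; field_simp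
  have hexp : NormedSpace.exp ((-(Complex.I * (Real.pi / 2 : ℝ))) • H) =
      NormedSpace.exp ((-(Complex.I * (τ : ℝ))) • H) ^ n := by
    rw [← Matrix.exp_nsmul, ← Nat.cast_smul_eq_nsmul ℂ, smul_smul, ← hnτ]
    push_cast
    congr 2
    ring
  have hη0 : 0 ≤ η := (norm_nonneg _).trans hη
  rw [hexp]
  refine (norm_pow_sub_pow_le (norm_list_prod_le_one _ fun A hA => ?_)
    (norm_exp_hermitian_le_one hH τ) n).trans ?_
  · rw [List.mem_reverse, List.mem_map] at hA
    obtain ⟨k, -, rfl⟩ := hA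
    exact norm_stepMatrix_le_one (hh k) (h3 k) _
  · refine (mul_le_mul_of_nonneg_left (norm_round_sub_exp_le h c hh h3 hn L hH hΛ hη hτ)
      hn'.le).trans ?_
    have h4 : Real.pi / 2 ≤ 2 := by linarith [Real.pi_le_four]
    have h5 : n * (7 * (τ * (Λ + η)) ^ 2 + τ * η) =
        7 * (n * τ) ^ 2 * (Λ + η) ^ 2 / n + (n * τ) * η := by field_simp
    rw [h5, hnτ]
    have h6 : (Real.pi / 2) ^ 2 ≤ 2 ^ 2 := by gcongr
    gcongr
    linarith

end ProductFormula

/-! ### Decomposition into matchings -/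

section Decomposition

variable {N d s b : ℕ} {V : Matrix (Fin N × Fin d) (Fin N) ℂ} (B : BlackBox V s)

theorem norm_blockHamiltonian_le_of_matching (M : Matrix (Fin N × Fin d) (Fin N) ℂ) {c : ℝ}
    (hc : 0 ≤ c) (hrow : ∀ x r r', M r x ≠ 0 → M r' x ≠ 0 → r = r')
    (hcol : ∀ r x x', M r x ≠ 0 → M r x' ≠ 0 → x = x') (hM : ∀ r x, ‖M r x‖ ≤ c) :
    ‖blockHamiltonian M‖ ≤ c := by
  have hH := blockHamiltonian_isHermitian M
  have key : ∀ p q q', blockHamiltonian M q p ≠ 0 → blockHamiltonian M q' p ≠ 0 → q = q' := by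
    rintro ⟨x, a | u⟩ ⟨y, a' | u'⟩ ⟨y', a'' | u''⟩ h h'
    all_goals try (simp at h; done)
    all_goals try (simp at h'; done)
    · rw [blockHamiltonian_inr_inl, star_ne_zero] at h h'
      rw [hcol _ _ _ h h']
    · rw [blockHamiltonian_inl_inr] at h h'
      obtain ⟨h1, h2⟩ := Prod.ext_iff.1 (hrow _ _ _ h h')
      simp only at h1 h2
      rw [h1, h2]
  refine norm_le_of_matching _ hc key (fun q p p' h h' => ?_) ?_
  · refine key q p p' ?_ ?_
    · rwa [← hH.apply, star_ne_zero]
    · rwa [← hH.apply, star_ne_zero]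
  · rintro ⟨x, a | u⟩ ⟨y, a' | u'⟩
    · simpa using hc
    · exact hM _ _
    · rw [blockHamiltonian_inr_inl, norm_star]; exact hM _ _
    · simpa using hc

open Classical in
/-- The matrix with entries `g (V r x)` at the positions that stand in slot `i` of their column and
slot `j` of their row. -/
def slotMatrix (i j : Fin s) (g : ℂ → ℂ) : Matrix (Fin N × Fin d) (Fin N) ℂ :=
  Matrix.of fun r x => if B.col x i = some r ∧ B.row r j = some x then g (V r x) else 0

theorem matchMatrix_eq_slotMatrix (i j : Fin s) (comp : Bool) (t : ℕ) (w : ℂ) :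
    matchMatrix B b i j comp t w =
      slotMatrix B i j fun z => if fixedPointBit b (part comp z) t then w else 0 := by
  ext r x
  simp only [matchMatrix, slotMatrix, Matrix.of_apply, Matched, ← ite_and, and_assoc]
  congr

/-- Every nonzero entry stands in exactly one slot of its column and one slot of its row. -/
theorem sum_slotMatrix (g : ℂ → ℂ) (hg : g 0 = 0) :
    ∑ i, ∑ j, slotMatrix B i j g = Matrix.of fun r x => g (V r x) := by
  ext r x
  simp only [Matrix.sum_apply, slotMatrix, Matrix.of_apply]
  by_cases h : V r x = 0
  · rw [h, hg]
    simp
  · obtain ⟨i, hi⟩ := (B.col_spec x r).1 h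
    obtain ⟨j, hj⟩ := (B.row_spec r x).1 h
    rw [Finset.sum_eq_single i, Finset.sum_eq_single j]
    · rw [if_pos ⟨hi, hj⟩]
    · exact fun j' _ hj' => if_neg fun h' => hj' (B.row_inj r _ _ x h'.2 hj)
    · simp
    · exact fun i' _ hi' => Finset.sum_eq_zero fun j' _ => if_neg fun h' =>
        hi' (B.col_inj x _ _ r h'.1 hi)
    · simp

/-- Once both slots are fixed, no row and no column has more than one entry. -/
theorem norm_slotMatrix_le (i j : Fin s) (g : ℂ → ℂ) {c : ℝ} (hc : 0 ≤ c)
    (hg : ∀ r x, ‖g (V r x)‖ ≤ c) : ‖blockHamiltonian (slotMatrix B i j g)‖ ≤ c := by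
  have h0 : ∀ r x, slotMatrix B i j g r x ≠ 0 → B.col x i = some r ∧ B.row r j = some x :=
    fun r x h => by
      by_contra h'
      exact h (by rw [slotMatrix, Matrix.of_apply, if_neg h'])
  refine norm_blockHamiltonian_le_of_matching _ hc (fun x r r' h h' => ?_) (fun r x x' h h' => ?_)
    fun r x => ?_
  · exact Option.some_injective _ ((h0 _ _ h).1.symm.trans (h0 _ _ h').1)
  · exact Option.some_injective _ ((h0 _ _ h).2.symm.trans (h0 _ _ h').2)
  · rw [slotMatrix, Matrix.of_apply]
    split_ifs
    · exact hg r x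
    · simpa using hc

theorem norm_matchHamiltonian_le (i j : Fin s) (comp : Bool) (t : ℕ) {w : ℂ} (hw : ‖w‖ ≤ 1) :
    ‖blockHamiltonian (matchMatrix B b i j comp t w)‖ ≤ 1 := by
  rw [matchMatrix_eq_slotMatrix]
  refine norm_slotMatrix_le B i j _ zero_le_one fun r x => ?_
  split_ifs
  · exact hw
  · simp

/-- The Hamiltonian of a matching swaps matched basis states up to conjugate phases and annihilates
all others, so its square is a projection. -/
theorem matchHamiltonian_cube (i j : Fin s) (comp : Bool) (t : ℕ) {w : ℂ} (hw : w * star w = 1) :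
    blockHamiltonian (matchMatrix B b i j comp t w) *
      blockHamiltonian (matchMatrix B b i j comp t w) *
        blockHamiltonian (matchMatrix B b i j comp t w) =
        blockHamiltonian (matchMatrix B b i j comp t w) := by
  refine Matrix.ext_of_mulVec_single fun p => ?_
  rw [← Matrix.mulVec_mulVec, ← Matrix.mulVec_mulVec]
  have hw' : star w * w = 1 := by rw [mul_comm, hw]
  obtain ⟨y, a | u⟩ := p
  · by_cases h : ∃ x, Matched B b i j comp t (y, a) x
    · obtain ⟨x, hm⟩ := h
      have h1 := matchHamiltonian_mulVec_row B w hm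
      have h2 := matchHamiltonian_mulVec_col B w hm
      simp only at h1 h2
      rw [h1, Matrix.mulVec_smul, h2, smul_smul, hw', one_smul, h1]
    · rw [matchHamiltonian_mulVec_row_eq_zero w h, Matrix.mulVec_zero, Matrix.mulVec_zero]
  · by_cases h : ∃ r, Matched B b i j comp t r y
    · obtain ⟨r, hm⟩ := h
      have h1 := matchHamiltonian_mulVec_row B w hm
      have h2 := matchHamiltonian_mulVec_col B w hm
      rw [h2, Matrix.mulVec_smul, h1, smul_smul, hw, one_smul, h2]
    · rw [matchHamiltonian_mulVec_col_eq_zero w h, Matrix.mulVec_zero, Matrix.mulVec_zero]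

theorem blockHamiltonian_add (M M' : Matrix (Fin N × Fin d) (Fin N) ℂ) :
    blockHamiltonian (M + M') = blockHamiltonian M + blockHamiltonian M' := by
  ext ⟨y, a | u⟩ ⟨x, a' | u'⟩ <;> simp

theorem blockHamiltonian_smul (c : ℝ) (M : Matrix (Fin N × Fin d) (Fin N) ℂ) :
    blockHamiltonian ((c : ℂ) • M) = (c : ℂ) • blockHamiltonian M := by
  ext ⟨y, a | u⟩ ⟨x, a' | u'⟩ <;> simp

theorem blockHamiltonian_sum {κ : Type*} (T : Finset κ)
    (M : κ → Matrix (Fin N × Fin d) (Fin N) ℂ) :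
    blockHamiltonian (∑ k ∈ T, M k) = ∑ k ∈ T, blockHamiltonian (M k) := by
  classical
  induction T using Finset.induction_on with
  | empty =>
    ext ⟨y, a | u⟩ ⟨x, a' | u'⟩ <;> simp
  | insert k T hk ih => rw [Finset.sum_insert hk, Finset.sum_insert hk, blockHamiltonian_add, ih]

/-! ### Fixed-point numbers -/

/-- Binary expansion with floor division, valid for negative integers as well. -/
theorem sum_bits_add_quotient (z : ℤ) (m : ℕ) :
    (∑ t ∈ Finset.range m, if Odd (z / 2 ^ t) then (2 : ℤ) ^ t else 0) +
      2 ^ m * (z / 2 ^ m) = z := by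
  induction m with
  | zero => simp
  | succ m ih =>
    rw [Finset.sum_range_succ, pow_succ, ← Int.ediv_ediv_of_nonneg (by positivity)]
    conv_rhs => rw [← ih]
    generalize z / 2 ^ m = q
    split_ifs with h
    · obtain ⟨k, rfl⟩ := h
      have : (2 * k + 1) / 2 = k := by omega
      rw [this]; ring
    · rw [Int.not_odd_iff_even] at h
      obtain ⟨k, rfl⟩ := h
      have : (k + k) / 2 = k := by omega
      rw [this]; ring

/-- The place value of bit `t` of a number in two's complement with `b` fractional bits and `2 * b`
bits altogether. -/
def placeValue (b t : ℕ) : ℝ := if t + 1 = 2 * b then -(2 ^ t / 2 ^ b) else 2 ^ t / 2 ^ b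

theorem sum_abs_placeValue_le (b : ℕ) : ∑ t : Fin (2 * b), |placeValue b t| ≤ 2 ^ b := by
  have h : ∀ t : ℕ, |placeValue b t| = 2 ^ t / 2 ^ b := fun t => by
    rw [placeValue]
    split_ifs
    · rw [abs_neg, abs_of_pos (by positivity)]
    · rw [abs_of_pos (by positivity)]
  simp only [h]
  rw [Fin.sum_univ_eq_sum_range (fun t => (2 : ℝ) ^ t / 2 ^ b), ← Finset.sum_div,
    geom_sum_eq (by norm_num), div_le_iff₀ (by positivity), ← pow_add, ← two_mul]
  norm_num

/-- The digits of a number that fits in the format represent it, rounded down. -/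
theorem sum_placeValue_mul_bit {b : ℕ} (hb : 0 < b) {x : ℝ} (hx : |x| < 2 ^ (b - 1)) :
    ∑ t : Fin (2 * b), (if fixedPointBit b x t then placeValue b t else 0) =
      ⌊(2 : ℝ) ^ b * x⌋ / 2 ^ b := by
  obtain ⟨m, rfl⟩ : ∃ m, b = m + 1 := ⟨b - 1, by omega⟩
  rw [Nat.add_sub_cancel] at hx
  set z := ⌊(2 : ℝ) ^ (m + 1) * x⌋ with hz
  set p : ℤ := 2 ^ (2 * m + 1) with hp
  have hpp : 0 < p := by positivity
  obtain ⟨hx1, hx2⟩ := abs_lt.1 hx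
  have hpow : ((p : ℤ) : ℝ) = 2 ^ (m + 1) * 2 ^ m := by
    rw [hp]; push_cast; rw [← pow_add]; congr 1; omega
  have h1 : -p ≤ z := by
    rw [hz, Int.le_floor]
    push_cast
    rw [hpow, ← mul_neg]
    gcongr
  have h2 : z < p := by
    rw [hz, Int.floor_lt, hpow]
    gcongr
  -- The sign bit is the quotient by its place value, which is `0` or `-1`.
  have h3 : (if Odd (z / p) then -p else 0) = p * (z / p) := by
    rcases lt_or_ge z 0 with h | h
    · have : z / p = -1 := by
        rw [Int.ediv_eq_iff_of_pos hpp]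
        constructor <;> linarith
      rw [this, if_pos (by decide)]; ring
    · rw [Int.ediv_eq_zero_of_lt h h2]; simp
  have h4 := sum_bits_add_quotient z (2 * m + 1)
  rw [← h3] at h4
  have hbit : ∀ t, (fixedPointBit (m + 1) x t = true) = Odd (z / 2 ^ t) := fun t => by
    rw [fixedPointBit, decide_eq_true_eq]
  simp only [hbit]
  rw [Fin.sum_univ_eq_sum_range (fun t => if Odd (z / 2 ^ t) then placeValue (m + 1) t else 0),
    show 2 * (m + 1) = (2 * m + 1) + 1 by ring, Finset.sum_range_succ, eq_div_iff (by positivity),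
    add_mul, Finset.sum_mul]
  conv_rhs => rw [← h4]
  push_cast
  congr 1
  · refine Finset.sum_congr rfl fun t ht => ?_
    have : t + 1 ≠ 2 * (m + 1) := by
      have := Finset.mem_range.1 ht
      omega
    rw [placeValue, if_neg this]
    split_ifs
    · field_simp
    · simp
  · have hsign : placeValue (m + 1) (2 * m + 1) = -(2 ^ (2 * m + 1) / 2 ^ (m + 1)) := by
      rw [placeValue, if_pos (by ring)]
    rw [hsign]
    by_cases h : Odd (z / p)
    · rw [if_pos h, if_pos h, hp]
      push_cast
      field_simp
    · rw [if_neg h, if_neg h]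
      simp

/-- The complex number represented by the fixed-point digits of the real and imaginary part of
`z`, both rounded down. -/
def fixedPoint (b : ℕ) (z : ℂ) : ℂ :=
  ((⌊(2 : ℝ) ^ b * z.re⌋ / 2 ^ b : ℝ) : ℂ) + Complex.I * ((⌊(2 : ℝ) ^ b * z.im⌋ / 2 ^ b : ℝ) : ℂ)

theorem abs_sub_floor_div_le (b : ℕ) (x : ℝ) : |x - ⌊(2 : ℝ) ^ b * x⌋ / 2 ^ b| ≤ 1 / 2 ^ b := by
  have h1 := Int.floor_le ((2 : ℝ) ^ b * x)
  have h2 := Int.lt_floor_add_one ((2 : ℝ) ^ b * x)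
  have h3 : x - ⌊(2 : ℝ) ^ b * x⌋ / 2 ^ b = (2 ^ b * x - ⌊(2 : ℝ) ^ b * x⌋) / 2 ^ b := by field_simp
  rw [h3, abs_of_nonneg (div_nonneg (by linarith) (by positivity))]
  gcongr
  linarith

theorem norm_sub_fixedPoint_le (b : ℕ) (z : ℂ) : ‖z - fixedPoint b z‖ ≤ 2 / 2 ^ b := by
  have h : z - fixedPoint b z = ((z.re - ⌊(2 : ℝ) ^ b * z.re⌋ / 2 ^ b : ℝ) : ℂ) +
      Complex.I * ((z.im - ⌊(2 : ℝ) ^ b * z.im⌋ / 2 ^ b : ℝ) : ℂ) := by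
    apply Complex.ext <;> simp [fixedPoint, -Complex.ofReal_div]
  rw [h]
  refine (norm_add_le _ _).trans ?_
  rw [norm_mul, Complex.norm_I, one_mul, Complex.norm_real, Complex.norm_real, Real.norm_eq_abs,
    Real.norm_eq_abs]
  refine (add_le_add (abs_sub_floor_div_le b _) (abs_sub_floor_div_le b _)).trans_eq ?_
  ring

/-! ### The terms of the Hamiltonian -/

/-- The labels of the terms: slots `i`, `j`, real or imaginary part, and number of the bit. -/
abbrev Term (s b : ℕ) : Type := Fin s × Fin s × Bool × Fin (2 * b)

/-- The phase `1` or `i` of the real or imaginary part. -/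
def phase (comp : Bool) : ℂ := if comp then Complex.I else 1

theorem phase_mul_star (comp : Bool) : phase comp * star (phase comp) = 1 := by
  cases comp <;> simp [phase]

/-- The Hamiltonian of a term. -/
def termHamiltonian (k : Term s b) : Matrix (Fin N × (Fin d ⊕ Unit)) (Fin N × (Fin d ⊕ Unit)) ℂ :=
  blockHamiltonian (matchMatrix B b k.1 k.2.1 k.2.2.1 k.2.2.2 (phase k.2.2.1))

/-- The coefficient of a term: the place value of its bit. -/
def termCoeff (k : Term s b) : ℝ := placeValue b k.2.2.2

theorem sum_abs_termCoeff_le : ∑ k : Term s b, |termCoeff k| ≤ 2 * s ^ 2 * 2 ^ b := by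
  simp only [termCoeff, Fintype.sum_prod_type, Finset.sum_const, Finset.card_univ, Fintype.card_fin,
    Fintype.card_bool, nsmul_eq_mul]
  have h := sum_abs_placeValue_le b
  calc (s : ℝ) * (s * ((2 : ℕ) * ∑ t : Fin (2 * b), |placeValue b t|))
      ≤ s * (s * ((2 : ℕ) * 2 ^ b)) := by gcongr
    _ = _ := by push_cast; ring

theorem sum_terms_slot (hb : 0 < b) (hV : ∀ r x, ‖V r x‖ < 2 ^ (b - 1)) (i j : Fin s) :
    ∑ comp, ∑ t : Fin (2 * b), (placeValue b t : ℂ) • matchMatrix B b i j comp t (phase comp) =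
      slotMatrix B i j (fixedPoint b) := by
  ext r x
  simp only [Matrix.sum_apply, Matrix.smul_apply, matchMatrix_eq_slotMatrix, slotMatrix,
    Matrix.of_apply]
  split_ifs with h
  · have key : ∀ comp, ∑ t : Fin (2 * b), (placeValue b t : ℂ) •
        (if fixedPointBit b (part comp (V r x)) t = true then phase comp else 0) =
        phase comp * ((⌊(2 : ℝ) ^ b * part comp (V r x)⌋ / 2 ^ b : ℝ) : ℂ) := fun comp => by
      have hx : |part comp (V r x)| < 2 ^ (b - 1) := by
        refine lt_of_le_of_lt ?_ (hV r x)
        cases comp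
        · exact Complex.abs_re_le_norm _
        · exact Complex.abs_im_le_norm _
      rw [← sum_placeValue_mul_bit hb hx, Complex.ofReal_sum, Finset.mul_sum]
      refine Finset.sum_congr rfl fun t _ => ?_
      split_ifs
      · rw [smul_eq_mul, mul_comm]
      · simp
    rw [Fintype.sum_bool, key, key, fixedPoint, add_comm]
    simp only [phase, part]
    simp
  · simp

/-- The terms add up to the Hamiltonian up to the rounding of the entries. -/
theorem norm_blockHamiltonian_sub_sum_terms_le (hb : 0 < b) (hV : ∀ r x, ‖V r x‖ < 2 ^ (b - 1)) :
    ‖blockHamiltonian V - ∑ k : Term s b, (termCoeff k : ℂ) • termHamiltonian B k‖ ≤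
      2 * s ^ 2 / 2 ^ b := by
  have h1 : ∑ k : Term s b, (termCoeff k : ℂ) • termHamiltonian B k =
      ∑ i, ∑ j, blockHamiltonian (slotMatrix B i j (fixedPoint b)) := by
    simp only [Fintype.sum_prod_type, ← sum_terms_slot B hb hV, blockHamiltonian_sum,
      blockHamiltonian_smul, termCoeff, termHamiltonian]
  have h2 : blockHamiltonian V = ∑ i, ∑ j, blockHamiltonian (slotMatrix B i j id) := by
    simp only [← blockHamiltonian_sum, sum_slotMatrix B id rfl]
    rfl
  have h3 : ∀ i j, blockHamiltonian (slotMatrix B i j id) -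
      blockHamiltonian (slotMatrix B i j (fixedPoint b)) =
        blockHamiltonian (slotMatrix B i j fun z => z - fixedPoint b z) := fun i j => by
    rw [sub_eq_iff_eq_add, ← blockHamiltonian_add]
    congr 1
    ext r x
    simp only [slotMatrix, Matrix.add_apply, Matrix.of_apply]
    split_ifs <;> simp
  rw [h1, h2, ← Finset.sum_sub_distrib]
  simp only [← Finset.sum_sub_distrib, h3]
  calc _ ≤ ∑ i : Fin s, ∑ j : Fin s, (2 / 2 ^ b : ℝ) := by
        refine (norm_sum_le _ _).trans (Finset.sum_le_sum fun i _ => ?_)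
        refine (norm_sum_le _ _).trans (Finset.sum_le_sum fun j _ => ?_)
        exact norm_slotMatrix_le B i j _ (by positivity) fun r x => norm_sub_fixedPoint_le b _
    _ = _ := by simp; ring

end Decomposition

/-! ### The simulation circuit -/

section Simulation

variable {N d s b : ℕ} {V : Matrix (Fin N × Fin d) (Fin N) ℂ} (B : BlackBox V s)

theorem circuitMatrix_flatten_mul {W : Type} {P κ : Type*} [Fintype W] [DecidableEq W] [Fintype P]
    [DecidableEq P] (C : κ → List (Gate W N d s b)) (A : κ → Matrix P P ℂ)
    (J : Matrix (W → Bool) P ℂ) (h : ∀ k, circuitMatrix B (C k) * J = J * A k) (L : List κ) :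
    circuitMatrix B (L.map C).flatten * J = J * (L.map A).reverse.prod := by
  induction L with
  | nil => simp [circuitMatrix]
  | cons k L ih =>
    rw [List.map_cons, List.flatten_cons, circuitMatrix_append, Matrix.mul_assoc, h,
      ← Matrix.mul_assoc, ih, List.map_cons, List.reverse_cons, List.prod_append,
      List.prod_singleton, Matrix.mul_assoc]

/-- One round of the product formula: a step of angle `τ * termCoeff k` for every term `k`. -/
def roundCircuit (N d s b : ℕ) (τ : ℝ) : List (Gate (Reg N d s b) N d s b) :=
  ((Finset.univ : Finset (Term s b)).toList.map fun k =>
    stepCircuit k.1 k.2.1 k.2.2.1 k.2.2.2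
      (rotation (τ * termCoeff k) (phase k.2.2.1) (phase_mul_star _))).flatten

/-- The evolution for time `π / 2` in `n` rounds. -/
def evolutionCircuit (N d s b n : ℕ) : List (Gate (Reg N d s b) N d s b) :=
  (List.replicate n (roundCircuit N d s b (Real.pi / 2 / n))).flatten

theorem length_evolutionCircuit_le (n : ℕ) : (evolutionCircuit N d s b n).length ≤
    n * (s * (s * (2 * (2 * b))) * (101 + 60 * qubits N + 30 * qubits d)) := by
  rw [evolutionCircuit, List.length_flatten, List.map_replicate, List.sum_replicate, smul_eq_mul]
  gcongr
  rw [roundCircuit, List.length_flatten, List.map_map]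
  refine (List.sum_le_card_nsmul _ (101 + 60 * qubits N + 30 * qubits d) fun l hl => ?_).trans
    (le_of_eq ?_)
  · obtain ⟨k, -, rfl⟩ := List.mem_map.1 hl
    exact length_stepCircuit _ _ _ _ _
  · simp

/-- The matrix of one round on the encoded states. -/
def roundMatrix (n : ℕ) : Matrix (Fin N × (Fin d ⊕ Unit)) (Fin N × (Fin d ⊕ Unit)) ℂ :=
  ((Finset.univ : Finset (Term s b)).toList.map fun k =>
    stepMatrix (Real.pi / 2 / n * termCoeff k) (termHamiltonian B k)).reverse.prod

theorem evolutionCircuit_mul_basisMatrix (n : ℕ) :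
    circuitMatrix B (evolutionCircuit N d s b n) * basisMatrix N d s b =
      basisMatrix N d s b * roundMatrix (b := b) B n ^ n := by
  have h1 : circuitMatrix B (roundCircuit N d s b (Real.pi / 2 / n)) * basisMatrix N d s b =
      basisMatrix N d s b * roundMatrix (b := b) B n :=
    circuitMatrix_flatten_mul B _ _ _ (fun k => stepCircuit_mul_basisMatrix _ _ _ _ _ _ _) _
  have h2 := circuitMatrix_flatten_mul B (fun _ : Unit => roundCircuit N d s b (Real.pi / 2 / n))
    (fun _ => roundMatrix (b := b) B n) _ (fun _ => h1) (List.replicate n ())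
  simpa [evolutionCircuit] using h2

theorem termHamiltonian_isHermitian (k : Term s b) : (termHamiltonian B k).IsHermitian :=
  blockHamiltonian_isHermitian _

theorem termHamiltonian_cube (k : Term s b) :
    termHamiltonian B k * termHamiltonian B k * termHamiltonian B k = termHamiltonian B k :=
  matchHamiltonian_cube B _ _ _ _ (phase_mul_star _)

theorem norm_termHamiltonian_le_one (k : Term s b) : ‖termHamiltonian B k‖ ≤ 1 :=
  norm_matchHamiltonian_le B _ _ _ _ (by cases k.2.2.1 <;> simp [phase])

theorem norm_roundMatrix_pow_sub_exp_le (hb : 0 < b) (hV : ∀ r x, ‖V r x‖ < 2 ^ (b - 1)) {n : ℕ}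
    (hn : 0 < n) :
    ‖roundMatrix (b := b) B n ^ n -
        NormedSpace.exp ((-(Complex.I * (Real.pi / 2 : ℝ))) • blockHamiltonian V)‖ ≤
      28 * (2 * s ^ 2 * 2 ^ b + 2 * s ^ 2 / 2 ^ b) ^ 2 / n + 2 * (2 * s ^ 2 / 2 ^ b) := by
  refine norm_rounds_sub_exp_le _ _ (fun k => termHamiltonian_isHermitian B k)
    (termHamiltonian_cube B) (norm_termHamiltonian_le_one B) _ (blockHamiltonian_isHermitian V)
    ?_ ?_ hn
  · rw [Finset.sum_map_toList]
    exact sum_abs_termCoeff_le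
  · rw [Finset.sum_map_toList]
    exact norm_blockHamiltonian_sub_sum_terms_le B hb hV

theorem norm_roundMatrix_pow_le_one (n : ℕ) : ‖roundMatrix (b := b) B n ^ n‖ ≤ 1 := by
  refine norm_pow_le_one (norm_list_prod_le_one _ fun A hA => ?_) n
  rw [List.mem_reverse, List.mem_map] at hA
  obtain ⟨k, -, rfl⟩ := hA
  exact norm_stepMatrix_le_one (termHamiltonian_isHermitian B k) (termHamiltonian_cube B k) _

/-- The circuit that simulates the evolution in `n` rounds and delivers the output, on the qubits of
a `Circuit`. -/
def simulationCircuit (N d s b n : ℕ) : Circuit N d s b (numAnc N d s b) :=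
  (evolutionCircuit N d s b n ++ outputCircuit N d s b).map (Gate.relabel (wireEquiv N d s b))

theorem diamondNorm_simulationCircuit_sub_le (hb : 0 < b) (hV : ∀ r x, ‖V r x‖ < 2 ^ (b - 1))
    {n : ℕ} (hn : 0 < n) :
    diamondNorm (Circuit.op B (simulationCircuit N d s b n) - encoded (evolutionOp V)) ≤
      ENNReal.ofReal (2 * (28 * (2 * s ^ 2 * 2 ^ b + 2 * s ^ 2 / 2 ^ b) ^ 2 / n +
        2 * (2 * s ^ 2 / 2 ^ b))) := by
  set E := NormedSpace.exp ((-(Complex.I * (Real.pi / 2 : ℝ))) • blockHamiltonian V)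
  set P := roundMatrix (b := b) B n ^ n
  have hO := norm_outputMatrix_le (N := N) (d := d) (s := s) (b := b)
  have hA := norm_attachMatrix_le (N := N) (d := d)
  have hE : ‖E‖ ≤ 1 := norm_exp_hermitian_le_one (blockHamiltonian_isHermitian V) _
  have hP : ‖P‖ ≤ 1 := norm_roundMatrix_pow_le_one B n
  have hmul : ∀ X : Matrix (Fin N × (Fin d ⊕ Unit)) (Fin N × (Fin d ⊕ Unit)) ℂ,
      ‖outputMatrix N d s b * (X * attachMatrix N d)‖ ≤ ‖X‖ := fun X => by
    calc _ ≤ ‖outputMatrix N d s b‖ * (‖X‖ * ‖attachMatrix N d‖) :=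
          (Matrix.l2_opNorm_mul _ _).trans
            (mul_le_mul_of_nonneg_left (Matrix.l2_opNorm_mul _ _) (norm_nonneg _))
      _ ≤ 1 * (‖X‖ * 1) := by gcongr
      _ = ‖X‖ := by ring
  rw [simulationCircuit,
    circuit_op_eq_stinespring _ (evolutionCircuit_mul_basisMatrix B n),
    evolutionOp_eq_stinespring, encoded_stinespring (s := s) (b := b)]
  refine (diamondNorm_stinespring_sub_le _ _).trans (ENNReal.ofReal_le_ofReal ?_)
  rw [← Matrix.mul_sub, ← Matrix.sub_mul]
  calc _ ≤ ‖P - E‖ * (1 + 1) := by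
        gcongr
        · exact hmul _
        · exact (hmul _).trans hP
        · exact (hmul _).trans hE
    _ = 2 * ‖P - E‖ := by ring
    _ ≤ _ := by
        gcongr
        exact norm_roundMatrix_pow_sub_exp_le B hb hV hn

end Simulation

/-! ### Choice of the parameters -/

section Parameters

/-- The number of fractional bits for sparsity `s` and the errors `ε` and `δ`: enough to hold the
entries of `V` and to make the rounding error of the Hamiltonian at most `δ / 8`. -/
def precision (s : ℕ) (ε δ : ℝ) : ℕ := Nat.clog 2 ⌈16 * s ^ 2 * δ⁻¹ + 2 * ε + 4⌉₊ + 1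

/-- The number of rounds: `28 * (Λ + η) ^ 2 / n ≤ δ / 4` holds for it, where `Λ + η ≤ 4 s ^ 2 2 ^ b`
bounds the sum of the coefficients and the rounding error of the Hamiltonian. -/
def rounds (s b : ℕ) (δ : ℝ) : ℕ := ⌈1792 * s ^ 4 * (2 ^ b) ^ 2 * δ⁻¹⌉₊ + 1

variable {s : ℕ} {ε δ : ℝ}

theorem le_two_pow_precision : 16 * s ^ 2 * δ⁻¹ + 2 * ε + 4 ≤ (2 : ℝ) ^ (precision s ε δ - 1) := by
  refine (Nat.le_ceil _).trans ?_
  rw [precision, Nat.add_sub_cancel]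
  exact_mod_cast Nat.le_pow_clog (by norm_num) _

theorem two_pow_precision_le (hε : 0 ≤ ε) (hδ : 0 < δ) :
    (2 : ℝ) ^ precision s ε δ ≤ 4 * (16 * s ^ 2 * δ⁻¹ + 2 * ε + 5) := by
  set y : ℝ := 16 * s ^ 2 * δ⁻¹ + 2 * ε + 4 with hy
  have hy0 : 4 ≤ y := by
    have : 0 ≤ 16 * (s : ℝ) ^ 2 * δ⁻¹ := by positivity
    linarith
  have h1 : 1 < ⌈y⌉₊ := Nat.lt_ceil.2 (by push_cast; linarith)
  have h2 : 2 ^ (Nat.clog 2 ⌈y⌉₊).pred < ⌈y⌉₊ := Nat.pow_pred_clog_lt_self (by norm_num) h1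
  have h3 : 0 < Nat.clog 2 ⌈y⌉₊ := Nat.clog_pos (by norm_num) h1
  obtain ⟨c, hc⟩ : ∃ c, Nat.clog 2 ⌈y⌉₊ = c + 1 := ⟨_, (Nat.succ_pred_eq_of_pos h3).symm⟩
  rw [hc, Nat.pred_succ] at h2
  have h4 : ((2 : ℝ) ^ c) < ⌈y⌉₊ := by exact_mod_cast h2
  have h5 : (⌈y⌉₊ : ℝ) < y + 1 := Nat.ceil_lt_add_one (by linarith)
  rw [precision, ← hy, hc, pow_succ, pow_succ]
  linarith

theorem entry_lt_two_pow_precision {x : ℝ} (hε : 0 ≤ ε) (hδ : 0 < δ) (hx : x ^ 2 ≤ 1 + ε) :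
    x < 2 ^ (precision s ε δ - 1) := by
  refine lt_of_lt_of_le ?_ (le_two_pow_precision (s := s) (ε := ε) (δ := δ))
  have : 0 ≤ 16 * (s : ℝ) ^ 2 * δ⁻¹ := by positivity
  nlinarith [sq_nonneg (x - 1)]

theorem simulation_error_le (hε : 0 ≤ ε) (hδ : 0 < δ) {b : ℕ} (hb : b = precision s ε δ) :
    2 * (28 * (2 * s ^ 2 * 2 ^ b + 2 * s ^ 2 / 2 ^ b) ^ 2 / rounds s b δ +
      2 * (2 * s ^ 2 / 2 ^ b)) ≤ δ := by
  have h1 : 16 * s ^ 2 * δ⁻¹ ≤ (2 : ℝ) ^ b := by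
    have h := le_two_pow_precision (s := s) (ε := ε) (δ := δ)
    rw [← hb] at h
    exact (by linarith : 16 * s ^ 2 * δ⁻¹ ≤ (2 : ℝ) ^ (b - 1)).trans
      (pow_le_pow_right₀ (by norm_num) (Nat.sub_le _ _))
  have hp : (1 : ℝ) ≤ 2 ^ b := one_le_pow₀ (by norm_num)
  have hp0 : (0 : ℝ) < 2 ^ b := by positivity
  have h2 : 2 * s ^ 2 / (2 : ℝ) ^ b ≤ δ / 8 := by
    rw [div_le_iff₀ hp0]
    have := mul_le_mul_of_nonneg_left h1 hδ.le
    have h3 : δ * (16 * (s : ℝ) ^ 2 * δ⁻¹) = 16 * s ^ 2 := by field_simp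
    linarith
  have h3 : 2 * s ^ 2 / (2 : ℝ) ^ b ≤ 2 * s ^ 2 * 2 ^ b :=
    (div_le_self (by positivity) hp).trans (le_mul_of_one_le_right (by positivity) hp)
  have hn : 1792 * (s : ℝ) ^ 4 * (2 ^ b) ^ 2 * δ⁻¹ ≤ rounds s b δ := by
    rw [rounds]
    push_cast
    exact (Nat.le_ceil _).trans (by linarith)
  have hn0 : (0 : ℝ) < rounds s b δ := by
    rw [rounds]
    positivity
  have h4 : 28 * (2 * s ^ 2 * 2 ^ b + 2 * s ^ 2 / (2 : ℝ) ^ b) ^ 2 / rounds s b δ ≤ δ / 4 := by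
    rw [div_le_iff₀ hn0]
    calc 28 * (2 * s ^ 2 * 2 ^ b + 2 * s ^ 2 / (2 : ℝ) ^ b) ^ 2
        ≤ 28 * (2 * s ^ 2 * 2 ^ b + 2 * s ^ 2 * 2 ^ b) ^ 2 := by gcongr
      _ = δ / 4 * (1792 * (s : ℝ) ^ 4 * (2 ^ b) ^ 2 * δ⁻¹) := by field_simp; ring
      _ ≤ _ := by gcongr
  linarith

/-- The constant of the polynomial bound on the resources: their number is at most this
constant times `M ^ 17`, where `M` is the sum of the parameters, and the constant, being larger
than 17, also serves as the exponent. -/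
def costConstant (d : ℕ) : ℕ := 10 ^ 12 * (1 + qubits d)

theorem cost_le {N d b n : ℕ} (hε : 0 ≤ ε) (hδ : 0 < δ) (hb : b = precision s ε δ)
    (hn : n = rounds s b δ) :
    (((simulationCircuit N d s b n).length + numAnc N d s b + b : ℕ) : ℝ) ≤
      costConstant d * (1 + s + qubits N + ε + δ⁻¹) ^ costConstant d := by
  set M : ℝ := 1 + s + qubits N + ε + δ⁻¹ with hM
  have hs0 : (0 : ℝ) ≤ s := Nat.cast_nonneg _
  have hq0 : (0 : ℝ) ≤ qubits N := Nat.cast_nonneg _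
  have hQ0 : (0 : ℝ) ≤ qubits d := Nat.cast_nonneg _
  have hδ0 : 0 < δ⁻¹ := inv_pos.2 hδ
  have hM1 : 1 ≤ M := by linarith
  have hM0 : 0 ≤ M := by linarith
  have hsM : (s : ℝ) ≤ M := by linarith
  have hqM : 1 + (qubits N : ℝ) ≤ M := by linarith
  have hεM : ε ≤ M := by linarith
  have hδM : δ⁻¹ ≤ M := by linarith
  clear_value M
  have hpow : ∀ {i j : ℕ}, i ≤ j → M ^ i ≤ M ^ j := fun h => pow_le_pow_right₀ hM1 h
  -- The powers of `M` multiply up to 17: 11 for the rounds, 5 for the terms, 1 for a step.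
  have h2b : (2 : ℝ) ^ b ≤ 92 * M ^ 3 := by
    rw [hb]
    refine (two_pow_precision_le hε hδ).trans ?_
    calc 4 * (16 * s ^ 2 * δ⁻¹ + 2 * ε + 5) ≤ 4 * (16 * M ^ 2 * M + 2 * M ^ 1 + 5 * M ^ 0) := by
          gcongr <;> simp [hεM]
      _ ≤ 4 * (16 * M ^ 2 * M + 2 * M ^ 3 + 5 * M ^ 3) := by
          gcongr 4 * (_ + 2 * ?_ + 5 * ?_) <;> exact hpow (by norm_num)
      _ = _ := by ring
  have hbM : (b : ℝ) ≤ 92 * M ^ 3 :=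
    (by exact_mod_cast Nat.lt_two_pow_self.le : (b : ℝ) ≤ 2 ^ b).trans h2b
  have hnM : (n : ℝ) ≤ 15167490 * M ^ 11 := by
    rw [hn, rounds]
    push_cast
    have h : (⌈1792 * (s : ℝ) ^ 4 * (2 ^ b) ^ 2 * δ⁻¹⌉₊ : ℝ) <
        1792 * (s : ℝ) ^ 4 * (2 ^ b) ^ 2 * δ⁻¹ + 1 := Nat.ceil_lt_add_one (by positivity)
    have h' : 1792 * (s : ℝ) ^ 4 * (2 ^ b) ^ 2 * δ⁻¹ ≤ 1792 * M ^ 4 * (92 * M ^ 3) ^ 2 * M := by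
      gcongr
    have h'' : 1 ≤ M ^ 11 := one_le_pow₀ hM1
    have h3 : 1792 * M ^ 4 * (92 * M ^ 3) ^ 2 * M = 15167488 * M ^ 11 := by ring
    linarith
  have hstep : 101 + 60 * (qubits N : ℝ) + 30 * qubits d ≤ (161 + 30 * qubits d) * M := by
    have := mul_le_mul_of_nonneg_left hM1 hQ0
    linarith
  have hlen : ((simulationCircuit N d s b n).length : ℝ) ≤
      n * (s * (s * (2 * (2 * b))) * (101 + 60 * qubits N + 30 * qubits d)) + 6 * qubits N := by
    have h := length_evolutionCircuit_le (N := N) (d := d) (s := s) (b := b) n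
    rw [simulationCircuit, List.length_map, List.length_append, length_outputCircuit]
    exact_mod_cast Nat.add_le_add_right h _
  have hlen' : (n * (s * (s * (2 * (2 * b))) * (101 + 60 * qubits N + 30 * qubits d)) : ℝ) ≤
      899 * 10 ^ 9 * (1 + qubits d) * M ^ 17 := by
    calc (n * (s * (s * (2 * (2 * b))) * (101 + 60 * qubits N + 30 * qubits d)) : ℝ)
        ≤ 15167490 * M ^ 11 * (M * (M * (2 * (2 * (92 * M ^ 3)))) *
            ((161 + 30 * qubits d) * M)) := by gcongr
      _ = 15167490 * 368 * (161 + 30 * qubits d) * M ^ 17 := by ring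
      _ ≤ _ := by
          refine mul_le_mul_of_nonneg_right ?_ (by positivity)
          linarith
  have hanc : (numAnc N d s b : ℝ) ≤ 2000 * (1 + qubits d) * M ^ 17 := by
    have h : (numAnc N d s b : ℝ) = 1 + ((qubits N + qubits d) +
        (s * (1 + ((qubits N + qubits d) + (2 * b + 2 * b))) +
        (s * (1 + (qubits N + (2 * b + 2 * b))) +
        ((qubits N + qubits d) + (qubits N + 2) + 1)))) := by
      rw [numAnc, Anc.card_eq]
      push_cast
      ring
    have h1 : (s : ℝ) * (4 * b) ≤ M * (4 * (92 * M ^ 3)) := by gcongr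
    have h2 : (s : ℝ) * (1 + qubits N) ≤ M * M := by gcongr
    have h3 : (s : ℝ) * qubits d ≤ M * qubits d := by gcongr
    have h4 : M * (4 * (92 * M ^ 3)) = 368 * M ^ 4 := by ring
    have h5 : M ^ 4 ≤ M ^ 17 := hpow (by norm_num)
    have h6 : M ^ 2 ≤ M ^ 17 := hpow (by norm_num)
    have h7 : M ^ 1 ≤ M ^ 17 := hpow (by norm_num)
    have h8 : 1 ≤ M ^ 17 := one_le_pow₀ hM1
    rw [pow_one] at h7
    have h9 : M * qubits d ≤ M ^ 17 * qubits d := by gcongr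
    have h10 : (qubits d : ℝ) ≤ M ^ 17 * qubits d := le_mul_of_one_le_left hQ0 h8
    have h11 : M * M = M ^ 2 := by ring
    rw [h]
    linarith
  have hb17 : (b : ℝ) ≤ 92 * (1 + qubits d) * M ^ 17 :=
    calc (b : ℝ) ≤ 92 * 1 * M ^ 3 := by rw [mul_one]; exact hbM
      _ ≤ 92 * (1 + qubits d) * M ^ 17 :=
          mul_le_mul (by linarith) (hpow (by norm_num)) (by positivity) (by positivity)
  have hq17 : 6 * (qubits N : ℝ) ≤ 6 * (1 + qubits d) * M ^ 17 :=
    calc 6 * (qubits N : ℝ) ≤ 6 * 1 * M ^ 1 := by rw [mul_one, pow_one]; linarith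
      _ ≤ 6 * (1 + qubits d) * M ^ 17 :=
          mul_le_mul (by linarith) (hpow (by norm_num)) (by positivity) (by positivity)
  have h17 : 17 ≤ costConstant d := by
    rw [costConstant]
    omega
  have hprod : 0 ≤ (1 + (qubits d : ℝ)) * M ^ 17 := by positivity
  calc (((simulationCircuit N d s b n).length + numAnc N d s b + b : ℕ) : ℝ)
      = (simulationCircuit N d s b n).length + numAnc N d s b + b := by push_cast; rfl
    _ ≤ 10 ^ 12 * ((1 + qubits d) * M ^ 17) := by linarith
    _ = costConstant d * M ^ 17 := by
        rw [costConstant]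
        push_cast
        ring
    _ ≤ _ := mul_le_mul_of_nonneg_left (hpow h17) (Nat.cast_nonneg _)

end Parameters

end SparseIsometry

end

theorem mainTheorem10 (d : ℕ) (hd : 0 < d) :
    ∃ (C : ℝ) (m : ℕ), ∀ (N s : ℕ) (ε : ℝ), 0 ≤ ε →
      (∀ V : Matrix (Fin N × Fin d) (Fin N) ℂ,
        SparseIsometry.RowColSparse V s →
        SparseIsometry.spectralNorm (Vᴴ * V - 1) ≤ ε →
          SparseIsometry.IsQuantumOperation (SparseIsometry.evolutionOp V) ∧
          SparseIsometry.diamondNorm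
              (SparseIsometry.evolutionOp V - SparseIsometry.stinespring V)
            ≤ ENNReal.ofReal (C * ε)) ∧
      (∀ δ : ℝ, 0 < δ →
        ∃ (b k : ℕ) (c : SparseIsometry.Circuit N d s b k),
          ((c.length + k + b : ℕ) : ℝ)
            ≤ m * (1 + s + SparseIsometry.qubits N + ε + δ⁻¹) ^ m ∧
          ∀ V : Matrix (Fin N × Fin d) (Fin N) ℂ,
            SparseIsometry.RowColSparse V s →
            SparseIsometry.spectralNorm (Vᴴ * V - 1) ≤ ε →
            ∀ B : SparseIsometry.BlackBox V s,
              SparseIsometry.diamondNorm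
                  (SparseIsometry.Circuit.op B c -
                    SparseIsometry.encoded (SparseIsometry.evolutionOp V))
                ≤ ENNReal.ofReal δ) := by
  refine ⟨12, SparseIsometry.costConstant d, fun N s ε hε => ⟨fun V _ hV =>
    ⟨SparseIsometry.isQuantumOperation_evolutionOp V,
      SparseIsometry.diamondNorm_evolutionOp_sub_le hε hV⟩, fun δ hδ => ?_⟩⟩
  refine ⟨_, _, SparseIsometry.simulationCircuit N d s (SparseIsometry.precision s ε δ)
    (SparseIsometry.rounds s (SparseIsometry.precision s ε δ) δ),
    SparseIsometry.cost_le hε hδ rfl rfl, fun V _ hV B => ?_⟩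
  refine (SparseIsometry.diamondNorm_simulationCircuit_sub_le B (Nat.succ_pos _) (fun r x => ?_)
    (Nat.succ_pos _)).trans
    (ENNReal.ofReal_le_ofReal (SparseIsometry.simulation_error_le hε hδ rfl))
  exact SparseIsometry.entry_lt_two_pow_precision hε hδ (SparseIsometry.norm_entry_le hV r x)
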